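/- Let $T=V/\Lambda$ be a complex torus of dimension $g>2$, where $V$ is a $g$-dimensional complex vector space and $\Lambda\subset V$ is a discrete lattice of rank $2g$; put $\Lambda_{\mathbb Q}=\Lambda\otimes\mathbb Q=\mathrm H_1(T,\mathbb Q)$. Assume that $T$ is 2-simple: if $H$ is a rational Hodge substructure of $\mathrm H^2(T,\mathbb Q)$ and $H_{\mathbb C}=H\otimes_{\mathbb Q}\mathbb C$ satisfies $H_{\mathbb C}\cap \mathrm H^{2,0}(T)\neq\{0\}$, then $H_{\mathbb C}\supset \mathrm H^{2,0}(T)$. Let $\mathrm{Hdg}(T)$ be the Hodge group of $T$, i.e. the smallest algebraic $\mathbb Q$-subgroup $G$ of $\mathrm{GL}(\Lambda_{\mathbb Q})$ such that $G(\mathbb R)\subset \mathrm{Aut}_{\mathbb R}(V)$ contains the multiplications by all $z\in\mathbb C$ with $|z|=1$, and let $\mathrm{End}^0(T)=\mathrm{End}(T)\otimes\mathbb Q$ be the endomorphism algebra of the complex Lie group $T$. Then $T$ is simple (it has no complex subtori except $\{0\}$ and $T$), and $\mathrm{Hdg}(T)$ is either semisimple or commutative, but not both. It is commutative if and only if $\mathrm{End}^0(T)$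 is a number field of degree $2g$ over $\mathbb Q$. -/

import Mathlib

open scoped TensorProduct

universe u v

/-! ### Algebraic subgroups of `GL(W)` -/

/-- The matrix coefficient `f ↦ φ(f(w))` of an `A`-linear endomorphism `f` of `A ⊗ W`, for a
linear form `φ` on `W` and a vector `w` of `W`. -/
noncomputable def matrixCoeff {k : Type u} {W : Type v} [Field k] [AddCommGroup W] [Module k W]
    {A : Type u} [CommRing A] [Algebra k A] (f : Module.End A (A ⊗[k] W))
    (c : Module.Dual k W × W) : A :=
  Module.Dual.baseChange A c.1 (f (1 ⊗ₜ[k] c.2))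

/-- An algebraic `k`-subgroup of `GL(W)` (`W` a finite-dimensional `k`-vector space), given by its
groups `G(A) ⊆ GL(A ⊗ W)` of points in all commutative `k`-algebras `A`, which have to be cut out
by a system of polynomial equations with coefficients in `k` in the matrix coefficients. -/
@[ext]
structure AlgebraicSubgroup (k : Type u) (W : Type v) [Field k] [AddCommGroup W]
    [Module k W] where
  /-- the group of `A`-points -/
  pts : ∀ (A : Type u) [CommRing A] [Algebra k A],
    Subgroup (LinearMap.GeneralLinearGroup A (A ⊗[k] W))
  exists_equations : ∃ S : Set (MvPolynomial (Module.Dual k W × W) k),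
    ∀ (A : Type u) [CommRing A] [Algebra k A] (f : LinearMap.GeneralLinearGroup A (A ⊗[k] W)),
      f ∈ pts A ↔
        ∀ p ∈ S, MvPolynomial.aeval (matrixCoeff (f : Module.End A (A ⊗[k] W))) p = 0

namespace AlgebraicSubgroup

variable {k : Type u} {W : Type v} [Field k] [AddCommGroup W] [Module k W]

/-- `G ≤ H` means `G(A) ⊆ H(A)` for all commutative `k`-algebras `A`. -/
instance : PartialOrder (AlgebraicSubgroup k W) where
  le G H := ∀ (A : Type u) [CommRing A] [Algebra k A], G.pts A ≤ H.pts A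
  le_refl _ _ _ _ := le_rfl
  le_trans _ _ _ h₁ h₂ A _ _ := (h₁ A).trans (h₂ A)
  le_antisymm G H h₁ h₂ := by
    ext A _ _ : 4
    exact le_antisymm (h₁ A) (h₂ A)

/-- The intersection of a family of algebraic subgroups. -/
instance : InfSet (AlgebraicSubgroup k W) where
  sInf F :=
    { pts := fun A _ _ => ⨅ G ∈ F, G.pts A
      exists_equations := by
        choose S hS using fun G : AlgebraicSubgroup k W => G.exists_equations
        refine ⟨⋃ G ∈ F, S G, fun A _ _ f => ?_⟩
        simp only [Subgroup.mem_iInf, Set.mem_iUnion, hS]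
        exact ⟨fun h p ⟨G, hG, hp⟩ => h G hG p hp, fun h G hG p hp => h p ⟨G, hG, hp⟩⟩ }

theorem isGLB_sInf (F : Set (AlgebraicSubgroup k W)) : IsGLB F (sInf F) := by
  refine ⟨fun G hG A _ _ => iInf₂_le G hG, fun H hH A _ _ => le_iInf₂ fun G hG => hH hG A⟩

/-- The algebraic group `G` is commutative. -/
def IsCommutative (G : AlgebraicSubgroup k W) : Prop :=
  ∀ (A : Type u) [CommRing A] [Algebra k A], ∀ x ∈ G.pts A, ∀ y ∈ G.pts A, x * y = y * x

end AlgebraicSubgroup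

/-- The Zariski topology on `GL(W)`, `W` a finite-dimensional vector space over a field `K`: it is
generated by the sets on which a given polynomial in the matrix coefficients does not vanish. -/
@[reducible]
def zariskiTopology (K : Type u) (W : Type v) [Field K] [AddCommGroup W] [Module K W] :
    TopologicalSpace (LinearMap.GeneralLinearGroup K W) :=
  TopologicalSpace.generateFrom
    {U | ∃ p : MvPolynomial (Module.Dual K W × W) K,
      U = {f : LinearMap.GeneralLinearGroup K W |
        MvPolynomial.eval (fun c => c.1 ((f : Module.End K W) c.2)) p ≠ 0}}

namespace AlgebraicSubgroup

variable {k : Type u} {W : Type v} [Field k] [AddCommGroup W] [Module k W]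

/-- An algebraic group over a field `k` of characteristic zero is semisimple if, over an algebraic
closure `K` of `k`, it is connected and has trivial radical, that is, has no connected solvable
normal algebraic subgroup except the trivial one. In characteristic zero algebraic groups are
reduced, so algebraic groups over `K` can be replaced by their groups of `K`-points. -/
def IsSemisimple [CharZero k] (G : AlgebraicSubgroup k W) : Prop :=
  letI K := AlgebraicClosure k
  letI : TopologicalSpace (LinearMap.GeneralLinearGroup K (K ⊗[k] W)) :=
    zariskiTopology K (K ⊗[k] W)
  IsConnected (G.pts K : Set (LinearMap.GeneralLinearGroup K (K ⊗[k] W))) ∧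
    ∀ N : Subgroup (LinearMap.GeneralLinearGroup K (K ⊗[k] W)),
      N ≤ G.pts K → (∀ g ∈ G.pts K, ∀ n ∈ N, g * n * g⁻¹ ∈ N) →
      IsClosed (N : Set (LinearMap.GeneralLinearGroup K (K ⊗[k] W))) →
      IsConnected (N : Set (LinearMap.GeneralLinearGroup K (K ⊗[k] W))) →
      Group.IsSolvable N → N = ⊥

end AlgebraicSubgroup

/-! ### Complex tori `T = V / Λ` -/

namespace ComplexTorus

variable {V : Type v} [NormedAddCommGroup V] [NormedSpace ℂ V]

/-- The torus `T = V / Λ` is simple: it is nonzero and has no complex subtori `W / (W ∩ Λ)`,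
with `W` a complex subspace in which `W ∩ Λ` is a lattice, except zero and itself. -/
def IsSimple (Λ : Submodule ℤ V) : Prop :=
  Nontrivial V ∧ ∀ W : Submodule ℂ V,
    Submodule.span ℝ ((W : Set V) ∩ (Λ : Set V)) = W.restrictScalars ℝ → W = ⊥ ∨ W = ⊤

/-- The endomorphism ring `End(T)`: every holomorphic endomorphism of the Lie group `V / Λ` is
induced by exactly one `ℂ`-linear endomorphism of `V` that maps `Λ` to itself. -/
def endRing (Λ : Submodule ℤ V) : Subring (Module.End ℂ V) where
  carrier := {f | ∀ x ∈ Λ, f x ∈ Λ}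
  mul_mem' hf hg x hx := hf _ (hg x hx)
  one_mem' _ hx := hx
  add_mem' hf hg x hx := Λ.add_mem (hf x hx) (hg x hx)
  zero_mem' _ _ := Λ.zero_mem
  neg_mem' hf x hx := Λ.neg_mem (hf x hx)

/-- The endomorphism algebra `End⁰(T) = End(T) ⊗ ℚ`. -/
abbrev endAlgebra (Λ : Submodule ℤ V) : Type v := ℚ ⊗[ℤ] endRing Λ

/-! #### Second cohomology and its Hodge structure -/

variable (V) in
/-- `H²(T, ℂ)`: the alternating `ℝ`-bilinear forms on `V = H₁(T, ℝ)` with values in `ℂ`. -/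
noncomputable abbrev H2C : Type v := V [⋀^Fin 2]→ₗ[ℝ] ℂ

/-- `H²(T, ℚ)` inside `H²(T, ℂ)`: the forms that take rational values on the lattice. -/
noncomputable def H2Q (Λ : Submodule ℤ V) : Submodule ℚ (H2C V) where
  carrier := {ω | ∀ x ∈ Λ, ∀ y ∈ Λ, ∃ q : ℚ, ω ![x, y] = q}
  add_mem' {ω η} hω hη x hx y hy := by
    obtain ⟨a, ha⟩ := hω x hx y hy
    obtain ⟨b, hb⟩ := hη x hx y hy
    exact ⟨a + b, by simp [ha, hb]⟩
  zero_mem' _ _ _ _ := ⟨0, by simp⟩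
  smul_mem' c ω hω x hx y hy := by
    obtain ⟨a, ha⟩ := hω x hx y hy
    exact ⟨c * a, by simp [ha, Rat.smul_def]⟩

variable (V) in
/-- `H^{2,0}(T)`: the forms that are `ℂ`-linear in both arguments (alternation transfers the
condition on the first argument to the second one). -/
noncomputable def H20 : Submodule ℂ (H2C V) where
  carrier := {ω | ∀ x y : V, ω ![Complex.I • x, y] = Complex.I * ω ![x, y]}
  add_mem' hω hη x y := by simp [hω x y, hη x y, mul_add]
  zero_mem' := by simp
  smul_mem' c ω hω x y := by simp [hω x y, mul_left_comm]

variable (V) in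
/-- `H^{0,2}(T)`: the forms that are `ℂ`-antilinear in both arguments. -/
noncomputable def H02 : Submodule ℂ (H2C V) where
  carrier := {ω | ∀ x y : V, ω ![Complex.I • x, y] = -Complex.I * ω ![x, y]}
  add_mem' hω hη x y := by
    simp only [AlternatingMap.add_apply, hω x y, hη x y, mul_add]
  zero_mem' := by simp
  smul_mem' c ω hω x y := by
    simp only [AlternatingMap.smul_apply, hω x y, smul_eq_mul, mul_left_comm]

variable (V) in
/-- `H^{1,1}(T)`: the forms that are invariant under multiplication by `i`; indeed
multiplication by `i` in both arguments acts on forms of types `(2,0)`, `(1,1)`, `(0,2)` by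
`i * i = -1`, `i * (-i) = 1`, `(-i) * (-i) = -1`, respectively. -/
noncomputable def H11 : Submodule ℂ (H2C V) where
  carrier := {ω | ∀ x y : V, ω ![Complex.I • x, Complex.I • y] = ω ![x, y]}
  add_mem' hω hη x y := by simp [hω x y, hη x y]
  zero_mem' := by simp
  smul_mem' c ω hω x y := by simp [hω x y]

/-- The complexification `H_ℂ ⊆ H²(T, ℂ)` of a rational subspace `H ⊆ H²(T, ℚ)`. -/
noncomputable def complexification (H : Submodule ℚ (H2C V)) : Submodule ℂ (H2C V) :=
  Submodule.span ℂ (H : Set (H2C V))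

/-- `H` is a rational Hodge substructure of `H²(T, ℚ)`: a rational subspace whose complexification
is the sum of its intersections with the Hodge components. -/
def IsHodgeSubstructure (Λ : Submodule ℤ V) (H : Submodule ℚ (H2C V)) : Prop :=
  H ≤ H2Q Λ ∧
    complexification H =
      (complexification H ⊓ H20 V) ⊔ (complexification H ⊓ H11 V) ⊔ (complexification H ⊓ H02 V)

/-- `T` is 2-simple: if the complexification of a rational Hodge substructure `H` of `H²(T, ℚ)`
meets `H^{2,0}(T)` nontrivially, then it contains `H^{2,0}(T)`. -/
def IsTwoSimple (Λ : Submodule ℤ V) : Prop :=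
  ∀ H : Submodule ℚ (H2C V), IsHodgeSubstructure Λ H →
    complexification H ⊓ H20 V ≠ ⊥ → H20 V ≤ complexification H

/-! #### The Hodge group -/

/-- `Λ_ℚ = Λ ⊗ ℚ = H₁(T, ℚ)`. -/
abbrev rationalLattice (Λ : Submodule ℤ V) : Type v := ℚ ⊗[ℤ] Λ

section

variable [FiniteDimensional ℂ V] (Λ : Submodule ℤ V) [DiscreteTopology Λ] [IsZLattice ℝ Λ]

theorem bijective_liftBaseChange_subtype :
    Function.Bijective (LinearMap.liftBaseChange ℝ Λ.subtype) := by
  let b := Module.Free.chooseBasis ℤ Λ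
  have h : LinearMap.liftBaseChange ℝ Λ.subtype =
      ((b.baseChange ℝ).equiv (b.ofZLatticeBasis ℝ Λ) (Equiv.refl _)).toLinearMap := by
    refine (b.baseChange ℝ).ext fun i => ?_
    simpa using (Module.Basis.equiv_apply (b := b.baseChange ℝ) i
      (b.ofZLatticeBasis ℝ Λ) (Equiv.refl _)).symm
  rw [h]
  exact LinearEquiv.bijective _

/-- The canonical isomorphism `ℝ ⊗ Λ_ℚ ≃ V`, which maps `r ⊗ (q ⊗ x)` to `r q x`. -/
noncomputable def realificationEquiv : (ℝ ⊗[ℚ] rationalLattice Λ) ≃ₗ[ℝ] V :=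
  (TensorProduct.AlgebraTensorModule.cancelBaseChange ℤ ℚ ℝ ℝ Λ).trans
    (LinearEquiv.ofBijective _ (bijective_liftBaseChange_subtype Λ))

theorem realificationEquiv_tmul (r : ℝ) (q : ℚ) (x : Λ) :
    realificationEquiv Λ (r ⊗ₜ[ℚ] (q ⊗ₜ[ℤ] x)) = (r * q) • (x : V) := by
  simp [realificationEquiv, Algebra.smul_def, mul_comm]

/-- The homomorphism `h` from the unit circle to `GL(ℝ ⊗ Λ_ℚ)`: `h(z)` is multiplication by `z` on
`V = ℝ ⊗ Λ_ℚ`. -/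
noncomputable def circleHom :
    Circle →* LinearMap.GeneralLinearGroup ℝ (ℝ ⊗[ℚ] rationalLattice Λ) :=
  MonoidHom.toHomUnits
    { toFun := fun z => (realificationEquiv Λ).symm.toLinearMap ∘ₗ
        (LinearMap.lsmul ℂ V (z : ℂ)).restrictScalars ℝ ∘ₗ (realificationEquiv Λ).toLinearMap
      map_one' := by ext x; simp
      map_mul' := fun z w => LinearMap.ext fun x => by
        simpa [SemigroupAction.mul_smul] using smul_comm _ _ _ }

theorem realificationEquiv_circleHom (z : Circle) (x : ℝ ⊗[ℚ] rationalLattice Λ) :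
    realificationEquiv Λ ((circleHom Λ z : Module.End ℝ (ℝ ⊗[ℚ] rationalLattice Λ)) x) =
      (z : ℂ) • realificationEquiv Λ x := by
  simp [circleHom]

/-- The Hodge group `Hdg(T)`: the smallest algebraic `ℚ`-subgroup `G` of `GL(Λ_ℚ)` such that `G(ℝ)`
contains `h(z)` for all complex numbers `z` of absolute value one. -/
noncomputable def hodgeGroup : AlgebraicSubgroup ℚ (rationalLattice Λ) :=
  sInf {G | (circleHom Λ).range ≤ G.pts ℝ}

theorem isLeast_hodgeGroup :
    IsLeast {G : AlgebraicSubgroup ℚ (rationalLattice Λ) | (circleHom Λ).range ≤ G.pts ℝ}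
      (hodgeGroup Λ) :=
  ⟨show (circleHom Λ).range ≤ ⨅ G ∈ _, AlgebraicSubgroup.pts G ℝ from
    le_iInf₂ fun _ hG => hG, (AlgebraicSubgroup.isGLB_sInf _).1⟩

end

end ComplexTorus

open scoped commutatorElement

/-! ### Galois descent and specialization -/

/-! Write W for Λ_ℚ, G for the Hodge group, D for the algebra of endomorphisms of W that commute
with the circle (a copy of End⁰(T)), E for the centre of D, and K for an algebraic closure of ℚ.

A subspace of H²(T, ℂ) that contains the rational components of its elements and is stable under
pull-back by complex scalars is the complexification of a Hodge substructure. By 2-simplicity it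
contains H^{2,0} or meets it in zero (`IsTwoSimple.le_of_ne_bot`). A proper nonzero subtorus V₁
contradicts this: take the forms with V₁ in their radical if V₁ has codimension at least two, and
the forms for which V₁ is isotropic if V₁ is a hyperplane, where g > 2 is needed
(`IsTwoSimple.isSimple`). So W has no proper nonzero rational subspace stable under the circle, and
by Schur's lemma D is a division algebra and E a field.

The dichotomy comes from the balanced forms: ω(ex, y) = ω(x, ey) for all e in E. If they contain
H^{2,0}, every vector of V is an eigenvector of every e, which forces E = ℚ; then central points of
G(K) are scalars of determinant one. Otherwise balanced forms are of type (1,1). A nonzero rational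
one is invariant under the circle, hence under G, and a central point a, which lies in K ⊗ E,
satisfies a² = 1. If there is no nonzero rational one, W is a line over E, because two independent
vectors would give an E-bilinear alternating form, and a functional E → ℚ would make it rational;
then D = E has degree 2g. In the first two cases the centre of G(K) has bounded order and G is
semisimple; in the last one G commutes with D, which has a cyclic vector, and G is commutative. Both
at once is impossible: G(K) would be trivial and every line of W stable (`isSemisimple_or_isField`,
`not_isCommutative_of_isSemisimple`).

For semisimplicity, K ⊗ W is the sum of its minimal G(K)-stable subspaces. A commutative normal
subgroup acts on each of them by scalars, since connectedness of G(K) prevents it from permuting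
finitely many eigenvalues. Such a subgroup is central, and trivial if it is connected and of bounded
exponent; descending the derived series disposes of connected solvable normal subgroups
(`eq_bot_of_solvable_normal`).

All this needs G(K) to be connected and to satisfy the same rational equations as the circle. The
K-points of the closures of the circle, for all embeddings of K in ℂ, generate a Galois stable group
`circleGroup`. Analyticity in the angle makes these closures irreducible, the Nullstellensatz
supplies enough K-points, and Galois descent makes the closure of `circleGroup` an algebraic
ℚ-subgroup containing the circle. By minimality G lies in it, so `circleGroup` is dense in G(K)
(`isConnected_pts`). -/

/-- Artin's independence of conjugates: if `κ` is linearly independent over `k`, then so are the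
vectors of conjugates over `K`. -/
theorem finsupp_eq_zero_of_sum_conj {k K ι : Type*} [Field k] [Field K] [Algebra k K]
    [IsGalois k K] {κ : ι → K} (hκ : LinearIndependent k κ) (y : ι →₀ K)
    (hy : ∀ σ : K ≃ₐ[k] K, (y.sum fun i a => a * σ (κ i)) = 0) : y = 0 := by
  classical
  by_contra hne
  have main : ∀ n : ℕ, ∀ y : ι →₀ K, y.support.card = n → y ≠ 0 →
      (∀ σ : K ≃ₐ[k] K, (y.sum fun i a => a * σ (κ i)) = 0) → False := by
    intro n
    induction n using Nat.strong_induction_on with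
    | _ n ih =>
      intro y hn hy0 hy
      obtain ⟨i₀, hi₀⟩ := Finsupp.ne_iff.1 hy0
      rw [Finsupp.zero_apply] at hi₀
      -- A shortest relation, normalized to have one coefficient 1, either has coefficients in k,
      -- against independence at σ = 1, or is shortened by passing to τz - z, which stays nonzero.
      set z : ι →₀ K := (y i₀)⁻¹ • y with hz
      have hz1 : z i₀ = 1 := by simp [hz, hi₀]
      have hzs : ∀ σ : K ≃ₐ[k] K, (z.sum fun i a => a * σ (κ i)) = 0 := by
        intro σ
        rw [hz, Finsupp.sum_smul_index' (by simp)]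
        simp only [smul_eq_mul, mul_assoc]
        rw [← Finsupp.mul_sum, hy, mul_zero]
      have hsupp : z.support = y.support :=
        Finsupp.support_smul_eq (inv_ne_zero hi₀)
      by_cases hfix : ∀ i, ∀ τ : K ≃ₐ[k] K, τ (z i) = z i
      · have h1 : ∀ i, ∃ c : k, algebraMap k K c = z i := fun i => by
          have := (InfiniteGalois.mem_bot_iff_fixed (k := k) (z i)).2 (hfix i)
          exact IntermediateField.mem_bot.1 this
        choose c hc using h1
        have h2 := hzs 1
        rw [Finsupp.sum] at h2
        have h3 : ∑ i ∈ z.support, c i • κ i = 0 := by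
          rw [← h2]
          refine Finset.sum_congr rfl fun i _ => ?_
          rw [Algebra.smul_def, hc]; rfl
        have h4 := linearIndependent_iff'.1 hκ _ _ h3 i₀ (by simp [hz1])
        have h5 := hc i₀
        rw [h4, hz1, map_zero] at h5
        exact zero_ne_one h5
      · push Not at hfix
        obtain ⟨i₁, τ, hτ⟩ := hfix
        set w : ι →₀ K := z.mapRange τ (map_zero τ) - z with hw
        have hwap : ∀ i, w i = τ (z i) - z i := fun i => by simp [hw]
        refine ih w.support.card ?_ w rfl ?_ ?_
        · rw [← hn, ← hsupp]
          refine Finset.card_lt_card ⟨fun i hi => ?_, fun h => ?_⟩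
          · rw [Finsupp.mem_support_iff] at hi ⊢
            intro h0
            exact hi (by rw [hwap, h0, map_zero, sub_zero])
          · have : i₀ ∈ w.support := h (by simp [hz1])
            rw [Finsupp.mem_support_iff, hwap, hz1, map_one, sub_self] at this
            exact this rfl
        · intro h0
          have := hwap i₁
          rw [h0, Finsupp.zero_apply] at this
          exact hτ (sub_eq_zero.1 this.symm)
        · intro σ
          rw [hw, Finsupp.sum_sub_index (by intros; ring), hzs, sub_zero,
            Finsupp.sum_mapRange_index (by simp)]
          -- The relation for τz at σ is τ applied to the relation for z at τ⁻¹σ.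
          have := congrArg τ (hzs (τ⁻¹ * σ))
          rw [map_zero, map_finsuppSum] at this
          rw [← this]
          refine Finsupp.sum_congr fun i _ => ?_
          rw [map_mul, AlgEquiv.mul_apply]
          congr 1
          exact (τ.apply_symm_apply _).symm
  exact main _ y rfl hne hy

/-- Galois descent: an element of `K ⊗ M` that is annihilated by a Galois stable set of `k`-linear
maps `M → K` comes from the common kernel of these maps. -/
theorem mem_baseChange_of_forall_liftBaseChange {k K M : Type*} [Field k] [Field K] [Algebra k K]
    [IsGalois k K] [AddCommGroup M] [Module k M] (Φ : Set (M →ₗ[k] K))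
    (hΦ : ∀ σ : K ≃ₐ[k] K, ∀ φ ∈ Φ, σ.toLinearMap ∘ₗ φ ∈ Φ) (t : K ⊗[k] M)
    (ht : ∀ φ ∈ Φ, LinearMap.liftBaseChange K φ t = 0) :
    t ∈ Submodule.baseChange K (⨅ φ ∈ Φ, LinearMap.ker φ) := by
  obtain ⟨c, rfl⟩ := TensorProduct.eq_repr_basis_left (Module.Free.chooseBasis k K) t
  set κ := Module.Free.chooseBasis k K
  refine Submodule.sum_mem _ fun i _ => ?_
  have : c i ∈ ⨅ φ ∈ Φ, LinearMap.ker φ := by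
    simp only [Submodule.mem_iInf, LinearMap.mem_ker]
    intro φ hφ
    -- With t = Σ κᵢ ⊗ cᵢ, applying σ to the vanishing of σ⁻¹φ on t gives Σ φ(cᵢ) σ(κᵢ) = 0 for all
    -- σ.
    have key := finsupp_eq_zero_of_sum_conj κ.linearIndependent
      (c.mapRange φ (map_zero φ)) (fun σ => ?_)
    · simpa using DFunLike.congr_fun key i
    · have h1 := ht _ (hΦ σ.symm φ hφ)
      rw [Finsupp.sum, map_sum] at h1
      simp only [LinearMap.liftBaseChange_tmul, LinearMap.comp_apply, AlgEquiv.toLinearMap_apply,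
        smul_eq_mul] at h1
      have h2 := congrArg σ h1
      rw [map_sum, map_zero] at h2
      rw [Finsupp.sum_mapRange_index (by simp), Finsupp.sum, ← h2]
      refine Finset.sum_congr rfl fun j _ => ?_
      rw [map_mul, AlgEquiv.apply_symm_apply, mul_comm]
  have h2 := Submodule.tmul_mem_baseChange_of_mem (A := K) (κ i) this
  exact h2

/-- A nontrivial finitely generated algebra over an algebraically closed field has a point. -/
theorem nonempty_algHom_of_finiteType (K R : Type*) [Field K] [IsAlgClosed K] [CommRing R]
    [Nontrivial R] [Algebra K R] [Algebra.FiniteType K R] : Nonempty (R →ₐ[K] K) := by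
  obtain ⟨m, hm⟩ := Ideal.exists_maximal R
  let : Field (R ⧸ m) := Ideal.Quotient.field m
  have : Algebra.FiniteType K (R ⧸ m) :=
    Algebra.FiniteType.of_surjective (Ideal.Quotient.mkₐ K m) (Ideal.Quotient.mkₐ_surjective K m)
  -- Zariski's lemma: the residue field is finite over K, hence equal to K.
  have : Module.Finite K (R ⧸ m) := finite_of_finite_type_of_isJacobsonRing K (R ⧸ m)
  have hb : Function.Bijective (algebraMap K (R ⧸ m)) :=
    IsAlgClosed.algebraMap_bijective_of_isIntegral
  let e : K ≃ₐ[K] (R ⧸ m) := AlgEquiv.ofBijective (Algebra.ofId K (R ⧸ m)) hb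
  exact ⟨e.symm.toAlgHom.comp (Ideal.Quotient.mkₐ K m)⟩

/-! ### Matrix coefficients -/

section MatrixCoeff

variable {k : Type u} {W : Type v} [Field k] [AddCommGroup W] [Module k W]
  {ι : Type*} [Fintype ι]
  {A : Type u} [CommRing A] [Algebra k A]

variable (k W) in
/-- The polynomial ring in the matrix coefficients. -/
abbrev CoeffRing : Type (max u v) := MvPolynomial (Module.Dual k W × W) k

/-- Evaluation of polynomials in the matrix coefficients at an endomorphism. -/
noncomputable def evalCoeff (f : Module.End A (A ⊗[k] W)) : CoeffRing k W →ₐ[k] A :=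
  MvPolynomial.aeval (matrixCoeff f)

@[simp]
theorem evalCoeff_X (f : Module.End A (A ⊗[k] W)) (c : Module.Dual k W × W) :
    evalCoeff f (MvPolynomial.X c) = matrixCoeff f c := by
  simp [evalCoeff]

theorem matrixCoeff_one (φ : Module.Dual k W) (w : W) :
    matrixCoeff (1 : Module.End A (A ⊗[k] W)) (φ, w) = algebraMap k A (φ w) := by
  simp [matrixCoeff, Module.Dual.baseChange_apply_tmul, Algebra.algebraMap_eq_smul_one]

theorem apply_one_tmul_eq_sum (b : Module.Basis ι k W) (f : Module.End A (A ⊗[k] W)) (w : W) :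
    f (1 ⊗ₜ w) = ∑ i, matrixCoeff f (b.coord i, w) • ((1 : A) ⊗ₜ[k] b i) := by
  have h := (b.baseChange A).sum_repr (f (1 ⊗ₜ w))
  rw [← h]
  refine Finset.sum_congr rfl fun i _ => ?_
  rw [Module.Basis.baseChange_apply]
  congr 1
  have : ∀ x : A ⊗[k] W, (b.baseChange A).repr x i = Module.Dual.baseChange A (b.coord i) x := by
    intro x
    induction x with
    | zero => simp
    | add x y hx hy => simp [hx, hy]
    | tmul a w => simp [Module.Dual.baseChange_apply_tmul]
  simp only [this]; rfl

theorem dual_baseChange_apply_one_tmul (φ : Module.Dual k W) (w : W) :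
    Module.Dual.baseChange A φ (1 ⊗ₜ w) = algebraMap k A (φ w) := by
  simp [Module.Dual.baseChange_apply_tmul, Algebra.algebraMap_eq_smul_one]

theorem matrixCoeff_mul (b : Module.Basis ι k W) (f g : Module.End A (A ⊗[k] W))
    (φ : Module.Dual k W) (w : W) :
    matrixCoeff (f * g) (φ, w) = ∑ i, matrixCoeff f (φ, b i) * matrixCoeff g (b.coord i, w) := by
  rw [matrixCoeff, Module.End.mul_apply]
  simp only
  rw [apply_one_tmul_eq_sum b g w]
  simp [matrixCoeff, mul_comm]

theorem matrixCoeff_eq_sum (b : Module.Basis ι k W) (f : Module.End A (A ⊗[k] W))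
    (φ : Module.Dual k W) (w : W) :
    matrixCoeff f (φ, w) =
      ∑ i, ∑ j, algebraMap k A (φ (b i) * b.repr w j) * matrixCoeff f (b.coord i, b j) := by
  have h : (1 : A) ⊗ₜ[k] w = ∑ j, algebraMap k A (b.repr w j) • ((1 : A) ⊗ₜ[k] b j) := by
    conv_lhs => rw [← b.sum_repr w]
    simp only [TensorProduct.tmul_sum, TensorProduct.tmul_smul, algebraMap_smul]
  rw [matrixCoeff]
  simp only
  rw [h, map_sum, map_sum, Finset.sum_comm]
  refine Finset.sum_congr rfl fun j _ => ?_
  rw [map_smul, apply_one_tmul_eq_sum b f (b j), map_smul, map_sum, smul_eq_mul, Finset.mul_sum]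
  refine Finset.sum_congr rfl fun i _ => ?_
  rw [map_smul, dual_baseChange_apply_one_tmul, smul_eq_mul, map_mul]
  ring

theorem end_ext_of_one_tmul {f g : Module.End A (A ⊗[k] W)}
    (h : ∀ w : W, f (1 ⊗ₜ w) = g (1 ⊗ₜ w)) : f = g := by
  refine LinearMap.ext fun x => ?_
  induction x with
  | zero => simp
  | add x y hx hy => simp [hx, hy]
  | tmul a w =>
    have : a ⊗ₜ[k] w = a • ((1 : A) ⊗ₜ[k] w) := by simp [TensorProduct.smul_tmul']
    rw [this, map_smul, map_smul, h]

/-- Comultiplication: matrix coefficients of a product. -/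
noncomputable def comulCoeff (b : Module.Basis ι k W) :
    CoeffRing k W →ₐ[k] CoeffRing k W ⊗[k] CoeffRing k W :=
  MvPolynomial.aeval fun c =>
    ∑ i, (MvPolynomial.X (c.1, b i) : CoeffRing k W) ⊗ₜ[k]
      (MvPolynomial.X (b.coord i, c.2) : CoeffRing k W)

theorem evalCoeff_mul (b : Module.Basis ι k W) (f g : Module.End A (A ⊗[k] W))
    (p : CoeffRing k W) :
    evalCoeff (f * g) p =
      Algebra.TensorProduct.productMap (evalCoeff f) (evalCoeff g) (comulCoeff b p) := by
  have : evalCoeff (f * g) =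
      (Algebra.TensorProduct.productMap (evalCoeff f) (evalCoeff g)).comp (comulCoeff b) := by
    refine MvPolynomial.algHom_ext fun c => ?_
    simp [comulCoeff, matrixCoeff_mul b f g c.1 c.2]
  rw [this]; rfl

variable [DecidableEq ι]

theorem toMatrix_baseChange_apply (b : Module.Basis ι k W) (f : Module.End A (A ⊗[k] W))
    (i j : ι) :
    LinearMap.toMatrix (b.baseChange A) (b.baseChange A) f i j =
      matrixCoeff f (b.coord i, b j) := by
  rw [LinearMap.toMatrix_apply, Module.Basis.baseChange_apply, apply_one_tmul_eq_sum b f (b j)]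
  simp [Finsupp.single_apply]

/-- The generic matrix with respect to a basis. -/
noncomputable def genericMatrix (b : Module.Basis ι k W) : Matrix ι ι (CoeffRing k W) :=
  Matrix.of fun i j => MvPolynomial.X (b.coord i, b j)

theorem map_genericMatrix (b : Module.Basis ι k W) (f : Module.End A (A ⊗[k] W)) :
    (genericMatrix b).map (evalCoeff f) =
      LinearMap.toMatrix (b.baseChange A) (b.baseChange A) f := by
  ext i j
  simp [genericMatrix, toMatrix_baseChange_apply]

theorem evalCoeff_det (b : Module.Basis ι k W) (f : Module.End A (A ⊗[k] W)) :
    evalCoeff f (genericMatrix b).det = LinearMap.det f := by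
  rw [AlgHom.map_det, AlgHom.mapMatrix_apply, map_genericMatrix, LinearMap.det_toMatrix]

/-- The antipode of the special linear group: matrix coefficients of the adjugate. -/
noncomputable def antipodeCoeff (b : Module.Basis ι k W) : CoeffRing k W →ₐ[k] CoeffRing k W :=
  MvPolynomial.aeval fun c =>
    ∑ i, ∑ j, algebraMap k _ (c.1 (b i) * b.repr c.2 j) * (genericMatrix b).adjugate i j

/-- In determinant one the adjugate is the inverse, so inversion is polynomial in the matrix
coefficients and the inverse of the determinant need not be adjoined to `CoeffRing`. -/
theorem evalCoeff_inv (b : Module.Basis ι k W) (f : LinearMap.GeneralLinearGroup A (A ⊗[k] W))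
    (hf : LinearMap.det (f : Module.End A (A ⊗[k] W)) = 1) (p : CoeffRing k W) :
    evalCoeff (f⁻¹ : LinearMap.GeneralLinearGroup A (A ⊗[k] W)).val p =
      evalCoeff f.val (antipodeCoeff b p) := by
  have hadj : (LinearMap.toMatrix (b.baseChange A) (b.baseChange A) f.val).adjugate =
      LinearMap.toMatrix (b.baseChange A) (b.baseChange A) (f⁻¹).val := by
    set M := LinearMap.toMatrix (b.baseChange A) (b.baseChange A) f.val
    set N := LinearMap.toMatrix (b.baseChange A) (b.baseChange A) (f⁻¹).val
    have h1 : M * N = 1 := by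
      rw [← LinearMap.toMatrix_mul, ← Units.val_mul, mul_inv_cancel, Units.val_one,
        LinearMap.toMatrix_one]
    have h2 : M.adjugate * M = 1 := by
      rw [Matrix.adjugate_mul, LinearMap.det_toMatrix, hf, one_smul]
    calc M.adjugate = M.adjugate * (M * N) := by rw [h1, mul_one]
      _ = N := by rw [← mul_assoc, h2, one_mul]
  have : evalCoeff (f⁻¹).val = (evalCoeff f.val).comp (antipodeCoeff b) := by
    refine MvPolynomial.algHom_ext fun c => ?_
    rw [evalCoeff_X, matrixCoeff_eq_sum b (f⁻¹).val c.1 c.2]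
    simp only [antipodeCoeff, AlgHom.comp_apply, MvPolynomial.aeval_X, map_sum, map_mul,
      AlgHom.commutes]
    refine Finset.sum_congr rfl fun i _ => Finset.sum_congr rfl fun j _ => ?_
    rw [← toMatrix_baseChange_apply, ← hadj, ← map_genericMatrix]
    congr 1
    have := AlgHom.map_adjugate (evalCoeff f.val) (genericMatrix b)
    rw [AlgHom.mapMatrix_apply, AlgHom.mapMatrix_apply] at this
    rw [← this, Matrix.map_apply]
  rw [this]; rfl

end MatrixCoeff

/-! ### The Galois action and descent of algebraic subgroups -/

theorem baseChange_apply_eq_zero_of_mem {k A M N : Type*} [CommRing k] [CommRing A] [Algebra k A]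
    [AddCommGroup M] [Module k M] [AddCommGroup N] [Module k N] {I : Submodule k M}
    (ψ : M →ₗ[k] N) (hψ : ∀ m ∈ I, ψ m = 0) {t : A ⊗[k] M} (ht : t ∈ I.baseChange A) :
    LinearMap.baseChange A ψ t = 0 := by
  rw [Submodule.baseChange_eq_span] at ht
  induction ht using Submodule.span_induction with
  | mem x hx =>
    obtain ⟨m, hm, rfl⟩ := hx
    simp [hψ m hm]
  | zero => simp
  | add x y _ _ hx hy => rw [map_add, hx, hy, add_zero]
  | smul a x _ hx => rw [map_smul, hx, smul_zero]

section Galois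

variable {k : Type u} {K : Type u} {W : Type v} [Field k] [Field K] [Algebra k K]
  [AddCommGroup W] [Module k W]

variable (W) in
/-- The semilinear action of the Galois group on `K ⊗ W`. -/
noncomputable def galAct (σ : K ≃ₐ[k] K) : K ⊗[k] W →ₗ[k] K ⊗[k] W :=
  LinearMap.rTensor W σ.toLinearMap

@[simp]
theorem galAct_tmul (σ : K ≃ₐ[k] K) (a : K) (w : W) : galAct W σ (a ⊗ₜ w) = σ a ⊗ₜ w := rfl

theorem galAct_smul (σ : K ≃ₐ[k] K) (a : K) (x : K ⊗[k] W) :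
    galAct W σ (a • x) = σ a • galAct W σ x := by
  induction x with
  | zero => simp
  | add x y hx hy => simp [hx, hy]
  | tmul b w => simp [TensorProduct.smul_tmul']

theorem galAct_symm_galAct (σ : K ≃ₐ[k] K) (x : K ⊗[k] W) :
    galAct W σ.symm (galAct W σ x) = x := by
  induction x with
  | zero => simp
  | add x y hx hy => simp [hx, hy]
  | tmul b w => simp

theorem galAct_galAct_symm (σ : K ≃ₐ[k] K) (x : K ⊗[k] W) :
    galAct W σ (galAct W σ.symm x) = x := galAct_symm_galAct σ.symm x

theorem dual_baseChange_galAct (σ : K ≃ₐ[k] K) (φ : Module.Dual k W) (x : K ⊗[k] W) :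
    Module.Dual.baseChange K φ (galAct W σ x) = σ (Module.Dual.baseChange K φ x) := by
  induction x with
  | zero => simp
  | add x y hx hy => simp [hx, hy]
  | tmul b w => simp [Module.Dual.baseChange_apply_tmul]

variable (W) in
/-- The Galois action on endomorphisms of `K ⊗ W`. -/
noncomputable def galConjEnd (σ : K ≃ₐ[k] K) : Module.End K (K ⊗[k] W) →* Module.End K (K ⊗[k] W)
    where
  toFun f :=
    { toFun := fun x => galAct W σ (f (galAct W σ.symm x))
      map_add' := fun x y => by simp
      map_smul' := fun a x => by simp [galAct_smul] }
  map_one' := LinearMap.ext fun x => galAct_galAct_symm σ x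
  map_mul' f g := LinearMap.ext fun x => by simp [galAct_symm_galAct]

variable (W) in
/-- The Galois action on the general linear group of `K ⊗ W`. -/
noncomputable def galConj (σ : K ≃ₐ[k] K) :
    LinearMap.GeneralLinearGroup K (K ⊗[k] W) →* LinearMap.GeneralLinearGroup K (K ⊗[k] W) :=
  Units.map (galConjEnd W σ)

theorem galConj_apply (σ : K ≃ₐ[k] K) (g : LinearMap.GeneralLinearGroup K (K ⊗[k] W))
    (x : K ⊗[k] W) :
    (galConj W σ g).val x = galAct W σ (g.val (galAct W σ.symm x)) := rfl

theorem galConj_galAct (σ : K ≃ₐ[k] K) (g : LinearMap.GeneralLinearGroup K (K ⊗[k] W))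
    (x : K ⊗[k] W) :
    (galConj W σ g).val (galAct W σ x) = galAct W σ (g.val x) := by
  rw [galConj_apply, galAct_symm_galAct]

theorem matrixCoeff_galConj (σ : K ≃ₐ[k] K) (g : LinearMap.GeneralLinearGroup K (K ⊗[k] W))
    (c : Module.Dual k W × W) :
    matrixCoeff (galConj W σ g).val c = σ (matrixCoeff g.val c) := by
  rw [matrixCoeff, galConj_apply, galAct_tmul, map_one, dual_baseChange_galAct]; rfl

theorem evalCoeff_galConj (σ : K ≃ₐ[k] K) (g : LinearMap.GeneralLinearGroup K (K ⊗[k] W))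
    (p : CoeffRing k W) : evalCoeff (galConj W σ g).val p = σ (evalCoeff g.val p) := by
  have : evalCoeff (galConj W σ g).val = σ.toAlgHom.comp (evalCoeff g.val) := by
    refine MvPolynomial.algHom_ext fun c => ?_
    simp [matrixCoeff_galConj]
  rw [this]; rfl

/-- The points over `K` of an algebraic `k`-subgroup are stable under the Galois group. -/
theorem AlgebraicSubgroup.galConj_mem (G : AlgebraicSubgroup k W) (σ : K ≃ₐ[k] K)
    {g : LinearMap.GeneralLinearGroup K (K ⊗[k] W)} (hg : g ∈ G.pts K) :
    galConj W σ g ∈ G.pts K := by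
  obtain ⟨S, hS⟩ := G.exists_equations
  rw [hS] at hg ⊢
  intro p hp
  have := evalCoeff_galConj σ g p
  rw [evalCoeff, evalCoeff, hg p hp, map_zero] at this
  exact this

/-- A Galois stable subspace of `K ⊗ W` is spanned by its rational vectors. -/
theorem mem_span_rational_of_galAct_stable [IsGalois k K] (U : Submodule K (K ⊗[k] W))
    (hU : ∀ σ : K ≃ₐ[k] K, ∀ x ∈ U, galAct W σ x ∈ U) {x : K ⊗[k] W} (hx : x ∈ U) :
    x ∈ ((U.restrictScalars k).comap (TensorProduct.mk k K W 1)).baseChange K := by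
  -- The functionals on W whose K-linear extension kills U form a Galois stable set, to which
  -- descent applies.
  let Φ : Set (W →ₗ[k] K) := {φ | ∀ y ∈ U, LinearMap.liftBaseChange K φ y = 0}
  have hconj : ∀ (σ : K ≃ₐ[k] K) (φ : W →ₗ[k] K) (y : K ⊗[k] W),
      LinearMap.liftBaseChange K (σ.toLinearMap ∘ₗ φ) y =
        σ (LinearMap.liftBaseChange K φ (galAct W σ.symm y)) := by
    intro σ φ y
    induction y with
    | zero => simp
    | add x y hx hy => simp [hx, hy]
    | tmul a w => simp
  have h := mem_baseChange_of_forall_liftBaseChange Φ (fun σ φ hφ y hy => by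
    rw [hconj, hφ _ (hU _ _ hy), map_zero]) x (fun φ hφ => hφ x hx)
  refine Submodule.baseChange_mono (A := K) ?_ h
  intro w hw
  simp only [Submodule.mem_iInf, LinearMap.mem_ker] at hw
  rw [Submodule.mem_comap, Submodule.restrictScalars_mem]
  -- A rational vector outside U would be separated from U by a K-linear functional, whose
  -- restriction to W belongs to Φ.
  by_contra hnot
  obtain ⟨f, hf1, hf2⟩ := Submodule.exists_le_ker_of_notMem hnot
  refine hf1 ?_
  have h3 : LinearMap.liftBaseChange K (f.restrictScalars k ∘ₗ TensorProduct.mk k K W 1) = f := by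
    ext w
    simp
  have h4 := hw (f.restrictScalars k ∘ₗ TensorProduct.mk k K W 1) (fun y hy => by
    rw [h3]; exact hf2 hy)
  exact h4

end Galois

/-! ### Zariski closures over the ground field of Galois stable groups. -/

section Descent

variable {k : Type u} {K : Type u} {W : Type v} [Field k] [Field K] [Algebra k K]
  [AddCommGroup W] [Module k W]

/-- The polynomials over `k` in the matrix coefficients that vanish on a set. -/
def vanishingCoeff (Γ : Subgroup (LinearMap.GeneralLinearGroup K (K ⊗[k] W))) :
    Set (CoeffRing k W) := {p | ∀ γ ∈ Γ, evalCoeff γ.val p = 0}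

variable [IsGalois k K]

/-- Galois descent for equations: the evaluations at the points of Γ form a Galois stable set of
functionals, so the equations over K for Γ are spanned by equations over k. -/
theorem mem_baseChange_vanishing (Γ : Subgroup (LinearMap.GeneralLinearGroup K (K ⊗[k] W)))
    (hgal : ∀ σ : K ≃ₐ[k] K, ∀ γ ∈ Γ, galConj W σ γ ∈ Γ)
    (t : K ⊗[k] CoeffRing k W)
    (ht : ∀ γ ∈ Γ, Algebra.TensorProduct.productMap (AlgHom.id k K) (evalCoeff γ.val) t = 0) :
    t ∈ (⨅ γ ∈ Γ, LinearMap.ker (evalCoeff γ.val).toLinearMap).baseChange K := by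
  have h := mem_baseChange_of_forall_liftBaseChange
    {φ : CoeffRing k W →ₗ[k] K | ∃ γ ∈ Γ, φ = (evalCoeff γ.val).toLinearMap} ?_ t ?_
  · refine Submodule.baseChange_mono (A := K) ?_ h
    refine le_iInf₂ fun γ hγ => ?_
    exact iInf₂_le _ ⟨γ, hγ, rfl⟩
  · rintro σ _ ⟨γ, hγ, rfl⟩
    refine ⟨_, hgal σ γ hγ, LinearMap.ext fun p => ?_⟩
    simp [evalCoeff_galConj]
  · rintro _ ⟨γ, hγ, rfl⟩
    rw [← ht γ hγ]
    induction t with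
    | zero => simp
    | add x y hx hy =>
      have : ∀ x : K ⊗[k] CoeffRing k W,
          LinearMap.liftBaseChange K (evalCoeff γ.val).toLinearMap x =
          Algebra.TensorProduct.productMap (AlgHom.id k K) (evalCoeff γ.val) x := by
        intro x
        induction x with
        | zero => simp
        | add x y hx hy => simp [hx, hy]
        | tmul a w => simp
      exact this _
    | tmul a w => simp

variable [FiniteDimensional k W]

/-- The closure of a group is a group, for points in any algebra A. Inserting γ ∈ Γ on the left of
the comultiplication of p gives an equation for Γ over K; it is a combination of equations over k,
so g satisfies it. Hence the coefficients of the comultiplication with g on the right, in a basis of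
A over k, vanish on Γ, and therefore at f. -/
theorem evalCoeff_mul_eq_zero (Γ : Subgroup (LinearMap.GeneralLinearGroup K (K ⊗[k] W)))
    (hgal : ∀ σ : K ≃ₐ[k] K, ∀ γ ∈ Γ, galConj W σ γ ∈ Γ)
    {A : Type u} [CommRing A] [Algebra k A] (f g : Module.End A (A ⊗[k] W))
    (hf : ∀ p ∈ vanishingCoeff Γ, evalCoeff f p = 0)
    (hg : ∀ p ∈ vanishingCoeff Γ, evalCoeff g p = 0)
    {p : CoeffRing k W} (hp : p ∈ vanishingCoeff Γ) : evalCoeff (f * g) p = 0 := by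
  let b := Module.finBasis k W
  let β := Module.Free.chooseBasis k A
  rw [evalCoeff_mul b]
  set u := comulCoeff b p with hu
  obtain ⟨c, hc⟩ := TensorProduct.eq_repr_basis_right β
    (LinearMap.lTensor (CoeffRing k W) (evalCoeff g).toLinearMap u)
  have hcI : ∀ i, ∀ γ ∈ Γ, evalCoeff γ.val (c i) = 0 := by
    intro i γ hγ
    have h1 := mem_baseChange_vanishing Γ hgal
      (LinearMap.rTensor (CoeffRing k W) (evalCoeff γ.val).toLinearMap u) (fun γ' hγ' => by
        have h2 := hp (γ * γ') (Γ.mul_mem hγ hγ')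
        rw [Units.val_mul, evalCoeff_mul b, ← hu] at h2
        rw [← h2]
        generalize u = u'
        induction u' with
        | zero => simp
        | add x y hx hy => simp [hx, hy]
        | tmul a w => simp)
    have h2 := baseChange_apply_eq_zero_of_mem (A := K) (evalCoeff g).toLinearMap
      (fun m hm => hg m fun γ' hγ' => by
        simp only [Submodule.mem_iInf, LinearMap.mem_ker] at hm
        exact hm γ' hγ') h1
    have h3 : LinearMap.rTensor A (evalCoeff γ.val).toLinearMap
        (LinearMap.lTensor (CoeffRing k W) (evalCoeff g).toLinearMap u) = 0 := by
      rw [← h2]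
      generalize u = u'
      induction u' with
      | zero => simp
      | add x y hx hy => rw [map_add, map_add, hx, hy, map_add, map_add]
      | tmul a w => simp
    rw [← hc, Finsupp.sum, map_sum] at h3
    simp only [LinearMap.rTensor_tmul] at h3
    have h4 := TensorProduct.sum_tmul_basis_right_eq_zero β
      (c.mapRange (evalCoeff γ.val) (map_zero _)) (by
        rw [Finsupp.sum_mapRange_index (by simp)]; exact h3)
    simpa using DFunLike.congr_fun h4 i
  have h5 : Algebra.TensorProduct.productMap (evalCoeff f) (evalCoeff g) u =
      Algebra.TensorProduct.productMap (evalCoeff f) (AlgHom.id k A)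
        (LinearMap.lTensor (CoeffRing k W) (evalCoeff g).toLinearMap u) := by
    generalize u = u'
    induction u' with
    | zero => simp
    | add x y hx hy => rw [map_add, map_add, map_add, hx, hy]
    | tmul a w => simp
  rw [h5, ← hc, Finsupp.sum, map_sum]
  refine Finset.sum_eq_zero fun i _ => ?_
  rw [Algebra.TensorProduct.productMap_apply_tmul, hf (c i) (hcI i), zero_mul]

/-- The Zariski closure over `k` of a Galois stable subgroup of the special linear group over `K`,
as an algebraic `k`-subgroup. -/
noncomputable def descendedGroup (Γ : Subgroup (LinearMap.GeneralLinearGroup K (K ⊗[k] W)))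
    (hgal : ∀ σ : K ≃ₐ[k] K, ∀ γ ∈ Γ, galConj W σ γ ∈ Γ)
    (hdet : ∀ γ ∈ Γ, LinearMap.det γ.val = 1) : AlgebraicSubgroup k W where
  pts A _ _ :=
    { carrier := {f | ∀ p ∈ vanishingCoeff Γ, evalCoeff f.val p = 0}
      mul_mem' := fun hf hg p hp => by
        rw [Units.val_mul]
        exact evalCoeff_mul_eq_zero Γ hgal _ _ hf hg hp
      one_mem' := fun p hp => by
        have h1 := hp 1 Γ.one_mem
        have h2 : ∀ (B : Type u) [CommRing B] [Algebra k B],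
            evalCoeff (1 : Module.End B (B ⊗[k] W)) p =
              algebraMap k B (MvPolynomial.aeval (fun c : Module.Dual k W × W => c.1 c.2) p) := by
          intro B _ _
          have : evalCoeff (1 : Module.End B (B ⊗[k] W)) = (Algebra.ofId k B).comp
              (MvPolynomial.aeval (fun c : Module.Dual k W × W => c.1 c.2)) := by
            refine MvPolynomial.algHom_ext fun c => ?_
            simpa [Algebra.ofId_apply] using matrixCoeff_one c.1 c.2
          rw [this]; rfl
        rw [Units.val_one, h2] at h1 ⊢
        rw [(map_eq_zero_iff _ (algebraMap k K).injective).1 h1, map_zero]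
      inv_mem' := fun {f} hf p hp => by
        let b := Module.finBasis k W
        -- Determinant one is itself one of the equations for Γ, so the antipode formula applies to
        -- f.
        have hd : LinearMap.det f.val = 1 := by
          have h1 := hf ((genericMatrix b).det - 1) (fun γ hγ => by
            rw [map_sub, evalCoeff_det, hdet γ hγ, map_one, sub_self])
          rw [map_sub, evalCoeff_det, map_one] at h1
          exact sub_eq_zero.1 h1
        rw [evalCoeff_inv b f hd]
        refine hf _ fun γ hγ => ?_
        rw [← evalCoeff_inv b γ (hdet γ hγ)]
        exact hp _ (Γ.inv_mem hγ) }
  exists_equations := ⟨vanishingCoeff Γ, fun _ _ _ _ => Iff.rfl⟩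

end Descent

/-! ### The Zariski topology -/

section Zariski

attribute [local instance] zariskiTopology

variable {K : Type u} {W : Type v} [Field K] [AddCommGroup W] [Module K W]

variable (K W) in
/-- The polynomial functions in the matrix coefficients on `GL(W)`. -/
def regularFunctions : Subalgebra K (LinearMap.GeneralLinearGroup K W → K) :=
  Algebra.adjoin K (Set.range fun (c : Module.Dual K W × W)
    (g : LinearMap.GeneralLinearGroup K W) => c.1 (g.val c.2))

theorem coeff_mem_regularFunctions (φ : Module.Dual K W) (w : W) :
    (fun g : LinearMap.GeneralLinearGroup K W => φ (g.val w)) ∈ regularFunctions K W :=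
  Algebra.subset_adjoin ⟨(φ, w), rfl⟩

theorem mem_regularFunctions_iff {F : LinearMap.GeneralLinearGroup K W → K} :
    F ∈ regularFunctions K W ↔ ∃ p : MvPolynomial (Module.Dual K W × W) K,
      ∀ g, F g = MvPolynomial.eval (fun c => c.1 (g.val c.2)) p := by
  have key : ∀ (p : MvPolynomial (Module.Dual K W × W) K) (g : LinearMap.GeneralLinearGroup K W),
      MvPolynomial.aeval (fun (c : Module.Dual K W × W)
        (g : LinearMap.GeneralLinearGroup K W) => c.1 (g.val c.2)) p g =
      MvPolynomial.eval (fun c => c.1 (g.val c.2)) p := by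
    intro p g
    induction p using MvPolynomial.induction_on with
    | C a => simp
    | add p q hp hq => simp [hp, hq]
    | mul_X p i hp => simp [hp]
  rw [regularFunctions, Algebra.adjoin_range_eq_range_aeval, AlgHom.mem_range]
  constructor
  · rintro ⟨p, rfl⟩
    exact ⟨p, key p⟩
  · rintro ⟨p, hp⟩
    exact ⟨p, funext fun g => by rw [hp, key]⟩

theorem isTopologicalBasis_zariski :
    TopologicalSpace.IsTopologicalBasis
      {U : Set (LinearMap.GeneralLinearGroup K W) |
        ∃ F ∈ regularFunctions K W, U = {g | F g ≠ 0}} := by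
  have h : {U : Set (LinearMap.GeneralLinearGroup K W) |
        ∃ F ∈ regularFunctions K W, U = {g | F g ≠ 0}} =
      {U | ∃ p : MvPolynomial (Module.Dual K W × W) K,
      U = {f : LinearMap.GeneralLinearGroup K W |
        MvPolynomial.eval (fun c => c.1 ((f : Module.End K W) c.2)) p ≠ 0}} := by
    ext U
    constructor
    · rintro ⟨F, hF, rfl⟩
      obtain ⟨p, hp⟩ := mem_regularFunctions_iff.1 hF
      exact ⟨p, by simp only [hp]⟩
    · rintro ⟨p, rfl⟩
      exact ⟨_, mem_regularFunctions_iff.2 ⟨p, fun _ => rfl⟩, rfl⟩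
  refine TopologicalSpace.isTopologicalBasis_of_subbasis_of_finiteInter (by rw [h]) ⟨?_, ?_⟩
  · exact ⟨1, one_mem _, by simp⟩
  · rintro _ ⟨F, hF, rfl⟩ _ ⟨G, hG, rfl⟩
    exact ⟨F * G, mul_mem hF hG, by ext g; simp⟩

theorem isClosed_zeros {F : LinearMap.GeneralLinearGroup K W → K}
    (hF : F ∈ regularFunctions K W) : IsClosed {g | F g = 0} :=
  ⟨isTopologicalBasis_zariski.isOpen ⟨F, hF, rfl⟩⟩

theorem isClosed_apply_eq_smul (a : LinearMap.GeneralLinearGroup K W) (v : W) (c : K) :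
    IsClosed {g : LinearMap.GeneralLinearGroup K W | a.val (g.val v) = c • g.val v} := by
  have : {g : LinearMap.GeneralLinearGroup K W | a.val (g.val v) = c • g.val v} =
      ⋂ φ : Module.Dual K W, {g | φ ((a.val - c • (1 : Module.End K W)) (g.val v)) = 0} := by
    ext g
    simp only [Set.mem_ofPred_eq, Set.mem_iInter]
    rw [Module.forall_dual_apply_eq_zero_iff, LinearMap.sub_apply, sub_eq_zero]
    rfl
  rw [this]
  refine isClosed_iInter fun φ => isClosed_zeros ?_
  exact coeff_mem_regularFunctions (φ ∘ₗ (a.val - c • (1 : Module.End K W))) v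

theorem isClosed_apply_eq_smul_self (v : W) (c : K) :
    IsClosed {g : LinearMap.GeneralLinearGroup K W | g.val v = c • v} := by
  have : {g : LinearMap.GeneralLinearGroup K W | g.val v = c • v} =
      ⋂ φ : Module.Dual K W, {g | φ (g.val v) - φ (c • v) = 0} := by
    ext g
    simp only [Set.mem_ofPred_eq, Set.mem_iInter, ← map_sub]
    rw [Module.forall_dual_apply_eq_zero_iff, sub_eq_zero]
  rw [this]
  refine isClosed_iInter fun φ => isClosed_zeros ?_
  exact sub_mem (coeff_mem_regularFunctions φ v) ((regularFunctions K W).algebraMap_mem _)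

/-- Pull-back then preserves regular functions. Regularity is only asked on S because inversion is
polynomial only where the determinant is one. -/
theorem continuousOn_of_regular {S : Set (LinearMap.GeneralLinearGroup K W)}
    {c : LinearMap.GeneralLinearGroup K W → LinearMap.GeneralLinearGroup K W}
    (h : ∀ (φ : Module.Dual K W) (w : W), ∃ F ∈ regularFunctions K W,
      ∀ g ∈ S, φ ((c g).val w) = F g) : ContinuousOn c S := by
  have key : ∀ F ∈ regularFunctions K W, ∃ F' ∈ regularFunctions K W,
      ∀ g ∈ S, F (c g) = F' g := by
    intro F hF
    induction hF using Algebra.adjoin_induction with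
    | mem F hF =>
      obtain ⟨⟨φ, w⟩, rfl⟩ := hF
      exact h φ w
    | algebraMap r => exact ⟨_, (regularFunctions K W).algebraMap_mem r, fun g _ => rfl⟩
    | add F G _ _ hF hG =>
      obtain ⟨F', hF', h1⟩ := hF
      obtain ⟨G', hG', h2⟩ := hG
      exact ⟨F' + G', add_mem hF' hG', fun g hg => by simp [h1 g hg, h2 g hg]⟩
    | mul F G _ _ hF hG =>
      obtain ⟨F', hF', h1⟩ := hF
      obtain ⟨G', hG', h2⟩ := hG
      exact ⟨F' * G', mul_mem hF' hG', fun g hg => by simp [h1 g hg, h2 g hg]⟩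
  refine continuousOn_to_generateFrom_iff.2 fun x hx t ht hxt => ?_
  obtain ⟨p, rfl⟩ := ht
  obtain ⟨F, hF, hF'⟩ := key _ (mem_regularFunctions_iff.2 ⟨p, fun _ => rfl⟩)
  refine mem_nhdsWithin.2 ⟨{g | F g ≠ 0}, isTopologicalBasis_zariski.isOpen ⟨F, hF, rfl⟩, ?_, ?_⟩
  · show F x ≠ 0
    rw [← hF' x hx]; exact hxt
  · rintro g ⟨hg1, hg2⟩
    show MvPolynomial.eval _ p ≠ 0
    rw [hF' g hg2]; exact hg1

theorem continuous_mul_left_zariski (a : LinearMap.GeneralLinearGroup K W) :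
    Continuous (fun g => a * g) := by
  rw [← continuousOn_univ]
  exact continuousOn_of_regular fun φ w =>
    ⟨_, coeff_mem_regularFunctions (φ ∘ₗ a.val) w, fun g _ => rfl⟩

/-- Multiplication is not jointly continuous for the product of Zariski topologies, but translations
are continuous: a word in elements of Y is joined to 1 by a chain of translates of Y, consecutive
ones meeting. -/
theorem isPreconnected_closure_of_one_mem {Y : Set (LinearMap.GeneralLinearGroup K W)}
    (hY : IsPreconnected Y) (h1 : 1 ∈ Y) :
    IsPreconnected (Subgroup.closure Y : Set (LinearMap.GeneralLinearGroup K W)) := by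
  refine isPreconnected_of_forall 1 fun γ hγ => ?_
  have htrans : ∀ g ∈ Subgroup.closure Y,
      (fun y => g * y) '' Y ⊆ (Subgroup.closure Y : Set _) ∧
        IsPreconnected ((fun y => g * y) '' Y) := fun g hg =>
    ⟨by rintro _ ⟨y, hy, rfl⟩; exact mul_mem hg (Subgroup.subset_closure hy),
      hY.image _ (continuous_mul_left_zariski g).continuousOn⟩
  induction hγ using Subgroup.closure_induction_right with
  | one => exact ⟨{1}, by simp, rfl, rfl, isPreconnected_singleton⟩
  | mul_right x hx y hy ih =>
    obtain ⟨t, ht1, ht2, ht3, ht4⟩ := ih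
    obtain ⟨h3, h4⟩ := htrans x hx
    exact ⟨t ∪ (fun y => x * y) '' Y, Set.union_subset ht1 h3, Or.inl ht2, Or.inr ⟨y, hy, rfl⟩,
      ht4.union x ht3 ⟨1, h1, mul_one x⟩ h4⟩
  | mul_inv_cancel x hx y hy ih =>
    obtain ⟨t, ht1, ht2, ht3, ht4⟩ := ih
    obtain ⟨h3, h4⟩ := htrans (x * y⁻¹) (mul_mem hx (inv_mem (Subgroup.subset_closure hy)))
    exact ⟨t ∪ (fun z => x * y⁻¹ * z) '' Y, Set.union_subset ht1 h3, Or.inl ht2,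
      -- The translate x y⁻¹ Y contains x, through y, and x y⁻¹, through 1.
      Or.inr ⟨1, h1, mul_one _⟩, ht4.union x ht3 ⟨y, hy, by simp⟩ h4⟩

theorem exists_regular_coeff_inv [FiniteDimensional K W] (φ : Module.Dual K W) (w : W) :
    ∃ F ∈ regularFunctions K W, ∀ g : LinearMap.GeneralLinearGroup K W,
      LinearMap.det g.val = 1 → φ ((g⁻¹).val w) = F g := by
  classical
  let b := Module.finBasis K W
  let M : Matrix _ _ (regularFunctions K W) := Matrix.of fun i j =>
    ⟨_, coeff_mem_regularFunctions (b.coord i) (b j)⟩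
  let θ : LinearMap.GeneralLinearGroup K W → (regularFunctions K W →+* K) := fun g =>
    (Pi.evalRingHom _ g).comp (regularFunctions K W).val.toRingHom
  refine ⟨∑ i, ∑ j, algebraMap K _ (φ (b i) * b.repr w j) * (M.adjugate i j).1, ?_, ?_⟩
  · exact sum_mem fun i _ => sum_mem fun j _ =>
      mul_mem ((regularFunctions K W).algebraMap_mem _) (M.adjugate i j).2
  · intro g hg
    have hM : (θ g).mapMatrix M = LinearMap.toMatrix b b g.val := by
      ext i j
      simp [θ, M, LinearMap.toMatrix_apply]
    have hadj : ∀ i j, (M.adjugate i j).1 g = LinearMap.toMatrix b b (g⁻¹).val i j := by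
      intro i j
      have h1 : (M.adjugate i j).1 g = ((θ g).mapMatrix M).adjugate i j := by
        rw [← RingHom.map_adjugate]; rfl
      rw [h1, hM]
      have h2 : LinearMap.toMatrix b b g.val * LinearMap.toMatrix b b (g⁻¹).val = 1 := by
        rw [← LinearMap.toMatrix_mul, ← Units.val_mul, mul_inv_cancel, Units.val_one,
          LinearMap.toMatrix_one]
      have h3 := Matrix.adjugate_mul (LinearMap.toMatrix b b g.val)
      rw [LinearMap.det_toMatrix, hg, one_smul] at h3
      rw [← one_mul (LinearMap.toMatrix b b (g⁻¹).val), ← h3, mul_assoc, h2, mul_one]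
    have h4 : φ ((g⁻¹).val w) = ∑ i, ∑ j, φ (b i) * b.repr w j *
        LinearMap.toMatrix b b (g⁻¹).val i j := by
      conv_lhs => rw [← b.sum_repr w]
      rw [map_sum, map_sum, Finset.sum_comm]
      refine Finset.sum_congr rfl fun j _ => ?_
      conv_lhs => rw [map_smul, ← b.sum_repr ((g⁻¹).val (b j))]
      rw [map_smul, map_sum, smul_eq_mul, Finset.mul_sum]
      refine Finset.sum_congr rfl fun i _ => ?_
      rw [map_smul, smul_eq_mul, LinearMap.toMatrix_apply]
      ring
    rw [h4]
    simp only [Finset.sum_apply, Pi.mul_apply, hadj, Pi.algebraMap_apply]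
    rfl

theorem continuousOn_commutator [FiniteDimensional K W] (x : LinearMap.GeneralLinearGroup K W) :
    ContinuousOn (fun y => ⁅x, y⁆) {y : LinearMap.GeneralLinearGroup K W | LinearMap.det y.val = 1} := by
  refine continuousOn_of_regular fun φ w => ?_
  let b := Module.finBasis K W
  choose F hF hF' using fun i => exists_regular_coeff_inv (K := K) (b.coord i) w
  refine ⟨∑ i, (fun g => φ (x.val (g.val ((x⁻¹).val (b i))))) * F i, ?_, ?_⟩
  · exact sum_mem fun i _ =>
      mul_mem (coeff_mem_regularFunctions (φ ∘ₗ x.val) ((x⁻¹).val (b i))) (hF i)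
  · intro g hg
    have h1 := b.sum_repr ((g⁻¹).val w)
    have h2 : (⁅x, g⁆ : LinearMap.GeneralLinearGroup K W).val w =
        x.val (g.val ((x⁻¹).val ((g⁻¹).val w))) := rfl
    rw [h2, ← h1]
    simp only [map_sum, map_smul, Finset.sum_apply, Pi.mul_apply, smul_eq_mul]
    refine Finset.sum_congr rfl fun i _ => ?_
    rw [← hF' i g hg, mul_comm]; rfl

/-- For fixed x the commutators with the elements of N form a connected set through 1. Separate
continuity is therefore enough. -/
theorem isPreconnected_commutator [FiniteDimensional K W]
    {N : Subgroup (LinearMap.GeneralLinearGroup K W)} (hdet : ∀ n ∈ N, LinearMap.det n.val = 1)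
    (hN : IsPreconnected (N : Set (LinearMap.GeneralLinearGroup K W))) :
    IsPreconnected ((⁅N, N⁆ : Subgroup _) : Set (LinearMap.GeneralLinearGroup K W)) := by
  rw [Subgroup.commutator_def]
  refine isPreconnected_closure_of_one_mem ?_ ⟨1, N.one_mem, 1, N.one_mem, by simp⟩
  refine isPreconnected_of_forall 1 ?_
  rintro _ ⟨x, hx, y, hy, rfl⟩
  refine ⟨(fun y => ⁅x, y⁆) '' N, ?_, ⟨1, N.one_mem, by simp⟩, ⟨y, hy, rfl⟩,
    hN.image _ ((continuousOn_commutator x).mono fun n hn => hdet n hn)⟩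
  rintro _ ⟨z, hz, rfl⟩
  exact ⟨x, hx, z, hz, rfl⟩

/-- A function with finite range and closed fibres on a preconnected set is constant. -/
theorem IsPreconnected.constant_of_finite_of_isClosed {X Y : Type*} [TopologicalSpace X]
    {S : Set X} (hS : IsPreconnected S) (F : X → Y) (T : Set Y) (hT : T.Finite)
    (hFT : ∀ x ∈ S, F x ∈ T) (Z : Y → Set X) (hZ : ∀ c, IsClosed (Z c))
    (hFZ : ∀ x ∈ S, ∀ c, x ∈ Z c ↔ F x = c) {x y : X} (hx : x ∈ S) (hy : y ∈ S) : F x = F y := by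
  by_contra hne
  have h := isPreconnected_closed_iff.1 hS (Z (F x)) (⋃ c ∈ T \ {F x}, Z c) (hZ _)
    ((hT.subset Set.sdiff_subset).isClosed_biUnion fun c _ => hZ c) ?_
    ⟨x, hx, (hFZ x hx _).2 rfl⟩ ⟨y, hy, ?_⟩
  · obtain ⟨z, hz, hz1, hz2⟩ := h
    simp only [Set.mem_iUnion] at hz2
    obtain ⟨c, hc, hzc⟩ := hz2
    exact hc.2 (((hFZ z hz c).1 hzc).symm.trans ((hFZ z hz _).1 hz1))
  · intro z hz
    by_cases h : F z = F x
    · exact Or.inl ((hFZ z hz _).2 h)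
    · refine Or.inr ?_
      simp only [Set.mem_iUnion]
      exact ⟨F z, ⟨hFT z hz, h⟩, (hFZ z hz _).2 rfl⟩
  · simp only [Set.mem_iUnion]
    exact ⟨F y, ⟨hFT y hy, fun h => hne h.symm⟩, (hFZ y hy _).2 rfl⟩

end Zariski

/-! ### The identity component and density -/

section CircleFamily

attribute [local instance] zariskiTopology

variable {W : Type v} [AddCommGroup W] [Module ℚ W]
  (h : Circle →* LinearMap.GeneralLinearGroup ℝ (ℝ ⊗[ℚ] W))

/-- A representation of the circle with determinant one and real analytic matrix coefficients. -/
structure IsAnalyticUnimodular : Prop where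
  det_eq_one : ∀ z, LinearMap.det (h z).val = 1
  analytic : ∀ c, AnalyticOnNhd ℝ (fun θ : ℝ => matrixCoeff (h (Circle.exp θ)).val c) Set.univ

/-- Evaluation of rational polynomials at the points `h z`, with values in `ℂ`. -/
noncomputable def evalCircle (z : Circle) : CoeffRing ℚ W →ₐ[ℚ] ℂ :=
  (Complex.ofRealAm.restrictScalars ℚ).comp (evalCoeff (h z).val)

theorem evalCircle_apply (z : Circle) (p : CoeffRing ℚ W) :
    evalCircle h z p = (evalCoeff (h z).val p : ℝ) := rfl

variable {K : Type} [Field K] [Algebra ℚ K]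

/-- Evaluation of polynomials with coefficients in `K`, embedded in `ℂ` by `τ`, at the points
`h z`. -/
noncomputable def evalCircleExt (τ : K →ₐ[ℚ] ℂ) (z : Circle) : K ⊗[ℚ] CoeffRing ℚ W →ₐ[ℚ] ℂ :=
  Algebra.TensorProduct.productMap τ (evalCircle h z)

/-- Evaluation of polynomials with coefficients in `K` at a point over `K`. -/
noncomputable def evalExt (g : LinearMap.GeneralLinearGroup K (K ⊗[ℚ] W)) :
    K ⊗[ℚ] CoeffRing ℚ W →ₐ[ℚ] K :=
  Algebra.TensorProduct.productMap (AlgHom.id ℚ K) (evalCoeff g.val)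

@[simp]
theorem evalExt_tmul (g : LinearMap.GeneralLinearGroup K (K ⊗[ℚ] W)) (a : K)
    (p : CoeffRing ℚ W) : evalExt g (a ⊗ₜ p) = a * evalCoeff g.val p := by
  simp [evalExt]

@[simp]
theorem evalCircleExt_tmul (τ : K →ₐ[ℚ] ℂ) (z : Circle) (a : K)
    (p : CoeffRing ℚ W) : evalCircleExt h τ z (a ⊗ₜ p) = τ a * evalCircle h z p := by
  simp [evalCircleExt]

/-- The Zariski closure over `K` of the circle, with respect to an embedding of `K` in `ℂ`. -/
def circlePts (τ : K →ₐ[ℚ] ℂ) : Set (LinearMap.GeneralLinearGroup K (K ⊗[ℚ] W)) :=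
  {g | ∀ s : K ⊗[ℚ] CoeffRing ℚ W, (∀ z, evalCircleExt h τ z s = 0) → evalExt g s = 0}

variable {h}

/-- Irreducibility of the circle: in the angle θ, polynomials become analytic functions on the
connected line, and these have no zero divisors. -/
theorem IsAnalyticUnimodular.eq_zero_or_eq_zero (hh : IsAnalyticUnimodular h) (τ : K →ₐ[ℚ] ℂ)
    {s t : K ⊗[ℚ] CoeffRing ℚ W} (hst : ∀ z, evalCircleExt h τ z (s * t) = 0) :
    (∀ z, evalCircleExt h τ z s = 0) ∨ ∀ z, evalCircleExt h τ z t = 0 := by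
  have han : ∀ s : K ⊗[ℚ] CoeffRing ℚ W,
      AnalyticOnNhd ℝ (fun θ : ℝ => evalCircleExt h τ (Circle.exp θ) s) Set.univ := by
    intro s
    induction s with
    | zero => simpa using analyticOnNhd_const
    | add x y hx hy =>
      simp only [map_add]
      exact hx.add hy
    | tmul a p =>
      have hp : AnalyticOnNhd ℝ (fun θ : ℝ => evalCircle h (Circle.exp θ) p) Set.univ := by
        induction p using MvPolynomial.induction_on with
        | C a =>
          have : ∀ θ : ℝ, evalCircle h (Circle.exp θ) (MvPolynomial.C a) = algebraMap ℚ ℂ a :=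
            fun θ => (evalCircle h (Circle.exp θ)).commutes a
          simp only [this]
          exact analyticOnNhd_const
        | add p q hp hq =>
          simp only [map_add]
          exact hp.add hq
        | mul_X p c hp =>
          have hc : AnalyticOnNhd ℝ
              (fun θ : ℝ => evalCircle h (Circle.exp θ) (MvPolynomial.X c)) Set.univ := by
            simp only [evalCircle_apply, evalCoeff_X]
            exact (Complex.ofRealCLM.analyticOnNhd Set.univ).comp (hh.analytic c)
              (Set.mapsTo_univ _ _)
          simpa using hp.mul hc
      simpa using (analyticOnNhd_const (v := τ a)).mul hp
  have key := AnalyticOnNhd.eq_zero_or_eq_zero_of_mul_eq_zero (han s) (han t)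
    (fun θ _ => by rw [← map_mul]; exact hst _) isPreconnected_univ
  refine key.imp (fun H z => ?_) (fun H z => ?_)
  all_goals
    rw [← Circle.exp_arg z]
    exact H _ trivial

theorem evalExt_galConj (σ : K ≃ₐ[ℚ] K) (g : LinearMap.GeneralLinearGroup K (K ⊗[ℚ] W))
    (s : K ⊗[ℚ] CoeffRing ℚ W) :
    evalExt (galConj W σ g) s =
      σ (evalExt g (LinearMap.rTensor (CoeffRing ℚ W) σ.symm.toLinearMap s)) := by
  induction s with
  | zero => simp
  | add x y hx hy => simp [hx, hy]
  | tmul a p => simp [evalCoeff_galConj]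

/-- Conjugation by σ changes the embedding from τ to τσ⁻¹. This is why `circleGroup` is generated by
the points for all embeddings. -/
theorem galConj_mem_circlePts (σ : K ≃ₐ[ℚ] K) (τ : K →ₐ[ℚ] ℂ)
    {g : LinearMap.GeneralLinearGroup K (K ⊗[ℚ] W)} (hg : g ∈ circlePts h τ) :
    galConj W σ g ∈ circlePts h (τ.comp σ.symm.toAlgHom) := by
  intro s hs
  rw [evalExt_galConj, hg, map_zero]
  intro z
  rw [← hs z]
  generalize s = s'
  induction s' with
  | zero => simp
  | add x y hx hy => simp [hx, hy]
  | tmul a p => simp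

theorem one_mem_circlePts (τ : K →ₐ[ℚ] ℂ) : 1 ∈ circlePts h τ := by
  intro s hs
  have h1 := hs 1
  have h2 : evalCircleExt h τ 1 s = τ (evalExt 1 s) := by
    have h3 : evalCircle h 1 = τ.comp (evalCoeff (1 : LinearMap.GeneralLinearGroup K
        (K ⊗[ℚ] W)).val) := by
      refine MvPolynomial.algHom_ext fun c => ?_
      obtain ⟨φ, w⟩ := c
      rw [evalCircle_apply, AlgHom.comp_apply, evalCoeff_X, evalCoeff_X, map_one, Units.val_one,
        Units.val_one, matrixCoeff_one, matrixCoeff_one]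
      simp
    generalize s = s'
    induction s' with
    | zero => simp
    | add x y hx hy => rw [map_add, map_add, map_add, hx, hy]
    | tmul a p => rw [evalCircleExt_tmul, evalExt_tmul, map_mul, h3]; rfl
  rw [h2] at h1
  exact (map_eq_zero_iff τ τ.injective).1 h1

variable (h) in
theorem evalCoeff_eq_zero_of_mem_circlePts {p : CoeffRing ℚ W}
    (hp : ∀ z, evalCoeff (h z).val p = 0) (τ : K →ₐ[ℚ] ℂ)
    {g : LinearMap.GeneralLinearGroup K (K ⊗[ℚ] W)} (hg : g ∈ circlePts h τ) :
    evalCoeff g.val p = 0 := by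
  have := hg (1 ⊗ₜ p) (fun z => by simp [evalCircle_apply, hp])
  simpa using this

variable [FiniteDimensional ℚ W]

/-- Specialization: a polynomial over `K` that does not vanish at some `h z` does not vanish at some
point over `K` of the Zariski closure of the circle. -/
theorem IsAnalyticUnimodular.exists_mem_circlePts [IsAlgClosed K] (hh : IsAnalyticUnimodular h)
    (τ : K →ₐ[ℚ] ℂ) {t : K ⊗[ℚ] CoeffRing ℚ W} {z : Circle} (ht : evalCircleExt h τ z t ≠ 0) :
    ∃ g ∈ circlePts h τ, evalExt g t ≠ 0 := by
  classical
  let : Algebra K ℂ := τ.toRingHom.toAlgebra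
  have : IsScalarTower ℚ K ℂ := IsScalarTower.of_algebraMap_eq fun x => (τ.commutes x).symm
  let b := Module.finBasis ℚ W
  let n := Module.finrank ℚ W
  let x : Fin n × Fin n → ℂ := fun i => evalCircle h z (MvPolynomial.X (b.coord i.1, b i.2))
  -- Nullstellensatz: a K-point ψ of the algebra generated by the entries of `h z` specializes them
  -- to a matrix over K. Every polynomial relation at `h z` survives, and the adjoined inverse keeps
  -- the value of t nonzero.
  let R : Subalgebra K ℂ := Algebra.adjoin K (insert (evalCircleExt h τ z t)⁻¹ (Set.range x))
  have : Algebra.FiniteType K R :=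
    R.fg_iff_finiteType.1 (Subalgebra.fg_def.2 ⟨_, (Set.finite_range x).insert _, rfl⟩)
  obtain ⟨ψ⟩ := nonempty_algHom_of_finiteType K R
  have hx : ∀ i, x i ∈ R := fun i => Algebra.subset_adjoin (Or.inr ⟨i, rfl⟩)
  have halgK : ∀ a : K, τ a ∈ R := fun a => R.algebraMap_mem a
  have halgQ : ∀ a : ℚ, algebraMap ℚ ℂ a ∈ R := fun a => by
    rw [IsScalarTower.algebraMap_apply ℚ K ℂ]; exact R.algebraMap_mem _
  have hX : ∀ c, evalCircle h z (MvPolynomial.X c) = ∑ i, ∑ j,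
      algebraMap ℚ ℂ (c.1 (b i) * b.repr c.2 j) * x (i, j) := by
    intro c
    simp only [x, evalCircle_apply, evalCoeff_X]
    rw [show c = (c.1, c.2) from rfl, matrixCoeff_eq_sum b (h z).val c.1 c.2]
    simp
  have hp : ∀ p, evalCircle h z p ∈ R := by
    intro p
    induction p using MvPolynomial.induction_on with
    | C a => rw [show MvPolynomial.C a = algebraMap ℚ (CoeffRing ℚ W) a from rfl,
        AlgHom.commutes]; exact halgQ a
    | add p q hp hq => rw [map_add]; exact add_mem hp hq
    | mul_X p c hp =>
      rw [map_mul, hX]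
      exact mul_mem hp (sum_mem fun i _ => sum_mem fun j _ => mul_mem (halgQ _) (hx _))
  have hs : ∀ s, evalCircleExt h τ z s ∈ R := by
    intro s
    induction s with
    | zero => rw [map_zero]; exact zero_mem _
    | add x y hx hy => rw [map_add]; exact add_mem hx hy
    | tmul a p => rw [evalCircleExt_tmul]; exact mul_mem (halgK a) (hp p)
  let M : Matrix (Fin n) (Fin n) K := Matrix.of fun i j => ψ ⟨x (i, j), hx _⟩
  let f : Module.End K (K ⊗[ℚ] W) := Matrix.toLin (b.baseChange K) (b.baseChange K) M
  have hcoeff : ∀ i j, matrixCoeff f (b.coord i, b j) = ψ ⟨x (i, j), hx _⟩ := by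
    intro i j
    rw [← toMatrix_baseChange_apply, LinearMap.toMatrix_toLin]; rfl
  have hf : ∀ p, evalCoeff f p = ψ ⟨evalCircle h z p, hp p⟩ := by
    let ev' : CoeffRing ℚ W →ₐ[ℚ] R :=
      (evalCircle h z).codRestrict (R.restrictScalars ℚ) hp
    have : evalCoeff f = (ψ.restrictScalars ℚ).comp ev' := by
      refine MvPolynomial.algHom_ext fun c => ?_
      have h1 : ev' (MvPolynomial.X c) = ∑ i, ∑ j,
          algebraMap ℚ R (c.1 (b i) * b.repr c.2 j) * ⟨x (i, j), hx _⟩ := by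
        refine Subtype.ext ?_
        simp only [AddSubmonoidClass.coe_finsetSum, MulMemClass.coe_mul]
        exact hX c
      rw [AlgHom.comp_apply, h1, evalCoeff_X, show c = (c.1, c.2) from rfl,
        matrixCoeff_eq_sum b f c.1 c.2]
      simp only [map_sum, map_mul, hcoeff, AlgHom.commutes]
      rfl
    intro p
    rw [this]; rfl
  -- The relation det = 1 also specializes, which makes the new endomorphism invertible.
  have hdet : LinearMap.det f = 1 := by
    rw [← evalCoeff_det b, hf, ← map_one ψ]
    congr 1
    refine Subtype.ext ?_
    show evalCircle h z _ = 1
    rw [evalCircle_apply, evalCoeff_det, hh.det_eq_one, Complex.ofReal_one]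
  have hunit : IsUnit f := by
    rw [LinearMap.isUnit_iff_isUnit_det, hdet]; exact isUnit_one
  obtain ⟨g, hg⟩ := hunit
  have hev : ∀ s, evalExt g s = ψ ⟨evalCircleExt h τ z s, hs s⟩ := by
    intro s
    induction s with
    | zero =>
      rw [show (⟨evalCircleExt h τ z 0, hs 0⟩ : R) = 0 from Subtype.ext (map_zero _), map_zero,
        map_zero]
    | add x y hx hy =>
      rw [map_add, hx, hy, ← map_add]; congr 1
      refine Subtype.ext ?_
      show _ = evalCircleExt h τ z (x + y)
      rw [map_add]; rfl
    | tmul a p =>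
      have h1 : (⟨evalCircleExt h τ z (a ⊗ₜ p), hs _⟩ : R) =
          algebraMap K R a * ⟨evalCircle h z p, hp p⟩ :=
        Subtype.ext (evalCircleExt_tmul h τ z a p)
      rw [evalExt_tmul, hg, hf, h1, map_mul, ψ.commutes]; rfl
  refine ⟨g, fun s hsz => ?_, ?_⟩
  · rw [hev, ← map_zero ψ]; congr 1
    exact Subtype.ext (hsz z)
  · rw [hev]
    have hinv : (evalCircleExt h τ z t)⁻¹ ∈ R := Algebra.subset_adjoin (Or.inl rfl)
    have h1 : (⟨evalCircleExt h τ z t, hs t⟩ : R) * ⟨_, hinv⟩ = 1 :=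
      Subtype.ext (mul_inv_cancel₀ ht)
    intro h0
    have h2 := congrArg ψ h1
    rw [map_mul, h0, zero_mul, map_one] at h2
    exact zero_ne_one h2

end CircleFamily

/-! ### The connected group over K generated by the closures of the circle. -/

section CircleGroup

attribute [local instance] zariskiTopology

variable {W : Type v} [AddCommGroup W] [Module ℚ W]
  {h : Circle →* LinearMap.GeneralLinearGroup ℝ (ℝ ⊗[ℚ] W)}
  {K : Type} [Field K] [Algebra ℚ K]

/-- In a rational basis, any matrix coefficient over K is a K-combination of rational ones. This
identifies the Zariski topology with the one given by K ⊗ `CoeffRing`. -/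
theorem exists_evalExt_of_regular [FiniteDimensional ℚ W]
    {F : LinearMap.GeneralLinearGroup K (K ⊗[ℚ] W) → K}
    (hF : F ∈ regularFunctions K (K ⊗[ℚ] W)) :
    ∃ s : K ⊗[ℚ] CoeffRing ℚ W, ∀ g, F g = evalExt g s := by
  induction hF using Algebra.adjoin_induction with
  | mem F hF =>
    obtain ⟨⟨φ, w⟩, rfl⟩ := hF
    let b := Module.finBasis ℚ W
    refine ⟨∑ j, ∑ i, ((b.baseChange K).repr w j * φ (1 ⊗ₜ b i)) ⊗ₜ
      MvPolynomial.X (b.coord i, b j), fun g => ?_⟩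
    simp only [map_sum, evalExt_tmul, evalCoeff_X]
    conv_lhs => rw [← (b.baseChange K).sum_repr w]
    simp only [map_sum, map_smul, Module.Basis.baseChange_apply]
    refine Finset.sum_congr rfl fun j _ => ?_
    rw [apply_one_tmul_eq_sum b g.val (b j)]
    simp only [map_sum, map_smul, smul_eq_mul, Finset.mul_sum]
    refine Finset.sum_congr rfl fun i _ => ?_
    ring
  | algebraMap r => exact ⟨r ⊗ₜ 1, fun g => by simp⟩
  | add F G _ _ hF hG =>
    obtain ⟨s, hs⟩ := hF
    obtain ⟨t, ht⟩ := hG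
    exact ⟨s + t, fun g => by simp [hs, ht]⟩
  | mul F G _ _ hF hG =>
    obtain ⟨s, hs⟩ := hF
    obtain ⟨t, ht⟩ := hG
    exact ⟨s * t, fun g => by simp [hs, ht]⟩

theorem coeffRing_regular (p : CoeffRing ℚ W) :
    (fun g : LinearMap.GeneralLinearGroup K (K ⊗[ℚ] W) => evalCoeff g.val p) ∈
      regularFunctions K (K ⊗[ℚ] W) := by
  induction p using MvPolynomial.induction_on with
  | C a =>
    have : ∀ g : LinearMap.GeneralLinearGroup K (K ⊗[ℚ] W),
        evalCoeff g.val (MvPolynomial.C a : CoeffRing ℚ W) = algebraMap ℚ K a :=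
      fun g => (evalCoeff g.val).commutes a
    simp only [this]
    exact (regularFunctions K (K ⊗[ℚ] W)).algebraMap_mem (algebraMap ℚ K a)
  | add p q hp hq =>
    simp only [map_add]
    exact add_mem hp hq
  | mul_X p c hp =>
    simp only [map_mul, evalCoeff_X]
    exact mul_mem hp (coeff_mem_regularFunctions (Module.Dual.baseChange K c.1) (1 ⊗ₜ c.2))

theorem AlgebraicSubgroup.isClosed_pts (G : AlgebraicSubgroup ℚ W) :
    IsClosed (G.pts K : Set (LinearMap.GeneralLinearGroup K (K ⊗[ℚ] W))) := by
  obtain ⟨S, hS⟩ := G.exists_equations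
  have : (G.pts K : Set (LinearMap.GeneralLinearGroup K (K ⊗[ℚ] W))) =
      ⋂ p ∈ S, {g | evalCoeff g.val p = 0} := by
    ext g
    simp only [SetLike.mem_coe, hS, Set.mem_iInter]
    rfl
  rw [this]
  exact isClosed_biInter fun p _ => isClosed_zeros (coeffRing_regular p)

variable (h K) in
/-- The group generated by the conjugates over `K` of the Zariski closure of the circle. -/
def circleGroup : Subgroup (LinearMap.GeneralLinearGroup K (K ⊗[ℚ] W)) :=
  Subgroup.closure (⋃ τ : K →ₐ[ℚ] ℂ, circlePts h τ)

theorem circlePts_subset_circleGroup (τ : K →ₐ[ℚ] ℂ) :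
    circlePts h τ ⊆ circleGroup h K :=
  (Set.subset_iUnion (fun τ : K →ₐ[ℚ] ℂ => circlePts h τ) τ).trans Subgroup.subset_closure

theorem circleGroup_le {H : Subgroup (LinearMap.GeneralLinearGroup K (K ⊗[ℚ] W))}
    (hH : ∀ τ : K →ₐ[ℚ] ℂ, circlePts h τ ⊆ H) : circleGroup h K ≤ H :=
  (Subgroup.closure_le H).2 (Set.iUnion_subset hH)

theorem galConj_mem_circleGroup (σ : K ≃ₐ[ℚ] K)
    {g : LinearMap.GeneralLinearGroup K (K ⊗[ℚ] W)} (hg : g ∈ circleGroup h K) :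
    galConj W σ g ∈ circleGroup h K := by
  have : circleGroup h K ≤ (circleGroup h K).comap (galConj W σ) :=
    circleGroup_le fun τ g hg => circlePts_subset_circleGroup _ (galConj_mem_circlePts σ τ hg)
  exact this hg

/-- Each generating set `circlePts h τ` is irreducible and contains 1; so their union is connected,
and so is the group it generates. -/
theorem isPreconnected_circleGroup [FiniteDimensional ℚ W] [IsAlgClosed K] (hh : IsAnalyticUnimodular h) :
    IsPreconnected (circleGroup h K : Set (LinearMap.GeneralLinearGroup K (K ⊗[ℚ] W))) := by
  rcases isEmpty_or_nonempty (K →ₐ[ℚ] ℂ) with hE | ⟨⟨τ₀⟩⟩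
  · have : circleGroup h K = ⊥ := by simp [circleGroup]
    rw [this]
    exact isPreconnected_singleton
  refine isPreconnected_closure_of_one_mem ?_ (Set.mem_iUnion.2 ⟨τ₀, one_mem_circlePts τ₀⟩)
  refine isPreconnected_iUnion ⟨1, Set.mem_iInter.2 one_mem_circlePts⟩ fun τ => ?_
  refine IsPreirreducible.isPreconnected ?_
  rintro U V hU hV ⟨x, hx, hxU⟩ ⟨y, hy, hyV⟩
  obtain ⟨_, ⟨F, hF, rfl⟩, hxF, hFU⟩ := isTopologicalBasis_zariski.exists_subset_of_mem_open hxU hU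
  obtain ⟨_, ⟨G, hG, rfl⟩, hyG, hGV⟩ := isTopologicalBasis_zariski.exists_subset_of_mem_open hyV hV
  obtain ⟨s, hs⟩ := exists_evalExt_of_regular hF
  obtain ⟨t, ht⟩ := exists_evalExt_of_regular hG
  by_contra hne
  -- If the two open sets had no common point in `circlePts h τ`, specialization would force the
  -- product of their equations to vanish on the whole circle.
  have hst : ∀ z, evalCircleExt h τ z (s * t) = 0 := by
    intro z
    by_contra hz
    obtain ⟨g, hg, hgst⟩ := hh.exists_mem_circlePts τ hz
    rw [map_mul, ← hs, ← ht] at hgst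
    exact hne ⟨g, hg, hFU (left_ne_zero_of_mul hgst), hGV (right_ne_zero_of_mul hgst)⟩
  rcases hh.eq_zero_or_eq_zero τ hst with H | H
  · exact hxF (by rw [hs]; exact hx s H)
  · exact hyG (by rw [ht]; exact hy t H)

theorem det_eq_one_of_mem_circleGroup [FiniteDimensional ℚ W] (hh : IsAnalyticUnimodular h)
    {g : LinearMap.GeneralLinearGroup K (K ⊗[ℚ] W)} (hg : g ∈ circleGroup h K) :
    LinearMap.det g.val = 1 := by
  have : circleGroup h K ≤
      (Units.map (LinearMap.det : Module.End K (K ⊗[ℚ] W) →* K)).ker := by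
    refine circleGroup_le fun τ g hg => ?_
    rw [SetLike.mem_coe, MonoidHom.mem_ker]
    refine Units.ext ?_
    have h1 := evalCoeff_eq_zero_of_mem_circlePts h
      (p := (genericMatrix (Module.finBasis ℚ W)).det - 1)
      (fun z => by rw [map_sub, evalCoeff_det, hh.det_eq_one, map_one, sub_self]) τ hg
    rw [map_sub, evalCoeff_det, map_one] at h1
    exact sub_eq_zero.1 h1
  exact congrArg Units.val (MonoidHom.mem_ker.1 (this hg))

end CircleGroup

/-! ### Properties of the smallest algebraic group that contains the circle -/

theorem end_ext_of_matrixCoeff {k : Type u} {W : Type v} [Field k] [AddCommGroup W] [Module k W]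
    [FiniteDimensional k W] {A : Type u} [CommRing A] [Algebra k A]
    {f g : Module.End A (A ⊗[k] W)} (hfg : ∀ c, matrixCoeff f c = matrixCoeff g c) : f = g :=
  end_ext_of_one_tmul fun w => by
    let b := Module.finBasis k W
    rw [apply_one_tmul_eq_sum b, apply_one_tmul_eq_sum b]
    simp only [hfg]

theorem dual_baseChange_comp {k : Type u} {W : Type v} [Field k] [AddCommGroup W] [Module k W]
    {A : Type u} [CommRing A] [Algebra k A] (φ : Module.Dual k W) (d : Module.End k W)
    (x : A ⊗[k] W) :
    Module.Dual.baseChange A φ (d.baseChange A x) = Module.Dual.baseChange A (φ ∘ₗ d) x := by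
  induction x with
  | zero => simp
  | add x y hx hy => simp only [map_add, hx, hy]
  | tmul a w => simp [Module.Dual.baseChange_apply_tmul]

/-- Commuting with a rational endomorphism is a system of linear equations over ℚ in the matrix
coefficients, so it can be transferred between the circle, `circleGroup` and the points of G. -/
theorem commute_baseChange_iff {k : Type u} {W : Type v} [Field k] [AddCommGroup W] [Module k W]
    [FiniteDimensional k W] {A : Type u} [CommRing A] [Algebra k A] (d : Module.End k W)
    (f : Module.End A (A ⊗[k] W)) :
    Commute f (d.baseChange A) ↔ ∀ (φ : Module.Dual k W) (w : W),
      evalCoeff f (MvPolynomial.X (φ, d w) - MvPolynomial.X (φ ∘ₗ d, w)) = 0 := by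
  have h1 : ∀ (φ : Module.Dual k W) (w : W), matrixCoeff f (φ, d w) =
      matrixCoeff (f * d.baseChange A) (φ, w) := fun φ w => by simp [matrixCoeff]
  have h2 : ∀ (φ : Module.Dual k W) (w : W), matrixCoeff f (φ ∘ₗ d, w) =
      matrixCoeff (d.baseChange A * f) (φ, w) := fun φ w => by
    simp only [matrixCoeff, Module.End.mul_apply, dual_baseChange_comp]
  simp only [map_sub, evalCoeff_X, h1, h2, sub_eq_zero]
  constructor
  · intro h φ w
    rw [h.eq]
  · intro h
    exact end_ext_of_matrixCoeff fun c => h c.1 c.2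

section Least

attribute [local instance] zariskiTopology

variable {W : Type v} [AddCommGroup W] [Module ℚ W]
  {h : Circle →* LinearMap.GeneralLinearGroup ℝ (ℝ ⊗[ℚ] W)}
  {K : Type} [Field K] [Algebra ℚ K] {G : AlgebraicSubgroup ℚ W}

theorem circleGroup_le_pts (hG : h.range ≤ G.pts ℝ) : circleGroup h K ≤ G.pts K := by
  obtain ⟨S, hS⟩ := G.exists_equations
  refine circleGroup_le fun τ g hg => ?_
  rw [SetLike.mem_coe, hS]
  intro p hp
  refine evalCoeff_eq_zero_of_mem_circlePts h (fun z => ?_) τ hg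
  exact (hS ℝ (h z)).1 (hG ⟨z, rfl⟩) p hp

variable [FiniteDimensional ℚ W] [IsAlgClosed K] [IsGalois ℚ K]

/-- By specialization, a rational polynomial that is nonzero somewhere on the circle is nonzero at a
point of `circlePts` for any chosen embedding of K. -/
theorem evalCoeff_eq_zero_of_circleGroup (hh : IsAnalyticUnimodular h) {p : CoeffRing ℚ W}
    (hp : ∀ g ∈ circleGroup h K, evalCoeff g.val p = 0) (z : Circle) :
    evalCoeff (h z).val p = 0 := by
  let τ : K →ₐ[ℚ] ℂ := IsAlgClosed.lift
  by_contra hne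
  obtain ⟨g, hg, hgp⟩ := hh.exists_mem_circlePts τ (t := 1 ⊗ₜ p) (z := z) (by
    simpa [evalCircle_apply] using hne)
  exact hgp (by simpa using hp g (circlePts_subset_circleGroup τ hg))

variable (h K) in
/-- The Zariski closure over `ℚ` of `circleGroup h K`. -/
noncomputable def circleClosure (hh : IsAnalyticUnimodular h) : AlgebraicSubgroup ℚ W :=
  descendedGroup (circleGroup h K) (fun σ _ hg => galConj_mem_circleGroup σ hg)
    (fun _ hg => det_eq_one_of_mem_circleGroup hh hg)

theorem le_circleClosure (hh : IsAnalyticUnimodular h)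
    (hG : IsLeast {G : AlgebraicSubgroup ℚ W | h.range ≤ G.pts ℝ} G) :
    G ≤ circleClosure h K hh := by
  refine hG.2 ?_
  rintro _ ⟨z, rfl⟩ p hp
  exact evalCoeff_eq_zero_of_circleGroup hh hp z

/-- Minimality of G in its usable form: rational equations for `circleGroup` hold on G over every
algebra, because the closure of `circleGroup` is an algebraic subgroup containing the circle. -/
theorem evalCoeff_eq_zero_of_mem_pts (hh : IsAnalyticUnimodular h)
    (hG : IsLeast {G : AlgebraicSubgroup ℚ W | h.range ≤ G.pts ℝ} G) {p : CoeffRing ℚ W}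
    (hp : ∀ g ∈ circleGroup h K, evalCoeff g.val p = 0) {A : Type} [CommRing A] [Algebra ℚ A]
    {f : LinearMap.GeneralLinearGroup A (A ⊗[ℚ] W)} (hf : f ∈ G.pts A) :
    evalCoeff f.val p = 0 :=
  le_circleClosure (K := K) hh hG A hf p hp

theorem evalCoeff_eq_zero_of_pts (hh : IsAnalyticUnimodular h) (hG : h.range ≤ G.pts ℝ)
    {p : CoeffRing ℚ W} (hp : ∀ g ∈ G.pts K, evalCoeff g.val p = 0) (z : Circle) :
    evalCoeff (h z).val p = 0 :=
  evalCoeff_eq_zero_of_circleGroup (K := K) hh (fun g hg => hp g (circleGroup_le_pts hG hg)) z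

/-- `circleGroup` is connected and dense in G(K): an equation for it over K is a combination of
rational ones by descent, and those hold on G. -/
theorem isConnected_pts (hh : IsAnalyticUnimodular h)
    (hG : IsLeast {G : AlgebraicSubgroup ℚ W | h.range ≤ G.pts ℝ} G) :
    IsConnected (G.pts K : Set (LinearMap.GeneralLinearGroup K (K ⊗[ℚ] W))) := by
  refine ⟨⟨1, one_mem _⟩, (isPreconnected_circleGroup hh).subset_closure
    (circleGroup_le_pts hG.1) fun g hg => ?_⟩
  rw [isTopologicalBasis_zariski.mem_closure_iff]
  rintro _ ⟨F, hF, rfl⟩ hgF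
  obtain ⟨s, hs⟩ := exists_evalExt_of_regular hF
  by_contra hne
  have hzero : ∀ γ ∈ circleGroup h K, evalExt γ s = 0 := by
    intro γ hγ
    by_contra hγs
    exact hne ⟨γ, by rw [← hs] at hγs; exact hγs, hγ⟩
  have h1 := mem_baseChange_vanishing (circleGroup h K)
    (fun σ _ hg => galConj_mem_circleGroup σ hg) s hzero
  have h2 := baseChange_apply_eq_zero_of_mem (A := K) (evalCoeff g.val).toLinearMap
    (fun p hp => by
      simp only [Submodule.mem_iInf, LinearMap.mem_ker] at hp
      exact evalCoeff_eq_zero_of_mem_pts hh hG hp hg) h1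
  have h3 : evalExt g s = LinearMap.mul' ℚ K
      (LinearMap.baseChange K (evalCoeff g.val).toLinearMap s) := by
    generalize s = s'
    induction s' with
    | zero => simp
    | add x y hx hy => rw [map_add, map_add, map_add, hx, hy]
    | tmul a p => simp
  refine hgF ?_
  rw [hs, h3, h2, map_zero]

theorem commute_baseChange_of_mem_pts (L : Type) [Field L] [Algebra ℚ L] [IsAlgClosed L]
    [IsGalois ℚ L] (hh : IsAnalyticUnimodular h)
    (hG : IsLeast {G : AlgebraicSubgroup ℚ W | h.range ≤ G.pts ℝ} G) {d : Module.End ℚ W}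
    (hd : ∀ z, Commute (h z).val (d.baseChange ℝ)) {A : Type} [CommRing A] [Algebra ℚ A]
    {f : LinearMap.GeneralLinearGroup A (A ⊗[ℚ] W)} (hf : f ∈ G.pts A) :
    Commute f.val (d.baseChange A) := by
  have h1 : ∀ g ∈ circleGroup h L, Commute g.val (d.baseChange L) := by
    intro g hg
    induction hg using Subgroup.closure_induction with
    | mem g hg =>
      obtain ⟨τ, hg⟩ := Set.mem_iUnion.1 hg
      rw [commute_baseChange_iff]
      intro φ w
      exact evalCoeff_eq_zero_of_mem_circlePts h
        (fun z => (commute_baseChange_iff d _).1 (hd z) φ w) τ hg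
    | one => exact Commute.one_left _
    | mul x y _ _ hx hy => exact hx.mul_left hy
    | inv x _ hx => exact hx.units_inv_left
  rw [commute_baseChange_iff]
  intro φ w
  exact evalCoeff_eq_zero_of_mem_pts hh hG
    (fun g hg => (commute_baseChange_iff d _).1 (h1 g hg) φ w) hf

theorem commute_baseChange_of_pts (hh : IsAnalyticUnimodular h) (hG : h.range ≤ G.pts ℝ)
    {d : Module.End ℚ W} (hd : ∀ g ∈ G.pts K, Commute g.val (d.baseChange K)) (z : Circle) :
    Commute (h z).val (d.baseChange ℝ) := by
  rw [commute_baseChange_iff]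
  intro φ w
  exact evalCoeff_eq_zero_of_pts (K := K) hh hG
    (fun g hg => (commute_baseChange_iff d _).1 (hd g hg) φ w) z

theorem det_eq_one_of_mem_pts (hh : IsAnalyticUnimodular h)
    (hG : IsLeast {G : AlgebraicSubgroup ℚ W | h.range ≤ G.pts ℝ} G)
    {g : LinearMap.GeneralLinearGroup K (K ⊗[ℚ] W)} (hg : g ∈ G.pts K) :
    LinearMap.det g.val = 1 := by
  have h1 := evalCoeff_eq_zero_of_mem_pts (K := K) hh hG
    (p := (genericMatrix (Module.finBasis ℚ W)).det - 1)
    (fun γ hγ => by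
      rw [map_sub, evalCoeff_det, det_eq_one_of_mem_circleGroup hh hγ, map_one, sub_self]) hg
  rw [map_sub, evalCoeff_det, map_one] at h1
  exact sub_eq_zero.1 h1

/-- A rational subspace that is stable under the points over `K` is stable under the circle. -/
theorem apply_mem_baseChange_of_pts (hh : IsAnalyticUnimodular h) (hG : h.range ≤ G.pts ℝ)
    {U : Submodule ℚ W}
    (hU : ∀ g ∈ G.pts K, ∀ u ∈ U, g.val (1 ⊗ₜ u) ∈ U.baseChange K) (z : Circle) {u : W}
    (hu : u ∈ U) : (h z).val (1 ⊗ₜ u) ∈ U.baseChange ℝ := by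
  obtain ⟨q, hq⟩ := U.exists_isCompl
  have h1 : ∀ φ : Module.Dual ℚ W, (∀ x ∈ U, φ x = 0) →
      evalCoeff (h z).val (MvPolynomial.X (φ, u)) = 0 := by
    intro φ hφ
    refine evalCoeff_eq_zero_of_pts (K := K) hh hG (fun g hg => ?_) z
    rw [evalCoeff_X]
    have h2 := hU g hg u hu
    have h3 := baseChange_apply_eq_zero_of_mem (A := K) φ hφ h2
    rw [matrixCoeff, Module.Dual.baseChange]
    simp [h3]
  -- A rational projection onto U. Membership in the base change of U is the vanishing of 1 - P,
  -- that is, of matrix coefficients (φ, u) with φ zero on U, and these equations are rational.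
  let P : Module.End ℚ W := U.subtype ∘ₗ U.projectionOnto q hq
  have hP : ∀ x, P x ∈ U := fun x => (U.projectionOnto q hq x).2
  have hP1 : ∀ x ∈ U, P x = x := fun x hx => by
    show ((U.projectionOnto q hq x : U) : W) = x
    exact congrArg Subtype.val (Submodule.projectionOnto_apply_left hq ⟨x, hx⟩)
  have h4 : (1 - P).baseChange ℝ ((h z).val (1 ⊗ₜ u)) = 0 := by
    let b := Module.finBasis ℚ W
    rw [← (b.baseChange ℝ).forall_coord_eq_zero_iff]
    intro i
    have h5 : ∀ x : ℝ ⊗[ℚ] W, (b.baseChange ℝ).coord i x =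
        Module.Dual.baseChange ℝ (b.coord i) x := by
      intro x
      induction x with
      | zero => simp
      | add x y hx hy => simp only [map_add, hx, hy]
      | tmul a w => simp [Module.Dual.baseChange_apply_tmul]
    rw [h5, dual_baseChange_comp]
    have h6 := h1 (b.coord i ∘ₗ (1 - P)) (fun x hx => by simp [hP1 x hx])
    rw [evalCoeff_X] at h6
    exact h6
  have h7 : ∀ x : ℝ ⊗[ℚ] W, x = (1 - P).baseChange ℝ x + P.baseChange ℝ x := by
    intro x
    rw [← LinearMap.add_apply, ← LinearMap.baseChange_add, sub_add_cancel]
    exact (LinearMap.congr_fun (LinearMap.baseChange_id (R := ℚ) (A := ℝ) (M := W)) x).symm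
  rw [h7 ((h z).val (1 ⊗ₜ u)), h4, zero_add]
  generalize (h z).val (1 ⊗ₜ u) = x
  induction x with
  | zero => simp
  | add x y hx hy => rw [map_add]; exact add_mem hx hy
  | tmul a w => exact Submodule.tmul_mem_baseChange_of_mem a (hP w)

end Least

/-! ### Commutative normal subgroups -/

/-- A nonzero stable subspace of a finite-dimensional space contains a minimal one. -/
theorem exists_minimal_stable {K V : Type*} [Field K] [AddCommGroup V] [Module K V]
    [FiniteDimensional K V] (S : Set (Module.End K V)) {U : Submodule K V} (hU : U ≠ ⊥)
    (hS : ∀ f ∈ S, ∀ x ∈ U, f x ∈ U) :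
    ∃ U₀ ≤ U, U₀ ≠ ⊥ ∧ (∀ f ∈ S, ∀ x ∈ U₀, f x ∈ U₀) ∧
      ∀ U' ≤ U₀, U' ≠ ⊥ → (∀ f ∈ S, ∀ x ∈ U', f x ∈ U') → U' = U₀ := by
  obtain ⟨U₀, ⟨h1, h2, h3⟩, hmin⟩ := wellFounded_lt.has_min
    {U' : Submodule K V | U' ≤ U ∧ U' ≠ ⊥ ∧ ∀ f ∈ S, ∀ x ∈ U', f x ∈ U'} ⟨U, le_rfl, hU, hS⟩
  refine ⟨U₀, h1, h2, h3, fun U' hle hne hst => ?_⟩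
  by_contra hneq
  exact hmin U' ⟨hle.trans h1, hne, hst⟩ (lt_of_le_of_ne hle hneq)

/-- Commuting endomorphisms have a common eigenvector in each nonzero stable subspace. -/
theorem exists_common_eigenvector {K V : Type*} [Field K] [IsAlgClosed K] [AddCommGroup V]
    [Module K V] [FiniteDimensional K V] (S : Set (Module.End K V))
    (hcomm : ∀ f ∈ S, ∀ g ∈ S, Commute f g) {U : Submodule K V} (hU : U ≠ ⊥)
    (hS : ∀ f ∈ S, ∀ x ∈ U, f x ∈ U) :
    ∃ v ∈ U, v ≠ 0 ∧ ∀ f ∈ S, ∃ c : K, f v = c • v := by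
  obtain ⟨U₀, hle, hne, hst, hmin⟩ := exists_minimal_stable S hU hS
  obtain ⟨v, hv, hv0⟩ := Submodule.exists_mem_ne_zero_of_ne_bot hne
  refine ⟨v, hle hv, hv0, fun f hf => ?_⟩
  have : Nontrivial U₀ := Submodule.nontrivial_iff_ne_bot.2 hne
  obtain ⟨c, hc⟩ := Module.End.exists_eigenvalue (f.restrict (hst f hf))
  obtain ⟨w, hw⟩ := hc.exists_hasEigenvector
  have hwc : f w.1 = c • w.1 := congrArg Subtype.val hw.apply_eq_smul
  -- Eigenspaces of f are stable under maps commuting with f, so minimality makes f a scalar on U₀.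
  have := hmin (U₀ ⊓ Module.End.eigenspace f c) inf_le_left (fun h0 => ?_) ?_
  · rw [← this] at hv
    exact ⟨c, Module.End.mem_eigenspace_iff.1 hv.2⟩
  · have hmem : w.1 ∈ U₀ ⊓ Module.End.eigenspace f c :=
      ⟨w.2, Module.End.mem_eigenspace_iff.2 hwc⟩
    rw [h0, Submodule.mem_bot] at hmem
    exact hw.2 (Subtype.ext hmem)
  · rintro g hg x ⟨hx1, hx2⟩
    refine ⟨hst g hg x hx1, ?_⟩
    rw [SetLike.mem_coe, Module.End.mem_eigenspace_iff] at hx2 ⊢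
    have h := LinearMap.congr_fun (hcomm f hf g hg).eq x
    rw [Module.End.mul_apply, Module.End.mul_apply, hx2, map_smul] at h
    exact h

section

attribute [local instance] zariskiTopology

variable {K V : Type*} [Field K] [AddCommGroup V]
    [Module K V] [FiniteDimensional K V]

/-- If a commutative subgroup is normalized by a connected group, then the group preserves
eigenvalues at common eigenvectors. -/
theorem apply_apply_eq_smul_of_normalized {G A : Subgroup (LinearMap.GeneralLinearGroup K V)}
    (hconn : IsPreconnected (G : Set (LinearMap.GeneralLinearGroup K V)))
    (hnorm : ∀ g ∈ G, ∀ a ∈ A, g * a * g⁻¹ ∈ A) {v : V} (hv : v ≠ 0)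
    (heig : ∀ a ∈ A, ∃ c : K, a.val v = c • v) {a : LinearMap.GeneralLinearGroup K V}
    (ha : a ∈ A) {c : K} (hc : a.val v = c • v) {g : LinearMap.GeneralLinearGroup K V}
    (hg : g ∈ G) : a.val (g.val v) = c • g.val v := by
  have hgv : ∀ g : LinearMap.GeneralLinearGroup K V, g.val v ≠ 0 := by
    intro g h0
    refine hv ?_
    have : (g⁻¹).val (g.val v) = v := by
      rw [← Module.End.mul_apply, ← Units.val_mul, inv_mul_cancel]; rfl
    rw [← this, h0, map_zero]
  have h1 : ∀ g : LinearMap.GeneralLinearGroup K V, ∃ c : K, g ∈ G →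
      a.val (g.val v) = c • g.val v := by
    intro g
    by_cases hg : g ∈ G
    -- Since g⁻¹ag is in A, it has v as an eigenvector; hence gv is an eigenvector of a.
    · obtain ⟨c, hc⟩ := heig _ (hnorm g⁻¹ (inv_mem hg) a ha)
      refine ⟨c, fun _ => ?_⟩
      have h2 : a.val (g.val v) = g.val ((g⁻¹ * a * g⁻¹⁻¹).val v) := by
        rw [← Module.End.mul_apply, ← Module.End.mul_apply, ← Units.val_mul, ← Units.val_mul]
        congr 2
        group
      rw [h2, hc, map_smul]
    · exact ⟨0, fun h => absurd h hg⟩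
  choose F hF using h1
  -- The eigenvalue of a at gv takes finitely many values, each on a relatively closed subset of G,
  -- so it does not depend on g.
  have h3 : F g = F 1 := hconn.constant_of_finite_of_isClosed F
    {c | Module.End.HasEigenvalue a.val c} (Module.End.finite_hasEigenvalue a.val)
    (fun g hg => Module.End.hasEigenvalue_of_hasEigenvector
      ⟨Module.End.mem_eigenspace_iff.2 (hF g hg), hgv g⟩)
    (fun c => {g | a.val (g.val v) = c • g.val v}) (fun c => isClosed_apply_eq_smul a v c)
    (fun g hg c => by
      rw [Set.mem_ofPred_eq, hF g hg]
      exact (smul_left_injective K (hgv g)).eq_iff) hg (one_mem G)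
  have h4 : F 1 = c := by
    have := hF 1 (one_mem G)
    rw [Units.val_one, Module.End.one_apply, hc] at this
    exact (smul_left_injective K hv this).symm
  rw [hF g hg, h3, h4]

/-- On a minimal stable subspace of a connected group, the elements of a commutative subgroup that
is normalized by the group act as scalars. -/
theorem exists_scalar_of_minimal [IsAlgClosed K] {G A : Subgroup (LinearMap.GeneralLinearGroup K V)}
    (hconn : IsPreconnected (G : Set (LinearMap.GeneralLinearGroup K V))) (hAG : A ≤ G)
    (hcomm : ∀ a ∈ A, ∀ b ∈ A, a * b = b * a)
    (hnorm : ∀ g ∈ G, ∀ a ∈ A, g * a * g⁻¹ ∈ A) {U : Submodule K V} (hU : U ≠ ⊥)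
    (hst : ∀ g ∈ G, ∀ x ∈ U, g.val x ∈ U)
    (hmin : ∀ U' ≤ U, U' ≠ ⊥ → (∀ g ∈ G, ∀ x ∈ U', g.val x ∈ U') → U' = U)
    {a : LinearMap.GeneralLinearGroup K V} (ha : a ∈ A) : ∃ c : K, ∀ x ∈ U, a.val x = c • x := by
  obtain ⟨v, hvU, hv0, hv⟩ := exists_common_eigenvector (Units.val '' (A : Set _))
    (by
      rintro _ ⟨a, ha, rfl⟩ _ ⟨b, hb, rfl⟩
      exact congrArg Units.val (hcomm a ha b hb)) hU
    (by
      rintro _ ⟨a, ha, rfl⟩ x hx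
      exact hst a (hAG ha) x hx)
  obtain ⟨c, hc⟩ := hv _ ⟨a, ha, rfl⟩
  refine ⟨c, ?_⟩
  -- The orbit of a common eigenvector spans U by minimality, and a has the same eigenvalue along
  -- the orbit.
  have hspan := hmin (Submodule.span K {x | ∃ g ∈ G, x = g.val v}) ?_ ?_ ?_
  · intro x hx
    rw [← hspan] at hx
    induction hx using Submodule.span_induction with
    | mem x hx =>
      obtain ⟨g, hg, rfl⟩ := hx
      exact apply_apply_eq_smul_of_normalized hconn hnorm hv0 (fun a ha => hv _ ⟨a, ha, rfl⟩) ha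
        hc hg
    | zero => simp
    | add x y _ _ hx hy => rw [map_add, hx, hy, smul_add]
    | smul r x _ hx => rw [map_smul, hx, smul_comm]
  · rw [Submodule.span_le]
    rintro _ ⟨g, hg, rfl⟩
    exact hst g hg v hvU
  · intro h0
    have : v ∈ Submodule.span K {x | ∃ g ∈ G, x = g.val v} :=
      Submodule.subset_span ⟨1, one_mem G, rfl⟩
    rw [h0, Submodule.mem_bot] at this
    exact hv0 this
  · intro g hg x hx
    induction hx using Submodule.span_induction with
    | mem x hx =>
      obtain ⟨g', hg', rfl⟩ := hx
      exact Submodule.subset_span ⟨g * g', mul_mem hg hg', rfl⟩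
    | zero => rw [map_zero]; exact zero_mem _
    | add x y _ _ hx hy => rw [map_add]; exact add_mem hx hy
    | smul r x _ hx => rw [map_smul]; exact Submodule.smul_mem _ _ hx

end

/-! ### Semisimplicity from simplicity over ℚ and a centre of bounded order. -/

section Semisimple

attribute [local instance] zariskiTopology

variable {W : Type v} [AddCommGroup W] [Module ℚ W]
  {h : Circle →* LinearMap.GeneralLinearGroup ℝ (ℝ ⊗[ℚ] W)}
  {K : Type} [Field K] [Algebra ℚ K] {G : AlgebraicSubgroup ℚ W}

variable (h) in
/-- `W` has no subspaces that are stable under the circle, except zero and itself. -/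
def IsCircleSimple : Prop :=
  ∀ U : Submodule ℚ W, (∀ z, ∀ u ∈ U, (h z).val (1 ⊗ₜ u) ∈ U.baseChange ℝ) → U = ⊥ ∨ U = ⊤

variable (K) in
/-- The minimal nonzero stable subspaces of `K ⊗ W`. -/
def IsMinimalStable (G : AlgebraicSubgroup ℚ W) (U : Submodule K (K ⊗[ℚ] W)) : Prop :=
  U ≠ ⊥ ∧ (∀ g ∈ G.pts K, ∀ x ∈ U, g.val x ∈ U) ∧
    ∀ U' ≤ U, U' ≠ ⊥ → (∀ g ∈ G.pts K, ∀ x ∈ U', g.val x ∈ U') → U' = U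

/-- The preimage of a subspace under the Galois action. -/
noncomputable def galComap (σ : K ≃ₐ[ℚ] K) (U : Submodule K (K ⊗[ℚ] W)) :
    Submodule K (K ⊗[ℚ] W) where
  carrier := {x | galAct W σ x ∈ U}
  add_mem' hx hy := by
    rw [Set.mem_ofPred_eq, map_add]
    exact add_mem hx hy
  zero_mem' := by simp
  smul_mem' c x hx := by
    rw [Set.mem_ofPred_eq, galAct_smul]
    exact U.smul_mem _ hx

theorem mem_galComap {σ : K ≃ₐ[ℚ] K} {U : Submodule K (K ⊗[ℚ] W)} {x : K ⊗[ℚ] W} :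
    x ∈ galComap σ U ↔ galAct W σ x ∈ U := Iff.rfl

theorem galComap_symm_galComap (σ : K ≃ₐ[ℚ] K) (U : Submodule K (K ⊗[ℚ] W)) :
    galComap σ.symm (galComap σ U) = U := by
  ext x
  rw [mem_galComap, mem_galComap, galAct_galAct_symm]

theorem galComap_mono {σ : K ≃ₐ[ℚ] K} {U U' : Submodule K (K ⊗[ℚ] W)} (hU : U ≤ U') :
    galComap σ U ≤ galComap σ U' := fun _ hx => hU hx

theorem galComap_bot (σ : K ≃ₐ[ℚ] K) : galComap (W := W) σ ⊥ = ⊥ := by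
  rw [eq_bot_iff]
  intro x hx
  rw [mem_galComap, Submodule.mem_bot] at hx
  rw [Submodule.mem_bot, ← galAct_symm_galAct σ x, hx, map_zero]

theorem galComap_ne_bot {σ : K ≃ₐ[ℚ] K} {U : Submodule K (K ⊗[ℚ] W)} (hU : U ≠ ⊥) :
    galComap σ U ≠ ⊥ := by
  intro h0
  refine hU ?_
  rw [← galComap_symm_galComap σ U, h0, galComap_bot]

theorem galComap_stable (σ : K ≃ₐ[ℚ] K) {U : Submodule K (K ⊗[ℚ] W)}
    (hU : ∀ g ∈ G.pts K, ∀ x ∈ U, g.val x ∈ U) :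
    ∀ g ∈ G.pts K, ∀ x ∈ galComap σ U, g.val x ∈ galComap σ U := by
  intro g hg x hx
  rw [mem_galComap, ← galConj_galAct]
  exact hU _ (G.galConj_mem σ hg) _ hx

theorem IsMinimalStable.galComap {U : Submodule K (K ⊗[ℚ] W)} (hU : IsMinimalStable K G U)
    (σ : K ≃ₐ[ℚ] K) : IsMinimalStable K G (galComap σ U) := by
  obtain ⟨h1, h2, h3⟩ := hU
  refine ⟨galComap_ne_bot h1, galComap_stable σ h2, fun U' hle hne hst => ?_⟩
  have h4 := h3 (_root_.galComap σ.symm U')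
    (by rw [← galComap_symm_galComap σ U]; exact galComap_mono hle) (galComap_ne_bot hne)
    (galComap_stable σ.symm hst)
  have h5 := galComap_symm_galComap σ.symm U'
  rw [AlgEquiv.symm_symm] at h5
  rw [← h4, h5]

variable [FiniteDimensional ℚ W] [IsAlgClosed K] [IsGalois ℚ K]

/-- `K ⊗ W` is the sum of the minimal stable subspaces. -/
theorem sSup_isMinimalStable [Nontrivial W] (hh : IsAnalyticUnimodular h)
    (hG : h.range ≤ G.pts ℝ) (hs : IsCircleSimple h) :
    sSup {U : Submodule K (K ⊗[ℚ] W) | IsMinimalStable K G U} = ⊤ := by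
  set S := sSup {U : Submodule K (K ⊗[ℚ] W) | IsMinimalStable K G U} with hS
  have hgal : ∀ σ : K ≃ₐ[ℚ] K, ∀ x ∈ S, galAct W σ x ∈ S := by
    intro σ
    have : S ≤ galComap σ S := by
      refine sSup_le fun U hU x hx => ?_
      rw [mem_galComap]
      have h1 : galComap σ.symm U ≤ S := le_sSup (hU.galComap σ.symm)
      refine h1 ?_
      rw [mem_galComap, galAct_symm_galAct]
      exact hx
    exact this
  have hst : ∀ g ∈ G.pts K, ∀ x ∈ S, g.val x ∈ S := by
    intro g hg
    have : S ≤ S.comap g.val := sSup_le fun U hU x hx => le_sSup (α := Submodule K _) hU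
      (hU.2.1 g hg x hx)
    exact this
  -- The sum S is Galois stable, because conjugation permutes minimal stable subspaces. So S is
  -- rational, and simplicity over ℚ leaves only zero and everything.
  have hrat : ∀ x ∈ S, x ∈ ((S.restrictScalars ℚ).comap (TensorProduct.mk ℚ K W 1)).baseChange K :=
    fun x hx => mem_span_rational_of_galAct_stable S hgal hx
  set U := (S.restrictScalars ℚ).comap (TensorProduct.mk ℚ K W 1)
  rcases hs U fun z u hu => apply_mem_baseChange_of_pts (K := K) hh hG
    (fun g hg u hu => hrat _ (hst g hg _ hu)) z hu with h0 | h1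
  · exfalso
    have : Nontrivial (K ⊗[ℚ] W) := by
      have := Module.Free.chooseBasis ℚ W
      exact Module.FaithfullyFlat.rTensor_nontrivial ℚ W K
    obtain ⟨U₀, -, h2, h3, h4⟩ := exists_minimal_stable (Units.val '' (G.pts K : Set _))
      (U := (⊤ : Submodule K (K ⊗[ℚ] W))) top_ne_bot (fun _ _ _ _ => trivial)
    have h5 : U₀ ≤ S := le_sSup ⟨h2, fun g hg => h3 _ ⟨g, hg, rfl⟩, fun U' hle hne hst =>
      h4 U' hle hne (by rintro _ ⟨g, hg, rfl⟩; exact hst g hg)⟩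
    refine h2 (eq_bot_iff.2 fun x hx => ?_)
    have := hrat x (h5 hx)
    rwa [h0, Submodule.baseChange_bot] at this
  · rw [eq_top_iff]
    intro x _
    induction x with
    | zero => exact zero_mem _
    | add x y hx hy => exact add_mem (hx trivial) (hy trivial)
    | tmul a w =>
      have hw : w ∈ U := h1 ▸ Submodule.mem_top
      have : a ⊗ₜ[ℚ] w = a • ((1 : K) ⊗ₜ[ℚ] w) := by simp [TensorProduct.smul_tmul']
      rw [this]
      exact S.smul_mem a hw

/-- Commutative subgroups that are normal in the points over `K` are central. -/
theorem mul_comm_of_commutative_normal [Nontrivial W] (hh : IsAnalyticUnimodular h)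
    (hG : IsLeast {G : AlgebraicSubgroup ℚ W | h.range ≤ G.pts ℝ} G) (hs : IsCircleSimple h)
    {A : Subgroup (LinearMap.GeneralLinearGroup K (K ⊗[ℚ] W))} (hAG : A ≤ G.pts K)
    (hcomm : ∀ a ∈ A, ∀ b ∈ A, a * b = b * a)
    (hnorm : ∀ g ∈ G.pts K, ∀ a ∈ A, g * a * g⁻¹ ∈ A)
    {a g : LinearMap.GeneralLinearGroup K (K ⊗[ℚ] W)} (ha : a ∈ A) (hg : g ∈ G.pts K) :
    Commute g.val a.val := by
  have hle : sSup {U : Submodule K (K ⊗[ℚ] W) | IsMinimalStable K G U} ≤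
      LinearMap.ker (g.val * a.val - a.val * g.val) := by
    refine sSup_le fun U hU x hx => ?_
    obtain ⟨c, hc⟩ := exists_scalar_of_minimal (isConnected_pts (K := K) hh hG).isPreconnected
      hAG hcomm hnorm hU.1 hU.2.1 hU.2.2 ha
    rw [LinearMap.mem_ker, LinearMap.sub_apply, Module.End.mul_apply, Module.End.mul_apply,
      hc x hx, hc _ (hU.2.1 g hg x hx), map_smul, sub_self]
  rw [sSup_isMinimalStable hh hG.1 hs, top_le_iff, LinearMap.ker_eq_top] at hle
  exact sub_eq_zero.1 hle

/-- Connected commutative normal subgroups of finite exponent are trivial. -/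
theorem eq_bot_of_commutative_normal [Nontrivial W] (hh : IsAnalyticUnimodular h)
    (hG : IsLeast {G : AlgebraicSubgroup ℚ W | h.range ≤ G.pts ℝ} G) (hs : IsCircleSimple h)
    {A : Subgroup (LinearMap.GeneralLinearGroup K (K ⊗[ℚ] W))} (hAG : A ≤ G.pts K)
    (hcomm : ∀ a ∈ A, ∀ b ∈ A, a * b = b * a)
    (hnorm : ∀ g ∈ G.pts K, ∀ a ∈ A, g * a * g⁻¹ ∈ A)
    (hconn : IsPreconnected (A : Set (LinearMap.GeneralLinearGroup K (K ⊗[ℚ] W))))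
    {n : ℕ} (hn : 0 < n) (hexp : ∀ a ∈ A, a ^ n = 1) : A = ⊥ := by
  rw [eq_bot_iff]
  intro a ha
  rw [Subgroup.mem_bot]
  have hle : sSup {U : Submodule K (K ⊗[ℚ] W) | IsMinimalStable K G U} ≤
      LinearMap.ker (a.val - 1) := by
    refine sSup_le fun U hU x hx => ?_
    by_cases hx0 : x = 0
    · rw [hx0]; exact zero_mem _
    have hF : ∀ a : LinearMap.GeneralLinearGroup K (K ⊗[ℚ] W), ∃ c : K,
        a ∈ A → a.val x = c • x := by
      intro a
      by_cases ha : a ∈ A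
      · obtain ⟨c, hc⟩ := exists_scalar_of_minimal (isConnected_pts (K := K) hh hG).isPreconnected
          hAG hcomm hnorm hU.1 hU.2.1 hU.2.2 ha
        exact ⟨c, fun _ => hc x hx⟩
      · exact ⟨0, fun h => absurd h ha⟩
    choose F hF using hF
    -- The eigenvalue at x is an n-th root of unity. Finitely many values with closed fibres on a
    -- connected group force it to equal its value at the identity.
    have h1 : F a = F 1 := hconn.constant_of_finite_of_isClosed F
      {c | c ^ n = 1} ?_ (fun a ha => ?_) (fun c => {g | g.val x = c • x})
      (fun c => isClosed_apply_eq_smul_self x c)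
      (fun g hg c => by
        rw [Set.mem_ofPred_eq, hF g hg]
        exact (smul_left_injective K hx0).eq_iff) ha (one_mem A)
    · have h2 := hF 1 (one_mem A)
      rw [LinearMap.mem_ker, LinearMap.sub_apply, hF a ha, h1, ← h2]
      simp
    · classical
      refine (Polynomial.nthRoots n (1 : K)).toFinset.finite_toSet.subset fun c hc => ?_
      simpa [Polynomial.mem_nthRoots hn] using hc
    · have h3 : ∀ m : ℕ, (a ^ m).val x = F a ^ m • x := by
        intro m
        induction m with
        | zero => simp
        | succ m ih =>
          rw [pow_succ, Units.val_mul, Module.End.mul_apply, hF a ha, map_smul, ih, smul_smul,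
            pow_succ, mul_comm]
      have h4 := h3 n
      rw [hexp a ha, Units.val_one, Module.End.one_apply] at h4
      have h5 : (F a ^ n) • x = (1 : K) • x := by rw [← h4, one_smul]
      exact smul_left_injective K hx0 h5
  rw [sSup_isMinimalStable hh hG.1 hs, top_le_iff, LinearMap.ker_eq_top] at hle
  exact Units.ext (sub_eq_zero.1 hle)

/-- Connected solvable normal subgroups are trivial if the elements of the centre have bounded
order. -/
theorem eq_bot_of_solvable_normal [Nontrivial W] (hh : IsAnalyticUnimodular h)
    (hG : IsLeast {G : AlgebraicSubgroup ℚ W | h.range ≤ G.pts ℝ} G) (hs : IsCircleSimple h)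
    {n : ℕ} (hn : 0 < n)
    (hexp : ∀ a ∈ G.pts K, (∀ g ∈ G.pts K, Commute g.val a.val) → a ^ n = 1)
    {N : Subgroup (LinearMap.GeneralLinearGroup K (K ⊗[ℚ] W))} (hNG : N ≤ G.pts K)
    (hnorm : ∀ g ∈ G.pts K, ∀ a ∈ N, g * a * g⁻¹ ∈ N)
    (hconn : IsPreconnected (N : Set (LinearMap.GeneralLinearGroup K (K ⊗[ℚ] W))))
    (hsolv : Group.IsSolvable N) : N = ⊥ := by
  obtain ⟨m, hm⟩ := hsolv.solvable
  let D : ℕ → Subgroup (LinearMap.GeneralLinearGroup K (K ⊗[ℚ] W)) := fun i => (derivedSeries N i).map N.subtype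
  have hDsucc : ∀ i, D (i + 1) = ⁅D i, D i⁆ := fun i => Subgroup.map_commutator _ _ _
  have hDN : ∀ i, D i ≤ N := fun i => by
    rintro _ ⟨x, -, rfl⟩
    exact x.2
  have hD0 : D 0 = N := by
    show (⊤ : Subgroup N).map N.subtype = N
    rw [← MonoidHom.range_eq_map, Subgroup.range_subtype]
  have hprop : ∀ i, IsPreconnected (D i : Set (LinearMap.GeneralLinearGroup K (K ⊗[ℚ] W))) ∧
      ∀ g ∈ G.pts K, ∀ a ∈ D i, g * a * g⁻¹ ∈ D i := by
    intro i
    induction i with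
    | zero => rw [hD0]; exact ⟨hconn, hnorm⟩
    | succ i ih =>
      rw [hDsucc]
      refine ⟨isPreconnected_commutator
        (fun x hx => det_eq_one_of_mem_pts hh hG (hNG (hDN i hx))) ih.1, fun g hg a ha => ?_⟩
      have h1 : (⁅D i, D i⁆).map (MulAut.conj g).toMonoidHom ≤ ⁅D i, D i⁆ := by
        rw [Subgroup.map_commutator]
        have h2 : (D i).map (MulAut.conj g).toMonoidHom ≤ D i := by
          rintro _ ⟨x, hx, rfl⟩
          exact ih.2 g hg x hx
        exact Subgroup.commutator_mono h2 h2
      exact h1 ⟨a, ha, rfl⟩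
  -- If the next derived group is trivial, this one is commutative, hence central, hence of bounded
  -- exponent; being connected, it is trivial.
  have hstep : ∀ i, D (i + 1) = ⊥ → D i = ⊥ := by
    intro i hi
    rw [hDsucc] at hi
    have hcomm : ∀ a ∈ D i, ∀ b ∈ D i, a * b = b * a := by
      intro a ha b hb
      have h1 := Subgroup.commutator_mem_commutator ha hb
      rw [hi, Subgroup.mem_bot] at h1
      exact commutatorElement_eq_one_iff_mul_comm.1 h1
    exact eq_bot_of_commutative_normal hh hG hs ((hDN i).trans hNG) hcomm (hprop i).2 (hprop i).1
      hn fun a ha => hexp a (hNG (hDN i ha)) fun g hg =>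
        mul_comm_of_commutative_normal hh hG hs ((hDN i).trans hNG) hcomm (hprop i).2 ha hg
  have hDm : D m = ⊥ := by
    show (derivedSeries N m).map N.subtype = ⊥
    rw [hm, Subgroup.map_bot]
  rw [← hD0]
  clear hm
  induction m with
  | zero => exact hDm
  | succ m ih => exact ih (hstep m hDm)

/-- The group is semisimple if the elements of its centre have bounded order. -/
theorem isSemisimple_of_forall_central [Nontrivial W] (hh : IsAnalyticUnimodular h)
    (hG : IsLeast {G : AlgebraicSubgroup ℚ W | h.range ≤ G.pts ℝ} G) (hs : IsCircleSimple h)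
    {n : ℕ} (hn : 0 < n)
    (hexp : ∀ (L : Type) [Field L] [Algebra ℚ L] [IsAlgClosed L] [IsGalois ℚ L],
      ∀ a ∈ G.pts L, (∀ g ∈ G.pts L, Commute g.val a.val) → a ^ n = 1) :
    G.IsSemisimple := by
  let : Algebra ℚ (AlgebraicClosure ℚ) := AlgebraicClosure.instAlgebra ℚ
  have : IsGalois ℚ (AlgebraicClosure ℚ) := IsAlgClosure.isGalois ℚ _
  exact ⟨isConnected_pts hh hG, fun N hNG hnorm _ hconn hsolv =>
    eq_bot_of_solvable_normal hh hG hs hn (hexp (AlgebraicClosure ℚ)) hNG hnorm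
      hconn.isPreconnected hsolv⟩

end Semisimple

/-! ### The commutant of the circle and its centre -/

section Commutant

variable {W : Type v} [AddCommGroup W] [Module ℚ W]
  (h : Circle →* LinearMap.GeneralLinearGroup ℝ (ℝ ⊗[ℚ] W))
  {K : Type} [Field K] [Algebra ℚ K] {G : AlgebraicSubgroup ℚ W}

/-- The rational endomorphisms that commute with the circle. -/
noncomputable def circleCommutant : Subalgebra ℚ (Module.End ℚ W) where
  carrier := {d | ∀ z, Commute (h z).val (d.baseChange ℝ)}
  mul_mem' {a b} ha hb z := by
    rw [LinearMap.baseChange_mul]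
    exact (ha z).mul_right (hb z)
  add_mem' {a b} ha hb z := by
    rw [LinearMap.baseChange_add]
    exact (ha z).add_right (hb z)
  algebraMap_mem' r z := by
    have : (algebraMap ℚ (Module.End ℚ W) r).baseChange ℝ = r • (1 : Module.End ℝ (ℝ ⊗[ℚ] W)) := by
      rw [Algebra.algebraMap_eq_smul_one, LinearMap.baseChange_smul, LinearMap.baseChange_one]
    rw [this]
    exact (Commute.one_right _).smul_right r

/-- The centre of the commutant of the circle. -/
noncomputable def circleCenter : Subalgebra ℚ (Module.End ℚ W) :=
  circleCommutant h ⊓ Subalgebra.centralizer ℚ (circleCommutant h : Set (Module.End ℚ W))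

variable {h}

theorem mem_circleCommutant {d : Module.End ℚ W} :
    d ∈ circleCommutant h ↔ ∀ z, Commute (h z).val (d.baseChange ℝ) := Iff.rfl

theorem mem_circleCenter {d : Module.End ℚ W} :
    d ∈ circleCenter h ↔ d ∈ circleCommutant h ∧ ∀ d' ∈ circleCommutant h, d' * d = d * d' := by
  rw [circleCenter, Algebra.mem_inf, Subalgebra.mem_centralizer_iff]
  rfl

variable (K) in
/-- The action of `K ⊗ Z` on `K ⊗ W`, for a subalgebra `Z` of the endomorphisms of `W`. -/
noncomputable def extendedAction (Z : Subalgebra ℚ (Module.End ℚ W)) :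
    K ⊗[ℚ] Z →ₐ[K] Module.End K (K ⊗[ℚ] W) :=
  Algebra.TensorProduct.lift (Algebra.ofId K _) ((Module.End.baseChangeHom ℚ K W).comp Z.val)
    fun x _ => (Algebra.commutes x _ : Commute (algebraMap K (Module.End K (K ⊗[ℚ] W)) x) _)

@[simp]
theorem extendedAction_tmul (Z : Subalgebra ℚ (Module.End ℚ W)) (a : K) (d : Z) :
    extendedAction K Z (a ⊗ₜ d) = a • d.1.baseChange K := by
  rw [Algebra.smul_def]
  exact Algebra.TensorProduct.lift_tmul ..

/-- The matrix coefficient `(φ, w)` of the commutator of `f` and an endomorphism of `W`. -/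
noncomputable def commutatorCoeff (f : Module.End K (K ⊗[ℚ] W)) (φ : Module.Dual ℚ W) (w : W) :
    Module.End K (K ⊗[ℚ] W) →ₗ[K] K :=
  Module.Dual.baseChange K φ ∘ₗ LinearMap.applyₗ (1 ⊗ₜ[ℚ] w) ∘ₗ
      LinearMap.mulLeft K f -
    Module.Dual.baseChange K φ ∘ₗ LinearMap.applyₗ (1 ⊗ₜ[ℚ] w) ∘ₗ LinearMap.mulRight K f

theorem commutatorCoeff_apply (f x : Module.End K (K ⊗[ℚ] W)) (φ : Module.Dual ℚ W) (w : W) :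
    commutatorCoeff f φ w x = matrixCoeff (f * x) (φ, w) - matrixCoeff (x * f) (φ, w) := rfl

theorem commutatorCoeff_baseChange (f : Module.End K (K ⊗[ℚ] W)) (d : Module.End ℚ W)
    (φ : Module.Dual ℚ W) (w : W) : commutatorCoeff f φ w (d.baseChange K) =
      matrixCoeff f (φ, d w) - matrixCoeff f (φ ∘ₗ d, w) := by
  simp [commutatorCoeff_apply, matrixCoeff, dual_baseChange_comp]

theorem commutatorCoeff_eq_zero {f x : Module.End K (K ⊗[ℚ] W)} (hfx : Commute f x)
    (φ : Module.Dual ℚ W) (w : W) : commutatorCoeff f φ w x = 0 := by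
  rw [commutatorCoeff_apply, hfx.eq, sub_self]

theorem liftBaseChange_comp_baseChangeHom (N : Module.End K (K ⊗[ℚ] W) →ₗ[K] K)
    (t : K ⊗[ℚ] Module.End ℚ W) :
    LinearMap.liftBaseChange K (N.restrictScalars ℚ ∘ₗ LinearMap.baseChangeHom ℚ K W W) t =
      N (LinearMap.liftBaseChange K (LinearMap.baseChangeHom ℚ K W W) t) := by
  induction t with
  | zero => simp
  | add x y hx hy => simp only [map_add, hx, hy]
  | tmul c d => simp

variable [FiniteDimensional ℚ W]

/-- Every endomorphism of `K ⊗ W` comes from `K ⊗ End W`. -/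
theorem exists_liftBaseChange_eq (a : Module.End K (K ⊗[ℚ] W)) :
    ∃ t : K ⊗[ℚ] Module.End ℚ W,
      LinearMap.liftBaseChange K (LinearMap.baseChangeHom ℚ K W W) t = a := by
  let b := Module.finBasis ℚ W
  refine ⟨∑ i, ∑ j, matrixCoeff a (b.coord i, b j) ⊗ₜ (b.coord j).smulRight (b i),
    end_ext_of_one_tmul fun w => ?_⟩
  rw [apply_one_tmul_eq_sum b a w]
  simp only [map_sum, LinearMap.liftBaseChange_tmul, LinearMap.sum_apply]
  refine Finset.sum_congr rfl fun i _ => ?_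
  rw [matrixCoeff_eq_sum b a (b.coord i) w, Finset.sum_comm, Finset.sum_smul]
  refine Finset.sum_congr rfl fun j _ => ?_
  rw [Finset.sum_eq_single i (fun k _ hk => by simp [Module.Basis.coord_apply, hk]) (by simp)]
  simp only [LinearMap.smul_apply, LinearMap.baseChangeHom_apply, LinearMap.baseChange_tmul,
    LinearMap.smulRight_apply, Module.Basis.coord_apply, Module.Basis.repr_self,
    Finsupp.single_eq_same, one_mul]
  rw [TensorProduct.tmul_smul, mul_comm, mul_smul, algebraMap_smul, smul_comm]

theorem commute_of_commutatorCoeff_eq_zero {f x : Module.End K (K ⊗[ℚ] W)}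
    (hfx : ∀ φ w, commutatorCoeff f φ w x = 0) : Commute f x :=
  end_ext_of_matrixCoeff fun c => sub_eq_zero.1 (hfx c.1 c.2)

/-- Exhibits invariance of B on rational vectors as quadratic equations over ℚ in the matrix
coefficients. -/
theorem evalCoeff_bilin {A : Type} [CommRing A] [Algebra ℚ A]
    (B : LinearMap.BilinForm ℚ W) (f : Module.End A (A ⊗[ℚ] W)) (w w' : W) :
    evalCoeff f (∑ i, ∑ j, MvPolynomial.C (B (Module.finBasis ℚ W i) (Module.finBasis ℚ W j)) *
      (MvPolynomial.X ((Module.finBasis ℚ W).coord i, w) *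
        MvPolynomial.X ((Module.finBasis ℚ W).coord j, w')) - MvPolynomial.C (B w w')) =
      B.baseChange A (f (1 ⊗ₜ w)) (f (1 ⊗ₜ w')) - algebraMap ℚ A (B w w') := by
  have hC : ∀ r : ℚ, evalCoeff f (MvPolynomial.C r) = algebraMap ℚ A r :=
    fun r => (evalCoeff f).commutes r
  set b := Module.finBasis ℚ W
  rw [apply_one_tmul_eq_sum b f w, apply_one_tmul_eq_sum b f w']
  simp only [map_sub, map_sum, map_mul, hC, evalCoeff_X, LinearMap.sum_apply, map_smul,
    LinearMap.smul_apply, LinearMap.BilinForm.baseChange_tmul, smul_eq_mul]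
  congr 1
  rw [Finset.sum_comm]
  refine Finset.sum_congr rfl fun j _ => ?_
  rw [Finset.mul_sum]
  refine Finset.sum_congr rfl fun i _ => ?_
  rw [mul_one, Algebra.smul_def]
  ring

variable [IsAlgClosed K] [IsGalois ℚ K]

/-- Central points over `K` belong to `K ⊗ Z`, with `Z` the centre of the commutant. -/
theorem exists_extendedAction_eq (hh : IsAnalyticUnimodular h)
    (hG : IsLeast {G : AlgebraicSubgroup ℚ W | h.range ≤ G.pts ℝ} G)
    {a : LinearMap.GeneralLinearGroup K (K ⊗[ℚ] W)} (ha : a ∈ G.pts K)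
    (hcent : ∀ g ∈ G.pts K, Commute g.val a.val) :
    ∃ t, extendedAction K (circleCenter h) t = a.val := by
  obtain ⟨t, ht⟩ := exists_liftBaseChange_eq a.val
  let Ψ : Module.End K (K ⊗[ℚ] W) → Module.Dual ℚ W → W → (Module.End ℚ W →ₗ[ℚ] K) :=
    fun f φ w => (commutatorCoeff f φ w).restrictScalars ℚ ∘ₗ LinearMap.baseChangeHom ℚ K W W
  have hΨ : ∀ f φ w d, Ψ f φ w d = commutatorCoeff f φ w (d.baseChange K) := fun _ _ _ _ => rfl
  -- The functionals are the matrix coefficients of commutators with G(K) and with D. They form a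
  -- Galois stable set, and all of them vanish at a, which is central and, like all of G, commutes
  -- with D.
  have key := mem_baseChange_of_forall_liftBaseChange
    ({ψ | ∃ g ∈ G.pts K, ∃ φ w, ψ = Ψ g.val φ w} ∪
      {ψ | ∃ d ∈ circleCommutant h, ∃ φ w, ψ = Ψ (d.baseChange K) φ w})
    (by
      rintro σ _ (⟨g, hg, φ, w, rfl⟩ | ⟨d', hd', φ, w, rfl⟩)
      · refine Or.inl ⟨galConj W σ g, G.galConj_mem σ hg, φ, w, LinearMap.ext fun d => ?_⟩
        show σ (Ψ g.val φ w d) = _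
        rw [hΨ, hΨ, commutatorCoeff_baseChange, commutatorCoeff_baseChange, map_sub,
          matrixCoeff_galConj, matrixCoeff_galConj]
      · refine Or.inr ⟨d', hd', φ, w, LinearMap.ext fun d => ?_⟩
        show σ (Ψ _ φ w d) = _
        rw [hΨ, commutatorCoeff_baseChange]
        simp only [matrixCoeff, LinearMap.baseChange_tmul, dual_baseChange_apply_one_tmul,
          map_sub, AlgEquiv.commutes]) t
    (by
      rintro _ (⟨g, hg, φ, w, rfl⟩ | ⟨d', hd', φ, w, rfl⟩)
      · rw [liftBaseChange_comp_baseChangeHom, ht]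
        exact commutatorCoeff_eq_zero (hcent g hg) φ w
      · rw [liftBaseChange_comp_baseChangeHom, ht]
        exact commutatorCoeff_eq_zero (commute_baseChange_of_mem_pts K hh hG hd' ha).symm φ w)
  have hle : (⨅ ψ ∈ ({ψ | ∃ g ∈ G.pts K, ∃ φ w, ψ = Ψ g.val φ w} ∪
      {ψ | ∃ d ∈ circleCommutant h, ∃ φ w, ψ = Ψ (d.baseChange K) φ w}), LinearMap.ker ψ) ≤
      Subalgebra.toSubmodule (circleCenter h) := by
    intro d hd
    simp only [Submodule.mem_iInf, LinearMap.mem_ker] at hd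
    rw [Subalgebra.mem_toSubmodule, mem_circleCenter]
    constructor
    -- A rational endomorphism that commutes with G(K) commutes with the circle, hence is in D;
    -- commuting with D as well puts it in the centre.
    · rw [mem_circleCommutant]
      exact commute_baseChange_of_pts (K := K) hh hG.1 fun g hg =>
        commute_of_commutatorCoeff_eq_zero fun φ w => hd _ (Or.inl ⟨g, hg, φ, w, rfl⟩)
    · intro d' hd'
      have h1 : Commute (d'.baseChange K) (d.baseChange K) :=
        commute_of_commutatorCoeff_eq_zero fun φ w => hd _ (Or.inr ⟨d', hd', φ, w, rfl⟩)
      have h2 := h1.eq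
      rw [← LinearMap.baseChange_mul, ← LinearMap.baseChange_mul] at h2
      refine LinearMap.ext fun w => ?_
      have h3 := LinearMap.congr_fun h2 (1 ⊗ₜ w)
      rw [LinearMap.baseChange_tmul, LinearMap.baseChange_tmul] at h3
      exact Module.FaithfullyFlat.tensorProduct_mk_injective (A := ℚ) (B := K) W h3
  obtain ⟨s, hs⟩ := Submodule.baseChange_mono (A := K) hle key
  refine ⟨s, ?_⟩
  rw [← ht, ← hs]
  generalize s = s'
  induction s' with
  | zero => simp
  | add x y hx hy => rw [map_add, map_add, hx, hy, map_add]
  | tmul c d => rw [extendedAction_tmul]; simp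

/-- If the centre of the commutant consists of scalars, the centre of the group has bounded
order. -/
theorem pow_finrank_eq_one_of_scalar (hh : IsAnalyticUnimodular h)
    (hG : IsLeast {G : AlgebraicSubgroup ℚ W | h.range ≤ G.pts ℝ} G)
    (hscal : ∀ d ∈ circleCenter h, ∃ r : ℚ, d = r • (1 : Module.End ℚ W))
    {a : LinearMap.GeneralLinearGroup K (K ⊗[ℚ] W)} (ha : a ∈ G.pts K)
    (hcent : ∀ g ∈ G.pts K, Commute g.val a.val) :
    a ^ Module.finrank ℚ W = 1 := by
  obtain ⟨t, ht⟩ := exists_extendedAction_eq hh hG ha hcent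
  have h1 : ∀ t, ∃ c : K, extendedAction K (circleCenter h) t = c • 1 := by
    intro t
    induction t with
    | zero => exact ⟨0, by simp⟩
    | add x y hx hy =>
      obtain ⟨c, hc⟩ := hx
      obtain ⟨c', hc'⟩ := hy
      exact ⟨c + c', by rw [map_add, hc, hc', add_smul]⟩
    | tmul b d =>
      obtain ⟨r, hr⟩ := hscal d.1 d.2
      refine ⟨b * algebraMap ℚ K r, ?_⟩
      rw [extendedAction_tmul, hr, LinearMap.baseChange_smul, LinearMap.baseChange_one, mul_smul,
        algebraMap_smul]
  obtain ⟨c, hc⟩ := h1 t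
  rw [ht] at hc
  -- A scalar c of determinant one satisfies c ^ dim W = 1.
  have h2 := det_eq_one_of_mem_pts hh hG ha
  rw [hc, LinearMap.det_smul, map_one, mul_one, Module.finrank_baseChange] at h2
  refine Units.ext ?_
  rw [Units.val_pow_eq_pow_val, hc, smul_pow, h2, one_pow, one_smul]; rfl

/-- Invariance passes from the circle to `circlePts` as a rational equation, to `circleGroup`
because isometries form a group, and to G(K) again as a rational equation. -/
theorem baseChange_apply_apply_of_mem_pts (hh : IsAnalyticUnimodular h)
    (hG : IsLeast {G : AlgebraicSubgroup ℚ W | h.range ≤ G.pts ℝ} G)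
    {B : LinearMap.BilinForm ℚ W}
    (hB : ∀ z x y, B.baseChange ℝ ((h z).val x) ((h z).val y) = B.baseChange ℝ x y)
    {g : LinearMap.GeneralLinearGroup K (K ⊗[ℚ] W)} (hg : g ∈ G.pts K) (x y : K ⊗[ℚ] W) :
    B.baseChange K (g.val x) (g.val y) = B.baseChange K x y := by
  have hone : ∀ {A : Type} [CommRing A] [Algebra ℚ A] (w w' : W),
      B.baseChange A (1 ⊗ₜ w) (1 ⊗ₜ w') = algebraMap ℚ A (B w w') := by
    intro A _ _ w w'
    rw [LinearMap.BilinForm.baseChange_tmul, mul_one, Algebra.algebraMap_eq_smul_one]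
  have hext : ∀ (g : LinearMap.GeneralLinearGroup K (K ⊗[ℚ] W)),
      (∀ w w', B.baseChange K (g.val (1 ⊗ₜ w)) (g.val (1 ⊗ₜ w')) = algebraMap ℚ K (B w w')) →
      ∀ x y, B.baseChange K (g.val x) (g.val y) = B.baseChange K x y := by
    intro g hg x y
    have htm : ∀ (a : K) (w : W), a ⊗ₜ[ℚ] w = a • ((1 : K) ⊗ₜ[ℚ] w) := fun a w => by
      simp [TensorProduct.smul_tmul']
    induction x with
    | zero => simp
    | add x₁ x₂ h₁ h₂ => simp only [map_add, LinearMap.add_apply, h₁, h₂]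
    | tmul a w =>
      induction y with
      | zero => simp
      | add x₁ x₂ h₁ h₂ => simp only [map_add, h₁, h₂]
      | tmul a' w' =>
        rw [htm a w, htm a' w']
        simp only [map_smul, LinearMap.smul_apply, hg, hone]
  have hcirc : ∀ g ∈ circleGroup h K, ∀ x y,
      B.baseChange K (g.val x) (g.val y) = B.baseChange K x y := by
    intro g hg
    induction hg using Subgroup.closure_induction with
    | mem g hg =>
      obtain ⟨τ, hg⟩ := Set.mem_iUnion.1 hg
      refine hext g fun w w' => ?_
      have := evalCoeff_eq_zero_of_mem_circlePts h (fun z => by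
        rw [evalCoeff_bilin B (h z).val w w', hB, hone, sub_self]) τ hg
      rw [evalCoeff_bilin] at this
      exact sub_eq_zero.1 this
    | one => intro x y; rfl
    | mul a b _ _ ha hb =>
      intro x y
      rw [Units.val_mul, Module.End.mul_apply, Module.End.mul_apply, ha, hb]
    | inv a _ ha =>
      intro x y
      have hinv : ∀ x, a.val ((a⁻¹).val x) = x := fun x => by
        rw [← Module.End.mul_apply, ← Units.val_mul, mul_inv_cancel]; rfl
      rw [← ha, hinv, hinv]
  refine hext g (fun w w' => ?_) x y
  have := evalCoeff_eq_zero_of_mem_pts (K := K) hh hG (fun g hg => by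
    rw [evalCoeff_bilin B g.val w w', hcirc g hg, hone, sub_self]) hg
  rw [evalCoeff_bilin] at this
  exact sub_eq_zero.1 this

/-- If the circle preserves a nonzero form for which the centre of the commutant acts by
self-adjoint endomorphisms, the centre of the group has exponent two. -/
theorem sq_eq_one_of_form (hh : IsAnalyticUnimodular h)
    (hG : IsLeast {G : AlgebraicSubgroup ℚ W | h.range ≤ G.pts ℝ} G)
    (hdiv : ∀ d ∈ circleCenter h, d ≠ 0 → Function.Surjective d)
    {B : LinearMap.BilinForm ℚ W} (hB0 : B ≠ 0)
    (hB : ∀ z x y, B.baseChange ℝ ((h z).val x) ((h z).val y) = B.baseChange ℝ x y)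
    (hBadj : ∀ d ∈ circleCenter h, ∀ x y, B (d x) y = B x (d y))
    {a : LinearMap.GeneralLinearGroup K (K ⊗[ℚ] W)} (ha : a ∈ G.pts K)
    (hcent : ∀ g ∈ G.pts K, Commute g.val a.val) : a ^ 2 = 1 := by
  obtain ⟨t, ht⟩ := exists_extendedAction_eq hh hG ha hcent
  have hadj : ∀ t x y, B.baseChange K (extendedAction K (circleCenter h) t x) y =
      B.baseChange K x (extendedAction K (circleCenter h) t y) := by
    intro t x y
    induction t with
    | zero => simp
    | add t₁ t₂ h₁ h₂ => simp only [map_add, LinearMap.add_apply, h₁, h₂]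
    | tmul c d =>
      rw [extendedAction_tmul]
      simp only [LinearMap.smul_apply, map_smul]
      congr 1
      induction x with
      | zero => simp
      | add x₁ x₂ h₁ h₂ => simp only [map_add, LinearMap.add_apply, h₁, h₂]
      | tmul r w =>
        induction y with
        | zero => simp
        | add x₁ x₂ h₁ h₂ => simp only [map_add, h₁, h₂]
        | tmul r' w' =>
          simp only [LinearMap.baseChange_tmul, LinearMap.BilinForm.baseChange_tmul,
            hBadj d.1 d.2]
  set s := t * t - 1 with hs
  -- Self-adjointness turns B(ax, ay) = B(x, y) into B(a²x, y) = B(x, y).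
  have hs0 : ∀ x y, B.baseChange K (extendedAction K (circleCenter h) s x) y = 0 := by
    intro x y
    rw [hs, map_sub, map_mul, map_one, LinearMap.sub_apply, Module.End.mul_apply, map_sub,
      LinearMap.sub_apply, hadj, ht, baseChange_apply_apply_of_mem_pts hh hG hB ha,
      Module.End.one_apply, sub_self]
  let Ψ : W → W → (circleCenter h →ₗ[ℚ] K) := fun x y =>
    { toFun := fun d => algebraMap ℚ K (B (d.1 x) y)
      map_add' := fun d d' => by
        rw [Subalgebra.coe_add, LinearMap.add_apply, map_add, LinearMap.add_apply, map_add]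
      map_smul' := fun r d => by
        rw [Subalgebra.coe_smul, LinearMap.smul_apply, map_smul, LinearMap.smul_apply, smul_eq_mul,
          map_mul, RingHom.id_apply, Algebra.smul_def] }
  have key := mem_baseChange_of_forall_liftBaseChange {ψ | ∃ x y, ψ = Ψ x y}
    (by
      rintro σ _ ⟨x, y, rfl⟩
      exact ⟨x, y, LinearMap.ext fun d => σ.commutes _⟩) s
    (by
      rintro _ ⟨x, y, rfl⟩
      rw [← hs0 (1 ⊗ₜ x) (1 ⊗ₜ y)]
      generalize s = s'
      induction s' with
      | zero => simp
      | add t₁ t₂ h₁ h₂ => simp only [map_add, LinearMap.add_apply, h₁, h₂]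
      | tmul c d =>
        rw [LinearMap.liftBaseChange_tmul, extendedAction_tmul, LinearMap.smul_apply, map_smul,
          LinearMap.smul_apply, LinearMap.baseChange_tmul, LinearMap.BilinForm.baseChange_tmul,
          mul_one, ← Algebra.algebraMap_eq_smul_one]
        rfl)
  -- A nonzero d in the centre is surjective, so B(dx, y) = 0 for all x and y would give B = 0. By
  -- descent this kills t² - 1.
  have hbot : (⨅ ψ ∈ {ψ | ∃ x y, ψ = Ψ x y}, LinearMap.ker ψ) = ⊥ := by
    rw [eq_bot_iff]
    intro d hd
    simp only [Submodule.mem_iInf, LinearMap.mem_ker] at hd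
    rw [Submodule.mem_bot]
    by_contra hne
    refine hB0 (LinearMap.ext fun x => LinearMap.ext fun y => ?_)
    obtain ⟨x', rfl⟩ := hdiv d.1 d.2 (fun h0 => hne (Subtype.ext h0)) x
    exact (map_eq_zero_iff _ (algebraMap ℚ K).injective).1 (hd _ ⟨x', y, rfl⟩)
  rw [hbot, Submodule.baseChange_bot, Submodule.mem_bot] at key
  have h3 : extendedAction K (circleCenter h) (t * t) = 1 := by
    rw [sub_eq_zero.1 (hs.symm.trans key), map_one]
  rw [map_mul, ht] at h3
  refine Units.ext ?_
  rw [sq]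
  exact h3

end Commutant

/-! ### Commutative groups -/

section Commutative

attribute [local instance] zariskiTopology

variable {W : Type v} [AddCommGroup W] [Module ℚ W] [FiniteDimensional ℚ W]
  {h : Circle →* LinearMap.GeneralLinearGroup ℝ (ℝ ⊗[ℚ] W)} {G : AlgebraicSubgroup ℚ W}

/-- A nontrivial simple representation gives no group that is semisimple and commutative. -/
theorem not_isCommutative_of_isSemisimple (hh : IsAnalyticUnimodular h)
    (hG : IsLeast {G : AlgebraicSubgroup ℚ W | h.range ≤ G.pts ℝ} G) (hs : IsCircleSimple h)
    (hdim : 1 < Module.finrank ℚ W) (hss : G.IsSemisimple) : ¬ G.IsCommutative := by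
  intro hcomm
  let : Algebra ℚ (AlgebraicClosure ℚ) := AlgebraicClosure.instAlgebra ℚ
  have : IsGalois ℚ (AlgebraicClosure ℚ) := IsAlgClosure.isGalois ℚ _
  have hbot : G.pts (AlgebraicClosure ℚ) = ⊥ := by
    -- A commutative G(K) is a connected solvable normal subgroup of itself, hence trivial by
    -- semisimplicity; then every rational line is stable.
    refine hss.2 _ le_rfl (fun g hg n hn => mul_mem (mul_mem hg hn) (inv_mem hg))
      G.isClosed_pts (isConnected_pts hh hG) ?_
    exact Group.isSolvable_of_comm fun a b => Subtype.ext (hcomm _ _ a.2 _ b.2)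
  obtain ⟨w, hw⟩ : ∃ w : W, w ≠ 0 := by
    have : Nontrivial W := Module.nontrivial_of_finrank_pos (R := ℚ) (by omega)
    exact exists_ne 0
  rcases hs (Submodule.span ℚ {w}) fun z u hu => apply_mem_baseChange_of_pts
    (K := AlgebraicClosure ℚ) hh hG.1 (fun g hg u hu => by
      rw [hbot, Subgroup.mem_bot] at hg
      rw [hg]
      exact Submodule.tmul_mem_baseChange_of_mem 1 hu) z hu with h0 | h1
  · exact hw (Submodule.span_singleton_eq_bot.1 h0)
  · have := finrank_span_singleton (K := ℚ) hw
    rw [h1, finrank_top] at this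
    omega

/-- The group is commutative if the commutant is commutative and has a cyclic vector. -/
theorem isCommutative_of_cyclic (hh : IsAnalyticUnimodular h)
    (hG : IsLeast {G : AlgebraicSubgroup ℚ W | h.range ≤ G.pts ℝ} G)
    (hcomm : ∀ d ∈ circleCommutant h, ∀ d' ∈ circleCommutant h, d * d' = d' * d) {w₀ : W}
    (hw₀ : ∀ w, ∃ d ∈ circleCommutant h, d w₀ = w) : G.IsCommutative := by
  intro A _ _ x hx y hy
  have hD : ∀ x ∈ G.pts A, ∀ d ∈ circleCommutant h, Commute x.val (d.baseChange A) := by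
    let : Algebra ℚ (AlgebraicClosure ℚ) := AlgebraicClosure.instAlgebra ℚ
    have : IsGalois ℚ (AlgebraicClosure ℚ) := IsAlgClosure.isGalois ℚ _
    exact fun x hx d hd => commute_baseChange_of_mem_pts (AlgebraicClosure ℚ) hh hG hd hx
  let S : Submodule A (Module.End A (A ⊗[ℚ] W)) :=
    Submodule.span A {f | ∃ d ∈ circleCommutant h, f = d.baseChange A}
  have hS : ∀ f : Module.End A (A ⊗[ℚ] W), (∀ d ∈ circleCommutant h,
      Commute f (d.baseChange A)) → ∀ s ∈ S, Commute f s := by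
    intro f hf s hs
    induction hs using Submodule.span_induction with
    | mem s hs => obtain ⟨d, hd, rfl⟩ := hs; exact hf d hd
    | zero => exact Commute.zero_right f
    | add s t _ _ hs ht => exact hs.add_right ht
    | smul a s _ hs => exact hs.smul_right a
  have hSD : ∀ s ∈ S, ∀ d ∈ circleCommutant h, Commute s (d.baseChange A) := by
    intro s hs d hd
    refine (hS _ (fun d' hd' => ?_) s hs).symm
    show _ * _ = _ * _
    rw [← LinearMap.baseChange_mul, ← LinearMap.baseChange_mul, hcomm d hd d' hd']
  have hsurj : ∀ v : A ⊗[ℚ] W, ∃ s ∈ S, s (1 ⊗ₜ w₀) = v := by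
    intro v
    induction v with
    | zero => exact ⟨0, zero_mem _, rfl⟩
    | add v v' hv hv' =>
      obtain ⟨s, hs, rfl⟩ := hv
      obtain ⟨s', hs', rfl⟩ := hv'
      exact ⟨s + s', add_mem hs hs', rfl⟩
    | tmul a w =>
      obtain ⟨d, hd, rfl⟩ := hw₀ w
      refine ⟨a • d.baseChange A, S.smul_mem a (Submodule.subset_span ⟨d, hd, rfl⟩), ?_⟩
      rw [LinearMap.smul_apply, LinearMap.baseChange_tmul, TensorProduct.smul_tmul', smul_eq_mul,
        mul_one]
  obtain ⟨s, hs, hsx⟩ := hsurj (x.val (1 ⊗ₜ w₀))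
  -- Both x and s commute with D and agree at the cyclic vector, so they agree everywhere. Thus x
  -- lies in the span of D, with which y commutes.
  have hxs : x.val = s := end_ext_of_one_tmul fun w => by
    obtain ⟨d, hd, rfl⟩ := hw₀ w
    rw [← LinearMap.baseChange_tmul, ← Module.End.mul_apply, ← Module.End.mul_apply,
      (hD x hx d hd).eq, (hSD s hs d hd).eq, Module.End.mul_apply, Module.End.mul_apply, hsx]
  refine Units.ext ?_
  rw [Units.val_mul, Units.val_mul, hxs]
  exact (hS y.val (hD y hy) s hs).eq.symm

end Commutative

/-! ### The rational lattice of a complex torus -/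

namespace ComplexTorus

variable {V : Type v} [NormedAddCommGroup V] [NormedSpace ℂ V] [FiniteDimensional ℂ V]
  (Λ : Submodule ℤ V) [DiscreteTopology Λ] [IsZLattice ℝ Λ]

instance finiteDimensional_rationalLattice : FiniteDimensional ℚ (rationalLattice Λ) := by
  have : FiniteDimensional ℝ V := FiniteDimensional.complexToReal V
  have : Module.Finite ℤ Λ := ZLattice.module_finite ℝ Λ
  infer_instance

theorem finrank_rationalLattice :
    Module.finrank ℚ (rationalLattice Λ) = 2 * Module.finrank ℂ V := by
  have : FiniteDimensional ℝ V := FiniteDimensional.complexToReal V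
  rw [Module.finrank_baseChange, ZLattice.rank ℝ Λ, finrank_real_of_complex]

/-- The embedding of `Λ_ℚ` into `V`. -/
noncomputable def latticeMap : rationalLattice Λ →+ V :=
  (realificationEquiv Λ).toLinearMap.toAddMonoidHom.comp
    (TensorProduct.mk ℚ ℝ (rationalLattice Λ) 1).toAddMonoidHom

theorem latticeMap_apply (w : rationalLattice Λ) :
    latticeMap Λ w = realificationEquiv Λ (1 ⊗ₜ w) := rfl

theorem realificationEquiv_tmul' (r : ℝ) (w : rationalLattice Λ) :
    realificationEquiv Λ (r ⊗ₜ w) = r • latticeMap Λ w := by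
  rw [latticeMap_apply, ← map_smul, TensorProduct.smul_tmul', smul_eq_mul, mul_one]

theorem latticeMap_tmul (q : ℚ) (x : Λ) : latticeMap Λ (q ⊗ₜ x) = (q : ℝ) • (x : V) := by
  rw [latticeMap_apply, realificationEquiv_tmul, one_mul]

theorem latticeMap_one_tmul (x : Λ) : latticeMap Λ (1 ⊗ₜ x) = x := by
  rw [latticeMap_tmul, Rat.cast_one, one_smul]

theorem latticeMap_smul (q : ℚ) (w : rationalLattice Λ) :
    latticeMap Λ (q • w) = (q : ℝ) • latticeMap Λ w := by
  rw [latticeMap_apply, ← realificationEquiv_tmul', ← TensorProduct.smul_tmul,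
    Rat.smul_one_eq_cast]

theorem latticeMap_injective : Function.Injective (latticeMap Λ) := fun _ _ hw =>
  Module.FaithfullyFlat.tensorProduct_mk_injective (A := ℚ) (B := ℝ) (rationalLattice Λ)
    ((realificationEquiv Λ).injective hw)

theorem span_range_latticeMap :
    Submodule.span ℝ (Set.range (latticeMap Λ)) = (⊤ : Submodule ℝ V) := by
  rw [eq_top_iff, ← IsZLattice.span_top (K := ℝ) (L := Λ)]
  exact Submodule.span_mono fun x hx => ⟨1 ⊗ₜ ⟨x, hx⟩, latticeMap_one_tmul Λ ⟨x, hx⟩⟩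

theorem realificationEquiv_circleHom_tmul (z : Circle) (w : rationalLattice Λ) :
    realificationEquiv Λ ((circleHom Λ z).val (1 ⊗ₜ w)) = (z : ℂ) • latticeMap Λ w :=
  realificationEquiv_circleHom Λ z _

/-- Multiplication by the imaginary unit, on `ℝ ⊗ Λ_ℚ`. -/
noncomputable def imaginaryUnit : Module.End ℝ (ℝ ⊗[ℚ] rationalLattice Λ) :=
  (realificationEquiv Λ).symm.toLinearMap ∘ₗ
        (LinearMap.lsmul ℂ V Complex.I).restrictScalars ℝ ∘ₗ (realificationEquiv Λ).toLinearMap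

theorem circleHom_exp (θ : ℝ) : (circleHom Λ (Circle.exp θ)).val =
    Real.cos θ • (1 : Module.End ℝ _) + Real.sin θ • imaginaryUnit Λ := by
  refine LinearMap.ext fun x => (realificationEquiv Λ).injective ?_
  rw [realificationEquiv_circleHom, Circle.coe_exp, Complex.exp_mul_I, add_smul, mul_smul,
    ← Complex.ofReal_cos, ← Complex.ofReal_sin, Complex.coe_smul, Complex.coe_smul]
  simp [imaginaryUnit]

theorem isAnalyticUnimodular_circleHom : IsAnalyticUnimodular (circleHom Λ) where
  det_eq_one z := by
    have : FiniteDimensional ℝ V := FiniteDimensional.complexToReal V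
    have h1 : (circleHom Λ z).val = (realificationEquiv Λ).symm.toLinearMap ∘ₗ
        (LinearMap.lsmul ℂ V (z : ℂ)).restrictScalars ℝ ∘ₗ
          (realificationEquiv Λ).symm.symm.toLinearMap := rfl
    -- The real determinant of a ℂ-linear map is the norm of its complex determinant, here the g-th
    -- power of the norm of z, which is 1.
    rw [h1, LinearMap.det_conj, LinearMap.det_restrictScalars]
    have h2 : LinearMap.lsmul ℂ V (z : ℂ) = (z : ℂ) • LinearMap.id := rfl
    rw [h2, LinearMap.det_smul, LinearMap.det_id, mul_one, map_pow, Algebra.norm_complex_eq]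
    simp
  analytic c := by
    have h1 : (fun θ : ℝ => matrixCoeff (circleHom Λ (Circle.exp θ)).val c) = fun θ =>
        Real.cos θ * matrixCoeff (1 : Module.End ℝ (ℝ ⊗[ℚ] rationalLattice Λ)) c +
          Real.sin θ * matrixCoeff (imaginaryUnit Λ) c := by
      funext θ
      rw [circleHom_exp]
      simp [matrixCoeff]
    rw [h1]
    exact (Real.analyticOnNhd_cos.mul analyticOnNhd_const).add
      (Real.analyticOnNhd_sin.mul analyticOnNhd_const)

/-- Two `ℂ`-linear maps that agree on the lattice are equal. -/
theorem linearMap_ext_latticeMap {F F' : Module.End ℂ V}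
    (hF : ∀ w, F (latticeMap Λ w) = F' (latticeMap Λ w)) : F = F' := by
  have h1 : F.restrictScalars ℝ = F'.restrictScalars ℝ :=
    LinearMap.ext_on_range (v := latticeMap Λ) (span_range_latticeMap Λ) hF
  exact LinearMap.ext fun x => LinearMap.congr_fun h1 x

variable {Λ}

/-- The elements of the commutant of the circle extend to `ℂ`-linear endomorphisms of `V`. -/
theorem mem_circleCommutant_iff {d : Module.End ℚ (rationalLattice Λ)} :
    d ∈ circleCommutant (circleHom Λ) ↔
      ∃ F : Module.End ℂ V, ∀ w, F (latticeMap Λ w) = latticeMap Λ (d w) := by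
  rw [mem_circleCommutant]
  constructor
  · intro hd
    let F : V →ₗ[ℝ] V := (realificationEquiv Λ).toLinearMap ∘ₗ d.baseChange ℝ ∘ₗ
      (realificationEquiv Λ).symm.toLinearMap
    have hF : ∀ x, F (realificationEquiv Λ x) = realificationEquiv Λ (d.baseChange ℝ x) :=
      fun x => by simp [F]
    have hz : ∀ (z : Circle) x, F ((z : ℂ) • x) = (z : ℂ) • F x := by
      intro z x
      obtain ⟨x, rfl⟩ := (realificationEquiv Λ).surjective x
      rw [← realificationEquiv_circleHom, hF, hF, ← realificationEquiv_circleHom,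
        ← Module.End.mul_apply, ← Module.End.mul_apply, (hd z).eq]
    -- The circle contains i = exp(iπ/2), and a real linear map that commutes with i is ℂ-linear.
    have hI : ∀ x, F (Complex.I • x) = Complex.I • F x := by
      intro x
      have := hz (Circle.exp (Real.pi / 2)) x
      rwa [Circle.coe_exp, Complex.ofReal_div, Complex.ofReal_ofNat,
        Complex.exp_pi_div_two_mul_I] at this
    refine ⟨{ toFun := F, map_add' := F.map_add, map_smul' := fun c x => ?_ }, fun w => ?_⟩
    · have hc : ∀ y : V, c • y = c.re • y + c.im • (Complex.I • y) := fun y => by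
        conv_lhs => rw [← Complex.re_add_im c, add_smul, mul_smul]
        simp
      rw [RingHom.id_apply, hc, hc, map_add, map_smul, map_smul, hI]
    · show F _ = _
      rw [latticeMap_apply, hF, LinearMap.baseChange_tmul]
      rfl
  · rintro ⟨F, hF⟩ z
    refine end_ext_of_one_tmul fun w => (realificationEquiv Λ).injective ?_
    have h1 : ∀ x, realificationEquiv Λ (d.baseChange ℝ x) = F (realificationEquiv Λ x) := by
      intro x
      induction x with
      | zero => simp
      | add x y hx hy => simp only [map_add, hx, hy]
      | tmul r w =>
        rw [LinearMap.baseChange_tmul, realificationEquiv_tmul', realificationEquiv_tmul', ← hF,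
          LinearMap.map_smul_of_tower]
    rw [Module.End.mul_apply, Module.End.mul_apply, h1, realificationEquiv_circleHom,
      realificationEquiv_circleHom, h1, map_smul]

end ComplexTorus

/-! ### Alternating forms and Hodge substructures -/

namespace ComplexTorus

section Forms

variable {V : Type v} [NormedAddCommGroup V] [NormedSpace ℂ V]

theorem H2C.ext' {ω η : H2C V} (hωη : ∀ x y, ω ![x, y] = η ![x, y]) : ω = η := by
  refine AlternatingMap.ext fun v => ?_
  have hv : v = ![v 0, v 1] := by
    funext i
    fin_cases i <;> rfl
  rw [hv]
  exact hωη _ _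

/-- The alternating form given by a bilinear map. -/
noncomputable def H2C.ofBilin (B : V →ₗ[ℝ] V →ₗ[ℝ] ℂ) (hB : ∀ x, B x x = 0) : H2C V where
  toFun v := B (v 0) (v 1)
  map_update_add' v i x y := by
    fin_cases i <;> simp [Function.update_of_ne]
  map_update_smul' v i c x := by
    fin_cases i <;> simp [Function.update_of_ne]
  map_eq_zero_of_eq' v i j hv hij := by
    fin_cases i <;> fin_cases j <;> simp_all

@[simp]
theorem H2C.ofBilin_apply (B : V →ₗ[ℝ] V →ₗ[ℝ] ℂ) (hB : ∀ x, B x x = 0) (x y : V) :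
    H2C.ofBilin B hB ![x, y] = B x y := rfl

theorem H2C.add_left (ω : H2C V) (x x' y : V) :
    ω ![x + x', y] = ω ![x, y] + ω ![x', y] := by
  have hu : ∀ z, Function.update ![x, y] 0 z = ![z, y] := fun z => by
    funext i
    fin_cases i <;> rfl
  have h1 := ω.map_update_add ![x, y] 0 x x'
  rwa [hu, hu, hu] at h1

theorem H2C.smul_left (ω : H2C V) (r : ℝ) (x y : V) : ω ![r • x, y] = r • ω ![x, y] := by
  have hu : ∀ z, Function.update ![x, y] 0 z = ![z, y] := fun z => by
    funext i
    fin_cases i <;> rfl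
  have h1 := ω.map_update_smul ![x, y] 0 r x
  rwa [hu, hu] at h1

theorem H2C.swap (ω : H2C V) (x y : V) : ω ![x, y] = - ω ![y, x] := by
  have h1 := ω.map_swap ![y, x] (i := 0) (j := 1) (by simp)
  rw [← h1]
  congr 1
  funext i
  fin_cases i <;> rfl

theorem H2C.self (ω : H2C V) (x : V) : ω ![x, x] = 0 :=
  ω.map_eq_zero_of_eq ![x, x] (i := 0) (j := 1) rfl (by simp)

/-- The bilinear map given by an alternating form. -/
noncomputable def H2C.toBilin (ω : H2C V) : V →ₗ[ℝ] V →ₗ[ℝ] ℂ :=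
  LinearMap.mk₂ ℝ (fun x y => ω ![x, y]) ω.add_left ω.smul_left
    (fun x y y' => by
      rw [ω.swap x, ω.add_left, ω.swap x y, ω.swap x y', neg_add])
    (fun r x y => by
      rw [ω.swap x, ω.smul_left, ω.swap x y, smul_neg])

theorem H2C.toBilin_apply (ω : H2C V) (x y : V) : ω.toBilin x y = ω ![x, y] := rfl

theorem H2C.add_right (ω : H2C V) (x y y' : V) :
    ω ![x, y + y'] = ω ![x, y] + ω ![x, y'] := map_add (ω.toBilin x) y y'

theorem H2C.smul_right (ω : H2C V) (r : ℝ) (x y : V) : ω ![x, r • y] = r • ω ![x, y] :=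
  map_smul (ω.toBilin x) r y

theorem H2C.neg_right (ω : H2C V) (x y : V) : ω ![x, -y] = - ω ![x, y] :=
  map_neg (ω.toBilin x) y

theorem H2C.neg_left (ω : H2C V) (x y : V) : ω ![-x, y] = - ω ![x, y] :=
  LinearMap.congr_fun (map_neg ω.toBilin x) y

theorem H2C.sum_apply {ι : Type*} (s : Finset ι) (η : ι → H2C V) (v : Fin 2 → V) :
    (∑ k ∈ s, η k) v = ∑ k ∈ s, η k v := by
  classical
  induction s using Finset.induction_on with
  | empty => simp
  | insert a s ha ih => rw [Finset.sum_insert ha, Finset.sum_insert ha, AlternatingMap.add_apply, ih]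

/-- The pull-back of a form under multiplication by a complex number. -/
noncomputable def H2C.pull (z : ℂ) (ω : H2C V) : H2C V :=
  ω.compLinearMap ((LinearMap.lsmul ℂ V z).restrictScalars ℝ)

theorem H2C.pull_apply (z : ℂ) (ω : H2C V) (x y : V) : ω.pull z ![x, y] = ω ![z • x, z • y] := by
  rw [H2C.pull, AlternatingMap.compLinearMap_apply]
  congr 1
  funext i
  fin_cases i <;> rfl

/-- Complex subspaces that are stable under multiplication by complex numbers decompose into their
Hodge components. -/
theorem eq_sup_of_pull_mem {P : Submodule ℂ (H2C V)} (hP : ∀ z, ∀ ω ∈ P, ω.pull z ∈ P) :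
    P = (P ⊓ H20 V) ⊔ (P ⊓ H11 V) ⊔ (P ⊓ H02 V) := by
  refine le_antisymm (fun ω hω => ?_) (sup_le (sup_le inf_le_left inf_le_left) inf_le_left)
  have hII : ∀ x : V, Complex.I • Complex.I • x = -x := fun x => by
    rw [smul_smul, Complex.I_mul_I, neg_one_smul]
  -- Polarization: pull-back by 1 + i yields the derivation ω(ix, y) + ω(x, iy), which acts on types
  -- (2,0), (1,1), (0,2) as 2i, 0, -2i. The (1,1) part is b, and T separates the two other parts of
  -- ω - b.
  set T : H2C V := ω.pull (1 + Complex.I) - ω - ω.pull Complex.I with hT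
  have hTP : T ∈ P := sub_mem (sub_mem (hP _ ω hω) hω) (hP _ ω hω)
  have hTa : ∀ x y, T ![x, y] = ω ![Complex.I • x, y] + ω ![x, Complex.I • y] := by
    intro x y
    rw [hT, AlternatingMap.sub_apply, AlternatingMap.sub_apply, H2C.pull_apply, H2C.pull_apply,
      add_smul, one_smul, add_smul, one_smul, H2C.add_left, H2C.add_right, H2C.add_right]
    ring
  set b : H2C V := (1 / 2 : ℂ) • (ω + ω.pull Complex.I) with hb
  have hba : ∀ x y, b ![x, y] = (1 / 2) * (ω ![x, y] + ω ![Complex.I • x, Complex.I • y]) := by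
    intro x y
    rw [hb, AlternatingMap.smul_apply, AlternatingMap.add_apply, H2C.pull_apply, smul_eq_mul]
  set η : H2C V := ω - b with hη
  have hηa : ∀ x y, η ![x, y] = (1 / 2) * (ω ![x, y] - ω ![Complex.I • x, Complex.I • y]) := by
    intro x y
    rw [hη, AlternatingMap.sub_apply, hba]
    ring
  have hbP : b ∈ P := P.smul_mem _ (add_mem hω (hP _ ω hω))
  have hηP : η ∈ P := sub_mem hω hbP
  have hηI : ∀ x y, η ![Complex.I • x, y] = (1 / 2) * T ![x, y] := by
    intro x y
    rw [hηa, hTa, hII, H2C.neg_left]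
    ring
  have hTI : ∀ x y, T ![Complex.I • x, y] = -2 * η ![x, y] := by
    intro x y
    rw [hηa, hTa, hII, H2C.neg_left]
    ring
  have ha20 : (1 / 2 : ℂ) • (η - (Complex.I / 2) • T) ∈ H20 V := by
    intro x y
    simp only [AlternatingMap.smul_apply, AlternatingMap.sub_apply, smul_eq_mul, hηI, hTI]
    linear_combination (1 / 4 * T ![x, y]) * Complex.I_sq
  have hc02 : (1 / 2 : ℂ) • (η + (Complex.I / 2) • T) ∈ H02 V := by
    intro x y
    simp only [AlternatingMap.smul_apply, AlternatingMap.add_apply, smul_eq_mul, hηI, hTI]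
    linear_combination (1 / 4 * T ![x, y]) * Complex.I_sq
  have hb11 : b ∈ H11 V := by
    intro x y
    rw [hba, hba, hII, hII, H2C.neg_left, H2C.neg_right]
    ring
  have hsum : ω = (1 / 2 : ℂ) • (η - (Complex.I / 2) • T) + b +
      (1 / 2 : ℂ) • (η + (Complex.I / 2) • T) := by
    have h1 : ω = η + b := by rw [hη, sub_add_cancel]
    rw [h1]
    module
  rw [hsum]
  refine add_mem (Submodule.mem_sup_left (add_mem (Submodule.mem_sup_left ⟨?_, ha20⟩)
    (Submodule.mem_sup_right ⟨hbP, hb11⟩))) (Submodule.mem_sup_right ⟨?_, hc02⟩)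
  · exact P.smul_mem _ (sub_mem hηP (P.smul_mem _ hTP))
  · exact P.smul_mem _ (add_mem hηP (P.smul_mem _ hTP))

end Forms

/-! ### Rational forms and complexifications. -/

section Rational

variable {V : Type v} [NormedAddCommGroup V] [NormedSpace ℂ V] [FiniteDimensional ℂ V]
  {Λ : Submodule ℤ V} [DiscreteTopology Λ] [IsZLattice ℝ Λ]

theorem form_ext_basis {ι : Type*} (b : Module.Basis ι ℚ (rationalLattice Λ)) {ω η : H2C V}
    (hωη : ∀ i j, ω ![latticeMap Λ (b i), latticeMap Λ (b j)] =
      η ![latticeMap Λ (b i), latticeMap Λ (b j)]) : ω = η := by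
  let b' : Module.Basis ι ℝ V := (b.baseChange ℝ).map (realificationEquiv Λ)
  have hb' : ∀ i, b' i = latticeMap Λ (b i) := fun i => by
    rw [latticeMap_apply, Module.Basis.map_apply, Module.Basis.baseChange_apply]
  have h1 : ω.toBilin = η.toBilin := b'.ext fun i => b'.ext fun j => by
    rw [hb', hb']
    exact hωη i j
  exact H2C.ext' fun x y => by rw [← H2C.toBilin_apply, h1, H2C.toBilin_apply]

theorem form_ext {ω η : H2C V} (hωη : ∀ w w', ω ![latticeMap Λ w, latticeMap Λ w'] =
      η ![latticeMap Λ w, latticeMap Λ w']) : ω = η :=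
  form_ext_basis (Module.finBasis ℚ (rationalLattice Λ)) fun _ _ => hωη _ _

/-- Rational alternating forms on `Λ_ℚ` extend to forms on `V`. -/
theorem exists_form_of_bilin (B : LinearMap.BilinForm ℚ (rationalLattice Λ))
    (hB : ∀ w, B w w = 0) :
    ∃ η ∈ H2Q Λ, ∀ w w', η ![latticeMap Λ w, latticeMap Λ w'] = B w w' := by
  have hskew : ∀ w w', B w w' = - B w' w := fun w w' => by
    have := hB (w + w')
    simp only [map_add, LinearMap.add_apply, hB, zero_add, add_zero] at this
    linarith
  have hskewR : ∀ x y, B.baseChange ℝ x y = - B.baseChange ℝ y x := by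
    intro x y
    induction x with
    | zero => simp
    | add x₁ x₂ h₁ h₂ => rw [map_add, LinearMap.add_apply, h₁, h₂, map_add]; ring
    | tmul r w =>
      induction y with
      | zero => simp
      | add x₁ x₂ h₁ h₂ => rw [map_add, h₁, h₂, map_add, LinearMap.add_apply]; ring
      | tmul r' w' =>
        rw [LinearMap.BilinForm.baseChange_tmul, LinearMap.BilinForm.baseChange_tmul, hskew w w',
          neg_smul, mul_comm]
  let C : V →ₗ[ℝ] V →ₗ[ℝ] ℂ :=
    ((B.baseChange ℝ).compl₁₂ (realificationEquiv Λ).symm.toLinearMap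
      (realificationEquiv Λ).symm.toLinearMap).compr₂ Complex.ofRealCLM.toLinearMap
  have hC : ∀ x y, C x y = ((B.baseChange ℝ ((realificationEquiv Λ).symm x)
      ((realificationEquiv Λ).symm y) : ℝ) : ℂ) := fun _ _ => rfl
  have hCB : ∀ w w', C (latticeMap Λ w) (latticeMap Λ w') = B w w' := by
    intro w w'
    rw [hC, latticeMap_apply, latticeMap_apply, LinearEquiv.symm_apply_apply,
      LinearEquiv.symm_apply_apply, LinearMap.BilinForm.baseChange_tmul, mul_one,
      Rat.smul_one_eq_cast, Complex.ofReal_ratCast]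
  refine ⟨H2C.ofBilin C fun x => ?_, fun x hx y hy => ?_, fun w w' => ?_⟩
  · have h1 := hskewR ((realificationEquiv Λ).symm x) ((realificationEquiv Λ).symm x)
    rw [hC, Complex.ofReal_eq_zero]
    linarith
  · refine ⟨B (1 ⊗ₜ ⟨x, hx⟩) (1 ⊗ₜ ⟨y, hy⟩), ?_⟩
    rw [← hCB, latticeMap_one_tmul, latticeMap_one_tmul]
    rfl
  · rw [H2C.ofBilin_apply, hCB]

/-- The components of a complex form with respect to a rational functional on `ℂ`. -/
theorem exists_form_component (ω : H2C V) (l : ℂ →ₗ[ℚ] ℚ) :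
    ∃ η ∈ H2Q Λ, ∀ w w', η ![latticeMap Λ w, latticeMap Λ w'] =
      (l (ω ![latticeMap Λ w, latticeMap Λ w']) : ℚ) := by
  have hs : ∀ (q : ℚ) (z : ℂ), (q : ℝ) • z = q • z := fun q z => by
    rw [Complex.real_smul, Complex.ofReal_ratCast, Rat.smul_def]
  let B : LinearMap.BilinForm ℚ (rationalLattice Λ) :=
    LinearMap.mk₂ ℚ (fun w w' => l (ω ![latticeMap Λ w, latticeMap Λ w']))
      (fun w₁ w₂ w' => by rw [map_add, H2C.add_left, map_add])
      (fun q w w' => by rw [latticeMap_smul, H2C.smul_left, hs, map_smul])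
      (fun w w₁ w₂ => by rw [map_add, H2C.add_right, map_add])
      (fun q w w' => by rw [latticeMap_smul, H2C.smul_right, hs, map_smul])
  exact exists_form_of_bilin B fun w => by
    show l _ = 0
    rw [H2C.self, map_zero]

/-- A complex subspace is the complexification of its rational forms if it contains the rational
components of its elements. -/
theorem complexification_inf_H2Q {P : Submodule ℂ (H2C V)}
    (hP : ∀ ω ∈ P, ∀ (l : ℂ →ₗ[ℚ] ℚ) (η : H2C V),
      (∀ w w', η ![latticeMap Λ w, latticeMap Λ w'] =
        (l (ω ![latticeMap Λ w, latticeMap Λ w']) : ℚ)) → η ∈ P) :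
    complexification (P.restrictScalars ℚ ⊓ H2Q Λ) = P := by
  refine le_antisymm (Submodule.span_le.2 fun η hη => hη.1) fun ω hω => ?_
  -- Expanding the values of ω in a basis of ℂ over ℚ writes ω as a combination of rational forms,
  -- finite because ω has finitely many values on a basis of Λ_ℚ.
  let 𝓑 := Module.Basis.ofVectorSpace ℚ ℂ
  let b := Module.finBasis ℚ (rationalLattice Λ)
  choose η hηQ hη using fun k => exists_form_component (Λ := Λ) ω (𝓑.coord k)
  classical
  let S : Finset _ := Finset.univ.biUnion fun i => Finset.univ.biUnion fun j =>
    (𝓑.repr (ω ![latticeMap Λ (b i), latticeMap Λ (b j)])).support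
  have hsum : ω = ∑ k ∈ S, 𝓑 k • η k := by
    refine form_ext_basis b fun i j => ?_
    rw [H2C.sum_apply]
    simp only [AlternatingMap.smul_apply, hη, smul_eq_mul]
    conv_lhs => rw [← 𝓑.linearCombination_repr (ω ![latticeMap Λ (b i), latticeMap Λ (b j)]),
      Finsupp.linearCombination_apply]
    rw [Finsupp.sum_of_support_subset (s := S)]
    · refine Finset.sum_congr rfl fun k _ => ?_
      rw [Rat.smul_def, mul_comm]
      rfl
    · intro k hk
      exact Finset.mem_biUnion.2 ⟨i, Finset.mem_univ i,
        Finset.mem_biUnion.2 ⟨j, Finset.mem_univ j, hk⟩⟩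
    · simp
  rw [hsum]
  exact sum_mem fun k _ => Submodule.smul_mem _ _
    (Submodule.subset_span ⟨hP ω hω _ _ (hη k), hηQ k⟩)

/-- The consequence of 2-simplicity for subspaces of `H²(T, ℂ)` that are rational and stable under
multiplication by complex numbers. -/
theorem IsTwoSimple.le_of_ne_bot (hT : IsTwoSimple Λ) {P : Submodule ℂ (H2C V)}
    (hP : ∀ ω ∈ P, ∀ (l : ℂ →ₗ[ℚ] ℚ) (η : H2C V),
      (∀ w w', η ![latticeMap Λ w, latticeMap Λ w'] =
        (l (ω ![latticeMap Λ w, latticeMap Λ w']) : ℚ)) → η ∈ P)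
    (hpull : ∀ z, ∀ ω ∈ P, ω.pull z ∈ P) (hne : P ⊓ H20 V ≠ ⊥) : H20 V ≤ P := by
  have h1 := complexification_inf_H2Q hP
  have h2 := hT (P.restrictScalars ℚ ⊓ H2Q Λ) ⟨inf_le_right, by
    rw [h1]
    exact eq_sup_of_pull_mem hpull⟩
  rw [h1] at h2
  exact h2 hne

end Rational

end ComplexTorus

/-! ### Simplicity -/

section Division

variable {W : Type v} [AddCommGroup W] [Module ℚ W]
  {h : Circle →* LinearMap.GeneralLinearGroup ℝ (ℝ ⊗[ℚ] W)}

/-- Schur's lemma: the range of d is stable under the circle. -/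
theorem IsCircleSimple.surjective (hs : IsCircleSimple h) {d : Module.End ℚ W}
    (hd : d ∈ circleCommutant h) (hd0 : d ≠ 0) : Function.Surjective d := by
  have hmem : ∀ x : ℝ ⊗[ℚ] W, d.baseChange ℝ x ∈ (LinearMap.range d).baseChange ℝ := by
    intro x
    induction x with
    | zero => rw [map_zero]; exact zero_mem _
    | add x y hx hy => rw [map_add]; exact add_mem hx hy
    | tmul r w => exact Submodule.tmul_mem_baseChange_of_mem r (LinearMap.mem_range_self d w)
  rcases hs (LinearMap.range d) (by
    rintro z _ ⟨w, rfl⟩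
    rw [← LinearMap.baseChange_tmul, ← Module.End.mul_apply, (hd z).eq]
    exact hmem _) with h0 | h1
  · exact absurd (LinearMap.range_eq_bot.1 h0) hd0
  · exact LinearMap.range_eq_top.1 h1

theorem IsCircleSimple.eq_of_apply_eq [FiniteDimensional ℚ W] (hs : IsCircleSimple h)
    {d d' : Module.End ℚ W} (hd : d ∈ circleCommutant h) (hd' : d' ∈ circleCommutant h) {w : W}
    (hw : w ≠ 0) (hdw : d w = d' w) : d = d' := by
  by_contra hne
  have h1 := LinearMap.injective_iff_surjective.2
    (hs.surjective (sub_mem hd hd') (sub_ne_zero.2 hne))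
  refine hw (h1 ?_)
  rw [map_zero, LinearMap.sub_apply, hdw, sub_self]

theorem exists_dual_eq_one {F M : Type*} [Field F] [AddCommGroup M] [Module F M]
    {U : Submodule F M} {x : M} (hx : x ∉ U) :
    ∃ φ : Module.Dual F M, φ x = 1 ∧ ∀ u ∈ U, φ u = 0 := by
  obtain ⟨φ, hφ, hU⟩ := U.exists_le_ker_of_notMem hx
  refine ⟨(φ x)⁻¹ • φ, by simp [hφ], fun u hu => ?_⟩
  have : φ u = 0 := hU hu
  simp [this]

theorem exists_nat_smul_eq_one_tmul {M : Type*} [AddCommGroup M] (t : ℚ ⊗[ℤ] M) :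
    ∃ n : ℕ, n ≠ 0 ∧ ∃ m : M, (n : ℚ) • t = 1 ⊗ₜ m := by
  induction t with
  | zero => exact ⟨1, one_ne_zero, 0, by simp⟩
  | add t t' ht ht' =>
    obtain ⟨n, hn, m, hm⟩ := ht
    obtain ⟨n', hn', m', hm'⟩ := ht'
    refine ⟨n * n', mul_ne_zero hn hn', (n' : ℤ) • m + (n : ℤ) • m', ?_⟩
    have h1 : ∀ (k : ℕ) (m : M), (1 : ℚ) ⊗ₜ[ℤ] ((k : ℤ) • m) = (k : ℚ) • ((1 : ℚ) ⊗ₜ[ℤ] m) := by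
      intro k m
      rw [← TensorProduct.smul_tmul, TensorProduct.smul_tmul']
      simp
    rw [TensorProduct.tmul_add, h1, h1, ← hm, ← hm', smul_add, smul_smul, smul_smul]
    push_cast
    rw [mul_comm (n' : ℚ)]
  | tmul q x =>
    refine ⟨q.den, q.den_ne_zero, q.num • x, ?_⟩
    rw [TensorProduct.smul_tmul', smul_eq_mul, Rat.den_mul_eq_num, ← TensorProduct.smul_tmul]
    simp

end Division

namespace ComplexTorus

section Wedge

variable {V : Type v} [NormedAddCommGroup V] [NormedSpace ℂ V]

/-- The wedge product of two linear functionals. -/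
noncomputable def wedge (φ ψ : Module.Dual ℂ V) : H2C V :=
  H2C.ofBilin (LinearMap.mk₂ ℝ (fun x y => φ x * ψ y - φ y * ψ x)
    (fun x x' y => by simp only [map_add]; ring)
    (fun r x y => by
      simp only [LinearMap.map_smul_of_tower, Complex.real_smul]; ring)
    (fun x y y' => by simp only [map_add]; ring)
    (fun r x y => by
      simp only [LinearMap.map_smul_of_tower, Complex.real_smul]; ring))
    fun x => sub_self _

theorem wedge_apply (φ ψ : Module.Dual ℂ V) (x y : V) :
    wedge φ ψ ![x, y] = φ x * ψ y - φ y * ψ x := rfl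

theorem wedge_mem_H20 (φ ψ : Module.Dual ℂ V) : wedge φ ψ ∈ H20 V := by
  intro x y
  simp only [wedge_apply, map_smul, smul_eq_mul]
  ring

/-- The form is φ ∧ ψ with φ zero on U' and 1 at x, and ψ zero on U and 1 at y. It serves both to
find nonzero (2,0)-forms with prescribed zeros and to refute that all (2,0)-forms have them. -/
theorem exists_mem_H20 {U U' : Submodule ℂ V} {x y : V} (hx : x ∉ U') (hy : y ∈ U') (hyU : y ∉ U)
    (hU : U ≤ U') : ∃ ω ∈ H20 V, ω ![x, y] = 1 ∧ (∀ u ∈ U', ∀ u' ∈ U', ω ![u, u'] = 0) ∧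
      ∀ u ∈ U, ∀ v, ω ![u, v] = 0 := by
  obtain ⟨φ, hφ, hφU⟩ := exists_dual_eq_one hx
  obtain ⟨ψ, hψ, hψU⟩ := exists_dual_eq_one hyU
  refine ⟨wedge φ ψ, wedge_mem_H20 φ ψ, ?_, fun u hu u' hu' => ?_, fun u hu v => ?_⟩
  · rw [wedge_apply, hφ, hψ, hφU y hy, zero_mul, sub_zero, one_mul]
  · rw [wedge_apply, hφU u hu, hφU u' hu', zero_mul, zero_mul, sub_zero]
  · rw [wedge_apply, hφU u (hU hu), hψU u hu, zero_mul, mul_zero, sub_zero]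

end Wedge

variable {V : Type v} [NormedAddCommGroup V] [NormedSpace ℂ V] [FiniteDimensional ℂ V]
  {Λ : Submodule ℤ V} [DiscreteTopology Λ] [IsZLattice ℝ Λ]

/-- Forms that vanish on the rational vectors of two subspaces vanish on the subspaces. -/
theorem form_eq_zero_of_rational {V₁ V₂ : Submodule ℂ V}
    (h₁ : Submodule.span ℝ ((V₁ : Set V) ∩ (Λ : Set V)) = V₁.restrictScalars ℝ)
    (h₂ : Submodule.span ℝ ((V₂ : Set V) ∩ (Λ : Set V)) = V₂.restrictScalars ℝ) {ω : H2C V}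
    (hω : ∀ w w', latticeMap Λ w ∈ V₁ → latticeMap Λ w' ∈ V₂ →
      ω ![latticeMap Λ w, latticeMap Λ w'] = 0) {x y : V} (hx : x ∈ V₁) (hy : y ∈ V₂) :
    ω ![x, y] = 0 := by
  have hx' : x ∈ Submodule.span ℝ ((V₁ : Set V) ∩ (Λ : Set V)) := by rw [h₁]; exact hx
  have hy' : y ∈ Submodule.span ℝ ((V₂ : Set V) ∩ (Λ : Set V)) := by rw [h₂]; exact hy
  clear hx hy
  induction hx' using Submodule.span_induction with
  | mem x hx =>
    induction hy' using Submodule.span_induction with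
    | mem y hy =>
      have := hω (1 ⊗ₜ ⟨x, hx.2⟩) (1 ⊗ₜ ⟨y, hy.2⟩)
      rw [latticeMap_one_tmul, latticeMap_one_tmul] at this
      exact this hx.1 hy.1
    | zero => exact map_zero (ω.toBilin x)
    | add y y' _ _ ih ih' => rw [H2C.add_right, ih, ih', add_zero]
    | smul r y _ ih => rw [H2C.smul_right, ih, smul_zero]
  | zero => exact LinearMap.congr_fun (map_zero ω.toBilin) y
  | add x x' _ _ ih ih' => rw [H2C.add_left, ih, ih', add_zero]
  | smul r x _ ih => rw [H2C.smul_left, ih, smul_zero]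

/-- The forms for which two subspaces are orthogonal. -/
noncomputable def formsVanishing (V₁ V₂ : Submodule ℂ V) : Submodule ℂ (H2C V) where
  carrier := {ω | ∀ x ∈ V₁, ∀ y ∈ V₂, ω ![x, y] = 0}
  add_mem' hω hη x hx y hy := by
    rw [AlternatingMap.add_apply, hω x hx y hy, hη x hx y hy, add_zero]
  zero_mem' _ _ _ _ := rfl
  smul_mem' c ω hω x hx y hy := by
    rw [AlternatingMap.smul_apply, hω x hx y hy, smul_zero]

/-- For subspaces spanned by lattice vectors, orthogonality can be tested on rational vectors and is
unaffected by complex scalars; so 2-simplicity applies to `formsVanishing`. -/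
theorem IsTwoSimple.le_formsVanishing (hT : IsTwoSimple Λ) {V₁ V₂ : Submodule ℂ V}
    (h₁ : Submodule.span ℝ ((V₁ : Set V) ∩ (Λ : Set V)) = V₁.restrictScalars ℝ)
    (h₂ : Submodule.span ℝ ((V₂ : Set V) ∩ (Λ : Set V)) = V₂.restrictScalars ℝ)
    {ω : H2C V} (hω : ω ∈ formsVanishing V₁ V₂) (hω' : ω ∈ H20 V) (hω0 : ω ≠ 0) :
    H20 V ≤ formsVanishing V₁ V₂ := by
  refine hT.le_of_ne_bot (fun ω hω l η hη x hx y hy => ?_) (fun z ω hω x hx y hy => ?_) fun hbot =>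
    hω0 ((Submodule.mem_bot ℂ).1 (hbot ▸ ⟨hω, hω'⟩))
  · refine form_eq_zero_of_rational h₁ h₂ (fun w w' hw hw' => ?_) hx hy
    rw [hη, hω _ hw _ hw', map_zero, Rat.cast_zero]
  · rw [H2C.pull_apply]
    exact hω _ (V₁.smul_mem z hx) _ (V₂.smul_mem z hy)

/-- 2-simple tori of dimension greater than two are simple. -/
theorem IsTwoSimple.isSimple (hT : IsTwoSimple Λ) (hg : 2 < Module.finrank ℂ V) :
    IsSimple Λ := by
  refine ⟨Module.nontrivial_of_finrank_pos (R := ℂ) (by omega), fun V₁ h₁ => ?_⟩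
  by_contra! hne
  obtain ⟨hbot, htop⟩ := hne
  obtain ⟨v, hv, hv0⟩ := V₁.exists_mem_ne_zero_of_ne_bot hbot
  have hnot : ∀ U : Submodule ℂ V, Module.finrank ℂ U < Module.finrank ℂ V → ∃ x, x ∉ U := by
    intro U hU
    by_contra! hall
    rw [(Submodule.eq_top_iff' (p := U)).2 hall, finrank_top] at hU
    exact lt_irrefl _ hU
  have hline : ∀ x : V, Module.finrank ℂ (Submodule.span ℂ {x}) ≤ 1 := fun x =>
    (finrank_span_le_card ({x} : Set V)).trans (by simp)
  have htopR : Submodule.span ℝ (((⊤ : Submodule ℂ V) : Set V) ∩ (Λ : Set V)) =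
      (⊤ : Submodule ℂ V).restrictScalars ℝ := by
    rw [Submodule.top_coe, Set.univ_inter, IsZLattice.span_top]
    rfl
  have hv1 : v ∉ (⊥ : Submodule ℂ V) := hv0
  by_cases hdim : Module.finrank ℂ V₁ + 1 < Module.finrank ℂ V
  -- Codimension at least two: some nonzero (2,0)-form has V₁ in its radical, so all would, although
  -- v ∈ V₁ pairs nontrivially with any vector off its line under some (2,0)-form.
  · obtain ⟨y, hy⟩ := hnot V₁ (by omega)
    obtain ⟨x, hx⟩ := hnot (V₁ ⊔ Submodule.span ℂ {y}) (by
      have := Submodule.finrank_add_le_finrank_add_finrank V₁ (Submodule.span ℂ {y})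
      have := hline y
      omega)
    obtain ⟨ω, hω, hxy, -, hωV⟩ := exists_mem_H20 hx
      (Submodule.mem_sup_right (Submodule.mem_span_singleton_self y)) hy le_sup_left
    have hle := hT.le_formsVanishing h₁ htopR (ω := ω) (fun x hx y _ => hωV x hx y) hω (by
      rintro rfl
      exact zero_ne_one hxy)
    obtain ⟨x', hx'⟩ := hnot (Submodule.span ℂ {v}) (by have := hline v; omega)
    obtain ⟨ω', hω', hxv, -⟩ := exists_mem_H20 hx' (Submodule.mem_span_singleton_self v) hv1 bot_le
    rw [H2C.swap, hle hω' v hv x' trivial, neg_zero] at hxv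
    exact zero_ne_one hxv
  -- Codimension one: V₁ is isotropic for some nonzero (2,0)-form, hence for all; but g > 2 gives
  -- dim V₁ ≥ 2, so some (2,0)-form is nonzero on V₁.
  · obtain ⟨x, hx⟩ : ∃ x, x ∉ V₁ := by
      by_contra! hall
      exact htop ((Submodule.eq_top_iff' (p := V₁)).2 hall)
    obtain ⟨ω, hω, hxv, hωV, -⟩ := exists_mem_H20 hx hv hv1 bot_le
    have hle := hT.le_formsVanishing h₁ h₁ (ω := ω) hωV hω (by
      rintro rfl
      exact zero_ne_one hxv)
    obtain ⟨y, hy, hyv⟩ : ∃ y ∈ V₁, y ∉ Submodule.span ℂ {v} := by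
      by_contra! hall
      have := Submodule.finrank_mono (show V₁ ≤ Submodule.span ℂ {v} from hall)
      have := hline v
      omega
    obtain ⟨ω', hω', hyv', -⟩ := exists_mem_H20 hyv (Submodule.mem_span_singleton_self v) hv1 bot_le
    rw [hle hω' y hy v hv] at hyv'
    exact zero_ne_one hyv'

theorem realificationEquiv_mem_span {U : Submodule ℚ (rationalLattice Λ)}
    {x : ℝ ⊗[ℚ] rationalLattice Λ} (hx : x ∈ U.baseChange ℝ) :
    realificationEquiv Λ x ∈ Submodule.span ℝ (latticeMap Λ '' U) := by
  rw [Submodule.baseChange_eq_span] at hx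
  induction hx using Submodule.span_induction with
  | mem x hx =>
    obtain ⟨u, hu, rfl⟩ := hx
    exact Submodule.subset_span ⟨u, hu, rfl⟩
  | zero => rw [map_zero]; exact zero_mem _
  | add x y _ _ hx hy => rw [map_add]; exact add_mem hx hy
  | smul r x _ hx => rw [map_smul]; exact Submodule.smul_mem _ r hx

theorem mem_baseChange_of_mem_span {U : Submodule ℚ (rationalLattice Λ)}
    {x : V} (hx : x ∈ Submodule.span ℝ (latticeMap Λ '' U)) :
    (realificationEquiv Λ).symm x ∈ U.baseChange ℝ := by
  induction hx using Submodule.span_induction with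
  | mem x hx =>
    obtain ⟨u, hu, rfl⟩ := hx
    rw [latticeMap_apply, LinearEquiv.symm_apply_apply]
    exact Submodule.tmul_mem_baseChange_of_mem 1 hu
  | zero => rw [map_zero]; exact zero_mem _
  | add x y _ _ hx hy => rw [map_add]; exact add_mem hx hy
  | smul r x _ hx => rw [map_smul]; exact Submodule.smul_mem _ r hx

/-- The rational lattice of a simple torus has no stable subspaces. -/
theorem IsSimple.isCircleSimple (hT : IsSimple Λ) : IsCircleSimple (circleHom Λ) := by
  intro U hU
  have hI : ∀ x ∈ Submodule.span ℝ (latticeMap Λ '' U),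
      Complex.I • x ∈ Submodule.span ℝ (latticeMap Λ '' U) := by
    intro x hx
    induction hx using Submodule.span_induction with
    | mem x hx =>
      obtain ⟨u, hu, rfl⟩ := hx
      have h1 := realificationEquiv_mem_span (hU (Circle.exp (Real.pi / 2)) u hu)
      rwa [realificationEquiv_circleHom_tmul, Circle.coe_exp, Complex.ofReal_div,
        Complex.ofReal_ofNat, Complex.exp_pi_div_two_mul_I] at h1
    | zero => rw [smul_zero]; exact zero_mem _
    | add x y _ _ hx hy => rw [smul_add]; exact add_mem hx hy
    | smul r x _ hx => rw [smul_comm]; exact Submodule.smul_mem _ r hx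
  -- The real span of U is a complex subspace because the circle contains i. Clearing denominators
  -- shows that it is spanned by lattice vectors, so it is a subtorus.
  let V₁ : Submodule ℂ V :=
    { carrier := Submodule.span ℝ (latticeMap Λ '' U)
      add_mem' := add_mem
      zero_mem' := zero_mem _
      smul_mem' := fun c x hx => by
        have hc : c • x = c.re • x + c.im • (Complex.I • x) := by
          conv_lhs => rw [← Complex.re_add_im c, add_smul, mul_smul]
          simp
        rw [hc]
        exact add_mem (Submodule.smul_mem _ _ hx) (Submodule.smul_mem _ _ (hI x hx)) }
  have hV₁ : ∀ x, x ∈ V₁ ↔ x ∈ Submodule.span ℝ (latticeMap Λ '' U) := fun _ => Iff.rfl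
  have hspan : Submodule.span ℝ ((V₁ : Set V) ∩ (Λ : Set V)) = V₁.restrictScalars ℝ := by
    refine le_antisymm (Submodule.span_le.2 fun x hx => hx.1)
      (show Submodule.span ℝ (latticeMap Λ '' U) ≤ _ from Submodule.span_le.2 ?_)
    rintro _ ⟨u, hu, rfl⟩
    obtain ⟨n, hn, m, hm⟩ := exists_nat_smul_eq_one_tmul u
    have h1 : (n : ℝ) • latticeMap Λ u = m := by
      rw [← latticeMap_one_tmul Λ m, ← hm, latticeMap_smul, Rat.cast_natCast]
    have h2 : latticeMap Λ u = (n : ℝ)⁻¹ • (m : V) := by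
      rw [← h1, smul_smul, inv_mul_cancel₀ (Nat.cast_ne_zero.2 hn), one_smul]
    rw [h2]
    refine Submodule.smul_mem _ _ (Submodule.subset_span ⟨?_, m.2⟩)
    rw [← h1]
    exact V₁.smul_of_tower_mem _ ((hV₁ _).2 (Submodule.subset_span ⟨u, hu, rfl⟩))
  rcases hT.2 V₁ hspan with h0 | h1
  · left
    rw [eq_bot_iff]
    intro u hu
    have h2 : latticeMap Λ u ∈ V₁ := (hV₁ _).2 (Submodule.subset_span ⟨u, hu, rfl⟩)
    rw [h0, Submodule.mem_bot] at h2
    exact (Submodule.mem_bot ℚ).2 (latticeMap_injective Λ (h2.trans (map_zero _).symm))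
  · right
    by_contra hne
    obtain ⟨w, hw⟩ : ∃ w, w ∉ U := by
      by_contra! hall
      exact hne ((Submodule.eq_top_iff' (p := U)).2 hall)
    -- A rational functional that kills U also kills its real span, which is everything.
    obtain ⟨φ, hφ, hφU⟩ := U.exists_le_ker_of_notMem hw
    have h2 : latticeMap Λ w ∈ V₁ := h1 ▸ Submodule.mem_top
    have h3 := baseChange_apply_eq_zero_of_mem (A := ℝ) φ (fun u hu => hφU hu)
      (mem_baseChange_of_mem_span ((hV₁ _).1 h2))
    rw [latticeMap_apply, LinearEquiv.symm_apply_apply, LinearMap.baseChange_tmul] at h3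
    exact hφ (Module.FaithfullyFlat.tensorProduct_mk_injective (A := ℚ) (B := ℝ) ℚ
      (h3.trans (map_zero (TensorProduct.mk ℚ ℝ ℚ 1)).symm))

end ComplexTorus

/-! ### Forms for which the centre of the endomorphism algebra acts by self-adjoint maps -/

/-- A vector space of dimension at least two over a field extension carries a nonzero alternating
form that is balanced for the extension. -/
theorem exists_balanced_alternating {F W : Type*} [Field F] [Algebra ℚ F] [AddCommGroup W]
    [Module ℚ W] [Module F W] [IsScalarTower ℚ F W] {x y : W}
    (hx : x ≠ 0) (hy : y ∉ Submodule.span F {x}) :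
    ∃ B : LinearMap.BilinForm ℚ W, (∀ w, B w w = 0) ∧
      (∀ (e : F) w w', B (e • w) w' = B w (e • w')) ∧ B ≠ 0 := by
  obtain ⟨l, hl, -⟩ := exists_dual_eq_one (F := ℚ) (U := ⊥) (x := (1 : F)) (by simp)
  obtain ⟨φ, hφ, hφx⟩ := exists_dual_eq_one hy
  obtain ⟨ψ, hψ, -⟩ := exists_dual_eq_one (F := F) (U := ⊥) (x := x) (by simpa using hx)
  -- The form l ∘ (φ ∧ ψ) is balanced because φ ∧ ψ is F-bilinear; at (y, x) its value is l(1) = 1.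
  let B : LinearMap.BilinForm ℚ W := LinearMap.mk₂ ℚ (fun a b => l (φ a * ψ b - φ b * ψ a))
    (fun a a' b => by rw [← map_add, map_add, map_add]; congr 1; ring)
    (fun q a b => by
      rw [LinearMap.map_smul_of_tower, LinearMap.map_smul_of_tower, smul_mul_assoc, mul_smul_comm,
        map_sub, map_smul, map_smul, map_sub, smul_sub])
    (fun a b b' => by rw [← map_add, map_add, map_add]; congr 1; ring)
    (fun q a b => by
      rw [LinearMap.map_smul_of_tower, LinearMap.map_smul_of_tower, smul_mul_assoc, mul_smul_comm,
        map_sub, map_smul, map_smul, map_sub, smul_sub])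
  have hB : ∀ a b, B a b = l (φ a * ψ b - φ b * ψ a) := fun _ _ => rfl
  refine ⟨B, fun w => ?_, fun e w w' => ?_, fun h0 => ?_⟩
  · rw [hB, sub_self, map_zero]
  · rw [hB, hB, map_smul, map_smul, map_smul, map_smul]
    congr 1
    simp only [smul_eq_mul]
    ring
  · have h1 := hB y x
    rw [hφ, hψ, hφx x (Submodule.mem_span_singleton_self x), zero_mul, mul_one, sub_zero, hl, h0]
      at h1
    exact zero_ne_one h1

/-! ### Balanced forms and their Hodge types. -/

namespace ComplexTorus

section Conj

variable {V : Type v} [NormedAddCommGroup V] [NormedSpace ℂ V]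

/-- The complex conjugate of a form. -/
noncomputable def H2C.conj (ω : H2C V) : H2C V :=
  Complex.conjAe.toLinearMap.compAlternatingMap ω

theorem H2C.conj_apply (ω : H2C V) (v : Fin 2 → V) : ω.conj v = starRingEnd ℂ (ω v) := rfl

end Conj

variable {V : Type v} [NormedAddCommGroup V] [NormedSpace ℂ V] [FiniteDimensional ℂ V]
  {Λ : Submodule ℤ V} [DiscreteTopology Λ] [IsZLattice ℝ Λ]

variable (Λ) in
/-- The forms for which the centre of the endomorphism algebra acts by self-adjoint maps. -/
noncomputable def balancedForms : Submodule ℂ (H2C V) where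
  carrier := {ω | ∀ e ∈ circleCenter (circleHom Λ), ∀ w w',
    ω ![latticeMap Λ (e w), latticeMap Λ w'] = ω ![latticeMap Λ w, latticeMap Λ (e w')]}
  add_mem' hω hη e he w w' := by
    rw [AlternatingMap.add_apply, AlternatingMap.add_apply, hω e he, hη e he]
  zero_mem' _ _ _ _ := rfl
  smul_mem' c ω hω e he w w' := by
    rw [AlternatingMap.smul_apply, AlternatingMap.smul_apply, hω e he]

theorem mem_balancedForms {ω : H2C V} (hω : ω ∈ balancedForms Λ)
    {e : Module.End ℚ (rationalLattice Λ)} (he : e ∈ circleCenter (circleHom Λ))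
    {F : Module.End ℂ V} (hF : ∀ w, F (latticeMap Λ w) = latticeMap Λ (e w)) (x y : V) :
    ω ![F x, y] = ω ![x, F y] := by
  have h1 : ω.toBilin ∘ₗ F.restrictScalars ℝ = ω.toBilin.compl₂ (F.restrictScalars ℝ) := by
    refine LinearMap.ext_on_range (v := latticeMap Λ) (span_range_latticeMap Λ) fun w => ?_
    refine LinearMap.ext_on_range (v := latticeMap Λ) (span_range_latticeMap Λ) fun w' => ?_
    show ω ![F _, _] = ω ![_, F _]
    rw [hF, hF]
    exact hω e he w w'
  exact LinearMap.congr_fun (LinearMap.congr_fun h1 x) y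

/-- Elements of the centre act on V by ℂ-linear maps, which commute with the scalar z. -/
theorem pull_mem_balancedForms (z : ℂ) {ω : H2C V} (hω : ω ∈ balancedForms Λ) :
    ω.pull z ∈ balancedForms Λ := by
  intro e he w w'
  obtain ⟨F, hF⟩ := mem_circleCommutant_iff.1 (mem_circleCenter.1 he).1
  rw [H2C.pull_apply, H2C.pull_apply, ← hF, ← hF, ← F.map_smul, ← F.map_smul,
    mem_balancedForms hω he hF]

theorem component_mem_balancedForms {ω : H2C V} (hω : ω ∈ balancedForms Λ) (l : ℂ →ₗ[ℚ] ℚ)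
    {η : H2C V} (hη : ∀ w w', η ![latticeMap Λ w, latticeMap Λ w'] =
      (l (ω ![latticeMap Λ w, latticeMap Λ w']) : ℚ)) : η ∈ balancedForms Λ := by
  intro e he w w'
  rw [hη, hη, hω e he]

/-- If there are no balanced forms of type `(2,0)`, all balanced forms are of type `(1,1)`. -/
theorem balancedForms_le_H11 (hP : balancedForms Λ ⊓ H20 V = ⊥) : balancedForms Λ ≤ H11 V := by
  have h02 : balancedForms Λ ⊓ H02 V = ⊥ := by
    rw [eq_bot_iff]
    rintro ω ⟨hω, hω'⟩
    -- The balance condition concerns real vectors only, so it survives conjugation, which takes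
    -- type (0,2) to type (2,0).
    have h1 : ω.conj ∈ balancedForms Λ ⊓ H20 V := by
      refine ⟨fun e he w w' => ?_, fun x y => ?_⟩
      · rw [H2C.conj_apply, H2C.conj_apply, hω e he]
      · rw [H2C.conj_apply, H2C.conj_apply, hω' x y, map_mul, map_neg, Complex.conj_I, neg_neg]
    rw [hP, Submodule.mem_bot] at h1
    refine (Submodule.mem_bot ℂ).2 (AlternatingMap.ext fun v => ?_)
    have h2 : ω.conj v = 0 := by rw [h1]; rfl
    rw [H2C.conj_apply, map_eq_zero] at h2
    exact h2
  rw [eq_sup_of_pull_mem fun z ω hω => pull_mem_balancedForms (Λ := Λ) z hω, hP, h02, bot_sup_eq,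
    sup_bot_eq]
  exact inf_le_right

/-- If all forms of type `(2,0)` are balanced, the centre of the endomorphism algebra consists of
the rational scalars. -/
theorem exists_eq_smul_one_of_H20_le (hs : IsCircleSimple (circleHom Λ))
    (hg : 2 < Module.finrank ℂ V) (hP : H20 V ≤ balancedForms Λ)
    {e : Module.End ℚ (rationalLattice Λ)} (he : e ∈ circleCenter (circleHom Λ)) :
    ∃ r : ℚ, e = r • (1 : Module.End ℚ (rationalLattice Λ)) := by
  have heD := (mem_circleCenter.1 he).1
  obtain ⟨F, hF⟩ := mem_circleCommutant_iff.1 heD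
  have hline : ∀ x, F x ∈ Submodule.span ℂ {x} := by
    intro x
    by_contra hx
    have hx0 : x ∉ (⊥ : Submodule ℂ V) := by
      intro h0
      rw [Submodule.mem_bot] at h0
      rw [h0, map_zero] at hx
      exact hx (zero_mem _)
    obtain ⟨ω, hω, hxω, -⟩ := exists_mem_H20 hx (Submodule.mem_span_singleton_self x) hx0 bot_le
    -- Balance and alternation give ω(Fx, x) = ω(x, Fx) = -ω(Fx, x), hence zero for every (2,0)-form
    -- ω; so Fx and x are dependent.
    have h1 := mem_balancedForms (hP hω) he hF x x
    rw [ω.swap x, hxω] at h1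
    norm_num at h1
  have : Nontrivial (rationalLattice Λ) := Module.nontrivial_of_finrank_pos (R := ℚ) (by
    rw [finrank_rationalLattice]; omega)
  obtain ⟨w, hw⟩ := exists_ne (0 : rationalLattice Λ)
  obtain ⟨c, hc⟩ := Submodule.mem_span_singleton.1 (hline (latticeMap Λ w))
  rw [hF] at hc
  by_cases him : c.im = 0
  -- A real eigenvalue at w is the coefficient φ(ew), hence rational; by Schur's lemma e equals that
  -- scalar.
  · obtain ⟨φ, hφ, -⟩ := exists_dual_eq_one (F := ℚ) (U := ⊥) (x := w) (by simpa using hw)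
    have hc' : c • latticeMap Λ w = c.re • latticeMap Λ w := by
      conv_lhs => rw [← Complex.re_add_im c, him]
      simp
    rw [hc', ← realificationEquiv_tmul', latticeMap_apply] at hc
    have h1 := congrArg (Module.Dual.baseChange ℝ φ) ((realificationEquiv Λ).injective hc)
    rw [Module.Dual.baseChange_apply_tmul, dual_baseChange_apply_one_tmul, hφ] at h1
    refine ⟨φ (e w), hs.eq_of_apply_eq heD (Subalgebra.smul_mem _ (one_mem _) _) hw
      (latticeMap_injective Λ ?_)⟩
    rw [LinearMap.smul_apply, Module.End.one_apply, latticeMap_smul, latticeMap_apply, ← hc,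
      realificationEquiv_tmul']
    congr 1
    simpa using h1
  · exfalso
    -- For nonreal c, the complex line through w is the real span of w and ew. Then ⟨w, ew⟩ is
    -- stable under the circle, which contradicts dim W = 2g > 2.
    have hdecomp : ∀ z : ℂ, ∃ a b : ℝ, z = a + b * c := fun z =>
      ⟨z.re - z.im / c.im * c.re, z.im / c.im, by
        apply Complex.ext <;> simp [him]⟩
    have hmem : ∀ z : ℂ, (realificationEquiv Λ).symm (z • latticeMap Λ w) ∈
        (Submodule.span ℚ {w, e w}).baseChange ℝ := by
      intro z
      obtain ⟨a, b, rfl⟩ := hdecomp z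
      have h1 : ((a : ℂ) + b * c) • latticeMap Λ w =
          realificationEquiv Λ (a ⊗ₜ w + b ⊗ₜ e w) := by
        rw [map_add, realificationEquiv_tmul', realificationEquiv_tmul', ← hc, add_smul, mul_smul,
          Complex.coe_smul, Complex.coe_smul]
      rw [h1, LinearEquiv.symm_apply_apply]
      exact add_mem (Submodule.tmul_mem_baseChange_of_mem _ (Submodule.subset_span (by simp)))
        (Submodule.tmul_mem_baseChange_of_mem _ (Submodule.subset_span (by simp)))
    rcases hs (Submodule.span ℚ {w, e w}) (fun z u hu => by
      have h1 : ∃ μ : ℂ, latticeMap Λ u = μ • latticeMap Λ w := by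
        obtain ⟨p, q, rfl⟩ := Submodule.mem_span_pair.1 hu
        refine ⟨p + q * c, ?_⟩
        rw [map_add, latticeMap_smul, latticeMap_smul, ← hc, add_smul, mul_smul,
          ← Complex.coe_smul, ← Complex.coe_smul, Complex.ofReal_ratCast, Complex.ofReal_ratCast]
      obtain ⟨μ, hμ⟩ := h1
      rw [← (realificationEquiv Λ).symm_apply_apply ((circleHom Λ z).val _),
        realificationEquiv_circleHom_tmul, hμ, smul_smul]
      exact hmem _) with h0 | h1
    · have : w ∈ Submodule.span ℚ {w, e w} := Submodule.subset_span (by simp)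
      rw [h0, Submodule.mem_bot] at this
      exact hw this
    · classical
      have h2 := finrank_span_finset_le_card (R := ℚ) ({w, e w} : Finset (rationalLattice Λ))
      rw [Set.finrank, Finset.coe_pair, h1, finrank_top, finrank_rationalLattice] at h2
      have h3 := Finset.card_le_two (a := w) (b := e w)
      omega

/-- A rational balanced form of type `(1,1)` gives a form on `Λ_ℚ`. -/
theorem exists_bilin_of_balanced {ω : H2C V} (hω : ω ∈ balancedForms Λ) (hωQ : ω ∈ H2Q Λ)
    (hω11 : ω ∈ H11 V) (hω0 : ω ≠ 0) :
    ∃ B : LinearMap.BilinForm ℚ (rationalLattice Λ), B ≠ 0 ∧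
      (∀ z x y, B.baseChange ℝ ((circleHom Λ z).val x) ((circleHom Λ z).val y) =
        B.baseChange ℝ x y) ∧
      ∀ d ∈ circleCenter (circleHom Λ), ∀ x y, B (d x) y = B x (d y) := by
  have hrat : ∀ w w', ∃ q : ℚ, ω ![latticeMap Λ w, latticeMap Λ w'] = q := by
    intro w w'
    obtain ⟨n, hn, m, hm⟩ := exists_nat_smul_eq_one_tmul w
    obtain ⟨n', hn', m', hm'⟩ := exists_nat_smul_eq_one_tmul w'
    obtain ⟨q, hq⟩ := hωQ m m.2 m' m'.2
    rw [← latticeMap_one_tmul, ← latticeMap_one_tmul Λ m', ← hm, ← hm', latticeMap_smul,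
      latticeMap_smul, H2C.smul_left, H2C.smul_right, Complex.real_smul, Complex.real_smul] at hq
    refine ⟨q / (n * n'), ?_⟩
    have : (n : ℂ) ≠ 0 := Nat.cast_ne_zero.2 hn
    have : (n' : ℂ) ≠ 0 := Nat.cast_ne_zero.2 hn'
    push_cast at hq ⊢
    rw [← hq]
    field_simp
  choose β hβ using hrat
  have hinj : ∀ {p q : ℚ}, (p : ℂ) = q → p = q := fun h => Rat.cast_injective h
  let B : LinearMap.BilinForm ℚ (rationalLattice Λ) := LinearMap.mk₂ ℚ β
    (fun w₁ w₂ w' => hinj (by rw [Rat.cast_add, ← hβ, ← hβ, ← hβ, map_add, H2C.add_left]))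
    (fun q w w' => hinj (by
      rw [← hβ, latticeMap_smul, H2C.smul_left, smul_eq_mul, Rat.cast_mul, ← hβ, Complex.real_smul,
        Complex.ofReal_ratCast]))
    (fun w w₁ w₂ => hinj (by rw [Rat.cast_add, ← hβ, ← hβ, ← hβ, map_add, H2C.add_right]))
    (fun q w w' => hinj (by
      rw [← hβ, latticeMap_smul, H2C.smul_right, smul_eq_mul, Rat.cast_mul, ← hβ, Complex.real_smul,
        Complex.ofReal_ratCast]))
  have hB : ∀ w w', (B w w' : ℂ) = ω ![latticeMap Λ w, latticeMap Λ w'] := fun w w' => (hβ w w').symm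
  have hBR : ∀ x y, ((B.baseChange ℝ x y : ℝ) : ℂ) =
      ω ![realificationEquiv Λ x, realificationEquiv Λ y] := by
    intro x y
    induction x with
    | zero =>
      rw [map_zero, map_zero, LinearMap.zero_apply, Complex.ofReal_zero]
      exact (LinearMap.congr_fun (map_zero ω.toBilin) _).symm
    | add x₁ x₂ h₁ h₂ =>
      rw [map_add, LinearMap.add_apply, Complex.ofReal_add, h₁, h₂, map_add, H2C.add_left]
    | tmul r w =>
      induction y with
      | zero =>
        rw [map_zero, map_zero, Complex.ofReal_zero]
        exact (map_zero (ω.toBilin _)).symm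
      | add x₁ x₂ h₁ h₂ => rw [map_add, Complex.ofReal_add, h₁, h₂, map_add, H2C.add_right]
      | tmul r' w' =>
        rw [LinearMap.BilinForm.baseChange_tmul, realificationEquiv_tmul', realificationEquiv_tmul',
          H2C.smul_left, H2C.smul_right, ← hB, Rat.smul_def, Complex.real_smul, Complex.real_smul]
        push_cast
        ring
  refine ⟨B, fun h0 => hω0 (form_ext (Λ := Λ) fun w w' => ?_), fun z x y => ?_,
    fun d hd x y => hinj ?_⟩
  · rw [← hB, h0]
    simp
  · apply Complex.ofReal_injective
    rw [hBR, hBR, realificationEquiv_circleHom, realificationEquiv_circleHom]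
    generalize realificationEquiv Λ x = x'
    generalize realificationEquiv Λ y = y'
    have hz : ∀ x : V, (z : ℂ) • x = (z : ℂ).re • x + (z : ℂ).im • (Complex.I • x) := fun x => by
      conv_lhs => rw [← Complex.re_add_im (z : ℂ), add_smul, mul_smul]
      simp
    -- For a (1,1)-form, moving i across changes the sign, so the cross terms of ω(zx, zy) cancel
    -- and the rest is |z|² ω(x, y).
    have h1 : ω ![Complex.I • x', y'] = - ω ![x', Complex.I • y'] := by
      rw [← hω11 (Complex.I • x') y', smul_smul, Complex.I_mul_I, neg_one_smul, H2C.neg_left]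
    have h2 : ((z : ℂ).re : ℂ) ^ 2 + ((z : ℂ).im : ℂ) ^ 2 = 1 := by
      have h3 := Circle.normSq_coe z
      rw [Complex.normSq_apply] at h3
      rw [sq, sq]
      exact_mod_cast h3
    rw [hz x', hz y']
    simp only [H2C.add_left, H2C.add_right, H2C.smul_left, H2C.smul_right, h1, hω11 x' y',
      Complex.real_smul]
    linear_combination ω ![x', y'] * h2
  · rw [hB, hB]
    exact hω d hd x y

end ComplexTorus

/-! ### The endomorphism algebra -/

section Inverse

variable {W : Type v} [AddCommGroup W] [Module ℚ W] [FiniteDimensional ℚ W]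
  {h : Circle →* LinearMap.GeneralLinearGroup ℝ (ℝ ⊗[ℚ] W)}

theorem IsCircleSimple.exists_inverse (hs : IsCircleSimple h) {d : Module.End ℚ W}
    (hd : d ∈ circleCommutant h) (hd0 : d ≠ 0) :
    ∃ d' ∈ circleCommutant h, d * d' = 1 ∧ (d ∈ circleCenter h → d' ∈ circleCenter h) := by
  have hsurj := hs.surjective hd hd0
  let e := LinearEquiv.ofBijective d ⟨LinearMap.injective_iff_surjective.2 hsurj, hsurj⟩
  have h1 : d * e.symm.toLinearMap = 1 := LinearMap.ext fun w => e.apply_symm_apply w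
  have h2 : e.symm.toLinearMap * d = 1 := LinearMap.ext fun w => e.symm_apply_apply w
  have hmem : e.symm.toLinearMap ∈ circleCommutant h := by
    intro z
    let u : (Module.End ℝ (ℝ ⊗[ℚ] W))ˣ := ⟨d.baseChange ℝ, e.symm.toLinearMap.baseChange ℝ,
      by rw [← LinearMap.baseChange_mul, h1, LinearMap.baseChange_one],
      by rw [← LinearMap.baseChange_mul, h2, LinearMap.baseChange_one]⟩
    exact Commute.units_inv_right (u := u) (hd z)
  refine ⟨_, hmem, h1, fun hdZ => mem_circleCenter.2 ⟨hmem, fun d' hd' => ?_⟩⟩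
  let u : (Module.End ℚ W)ˣ := ⟨d, e.symm.toLinearMap, h1, h2⟩
  exact (Commute.units_inv_right (u := u) (show Commute d' d from
    (mem_circleCenter.1 hdZ).2 d' hd')).eq

theorem IsCircleSimple.isField_circleCenter [Nontrivial W] (hs : IsCircleSimple h) :
    IsField (circleCenter h) where
  exists_pair_ne := ⟨0, 1, fun h0 => zero_ne_one (α := Module.End ℚ W)
    (congrArg Subtype.val h0)⟩
  mul_comm a b := Subtype.ext ((mem_circleCenter.1 b.2).2 a.1 (mem_circleCenter.1 a.2).1)
  mul_inv_cancel {a} ha := by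
    obtain ⟨d', -, h1, h2⟩ := hs.exists_inverse (mem_circleCenter.1 a.2).1
      fun h0 => ha (Subtype.ext h0)
    exact ⟨⟨d', h2 a.2⟩, Subtype.ext h1⟩

end Inverse

namespace ComplexTorus

variable {V : Type v} [NormedAddCommGroup V] [NormedSpace ℂ V] [FiniteDimensional ℂ V]
  {Λ : Submodule ℤ V} [DiscreteTopology Λ] [IsZLattice ℝ Λ]

/-- If there are no rational balanced forms, `Λ_ℚ` is a one-dimensional vector space over the centre
of the endomorphism algebra. -/
theorem exists_center_apply_eq (hs : IsCircleSimple (circleHom Λ))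
    (hno : ∀ ω ∈ balancedForms Λ, ω ∈ H2Q Λ → ω = 0) {x : rationalLattice Λ} (hx : x ≠ 0)
    (y : rationalLattice Λ) : ∃ e ∈ circleCenter (circleHom Λ), e x = y := by
  by_contra! hne
  have : Nontrivial (rationalLattice Λ) := ⟨x, 0, hx⟩
  let _ : Field (circleCenter (circleHom Λ)) := hs.isField_circleCenter.toField
  have : IsScalarTower ℚ (circleCenter (circleHom Λ)) (rationalLattice Λ) := ⟨fun _ _ _ => rfl⟩
  obtain ⟨B, hB0, hBe, hB⟩ := exists_balanced_alternating (F := circleCenter (circleHom Λ)) hx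
    (y := y) (fun hy => by
      obtain ⟨e, he⟩ := Submodule.mem_span_singleton.1 hy
      exact hne e.1 e.2 he)
  obtain ⟨ω, hωQ, hω⟩ := exists_form_of_bilin B hB0
  have h0 := hno ω (fun e he w w' => by
    rw [hω, hω]
    exact congrArg _ (hBe ⟨e, he⟩ w w')) hωQ
  refine hB (LinearMap.ext fun w => LinearMap.ext fun w' => ?_)
  have h1 := hω w w'
  rw [h0, AlternatingMap.zero_apply] at h1
  exact (Rat.cast_eq_zero.1 h1.symm)

/-- The action of the endomorphism ring on `Λ_ℚ`. -/
noncomputable def endAction (Λ : Submodule ℤ V) : endRing Λ → Module.End ℚ (rationalLattice Λ) :=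
  fun f => ((f.1.restrictScalars ℤ).restrict f.2).baseChange ℚ

theorem latticeMap_endAction (f : endRing Λ) (w : rationalLattice Λ) :
    latticeMap Λ (endAction Λ f w) = f.1 (latticeMap Λ w) := by
  induction w using TensorProduct.induction_on with
  | zero => simp
  | add x y hx hy => simp only [map_add, hx, hy]
  | tmul q x =>
    rw [endAction, LinearMap.baseChange_tmul, latticeMap_tmul, latticeMap_tmul,
      LinearMap.map_smul_of_tower]
    rfl

variable (Λ) in
/-- The action of the endomorphism ring on `Λ_ℚ`, as a ring homomorphism. -/
noncomputable def endActionHom : endRing Λ →+* Module.End ℚ (rationalLattice Λ) where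
  toFun := endAction Λ
  map_one' := LinearMap.ext fun w => latticeMap_injective Λ (by
    rw [latticeMap_endAction]; rfl)
  map_mul' f g := LinearMap.ext fun w => latticeMap_injective Λ (by
    rw [latticeMap_endAction, Module.End.mul_apply, latticeMap_endAction, latticeMap_endAction]
    rfl)
  map_zero' := LinearMap.ext fun w => latticeMap_injective Λ (by
    rw [latticeMap_endAction, LinearMap.zero_apply, map_zero]; rfl)
  map_add' f g := LinearMap.ext fun w => latticeMap_injective Λ (by
    rw [latticeMap_endAction, LinearMap.add_apply, map_add, latticeMap_endAction,
      latticeMap_endAction]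
    rfl)

variable (Λ) in
/-- The action of the endomorphism algebra on `Λ_ℚ`. -/
noncomputable def endAlgebraHom : endAlgebra Λ →ₐ[ℚ] Module.End ℚ (rationalLattice Λ) :=
  Algebra.TensorProduct.lift (Algebra.ofId ℚ _) (endActionHom Λ).toIntAlgHom
    fun x _ => (Algebra.commutes x _ :
      Commute (algebraMap ℚ (Module.End ℚ (rationalLattice Λ)) x) _)

theorem endAlgebraHom_tmul (q : ℚ) (f : endRing Λ) :
    endAlgebraHom Λ (q ⊗ₜ f) = q • endAction Λ f := by
  rw [Algebra.smul_def]
  exact Algebra.TensorProduct.lift_tmul ..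

theorem endAction_injective : Function.Injective (endAction Λ) := fun f g hfg =>
  Subtype.ext (linearMap_ext_latticeMap Λ fun w => by
    rw [← latticeMap_endAction, ← latticeMap_endAction, hfg])

theorem endAlgebraHom_injective : Function.Injective (endAlgebraHom Λ) := by
  rw [injective_iff_map_eq_zero]
  intro t ht
  obtain ⟨n, hn, f, hf⟩ := exists_nat_smul_eq_one_tmul t
  have h1 : endAlgebraHom Λ ((n : ℚ) • t) = 0 := by rw [map_smul, ht, smul_zero]
  rw [hf, endAlgebraHom_tmul, one_smul] at h1
  have h2 : f = 0 := endAction_injective (h1.trans (endActionHom Λ).map_zero.symm)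
  rw [h2, TensorProduct.tmul_zero] at hf
  rw [← one_smul ℚ t, ← inv_mul_cancel₀ (Nat.cast_ne_zero.2 hn : (n : ℚ) ≠ 0), mul_smul, hf,
    smul_zero]

theorem endAlgebraHom_mem (t : endAlgebra Λ) :
    endAlgebraHom Λ t ∈ circleCommutant (circleHom Λ) := by
  induction t using TensorProduct.induction_on with
  | zero => rw [map_zero]; exact zero_mem _
  | add x y hx hy => rw [map_add]; exact add_mem hx hy
  | tmul q f =>
    rw [endAlgebraHom_tmul]
    exact Subalgebra.smul_mem _ (mem_circleCommutant_iff.2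
      ⟨f.1, fun w => (latticeMap_endAction f w).symm⟩) q

/-- The ℂ-linear extension of d preserves Λ after multiplication by a common denominator, which
exists because Λ is finitely generated. -/
theorem exists_endAlgebraHom_eq {d : Module.End ℚ (rationalLattice Λ)}
    (hd : d ∈ circleCommutant (circleHom Λ)) : ∃ t, endAlgebraHom Λ t = d := by
  obtain ⟨F, hF⟩ := mem_circleCommutant_iff.1 hd
  have : FiniteDimensional ℝ V := FiniteDimensional.complexToReal V
  have : Module.Finite ℤ Λ := ZLattice.module_finite ℝ Λ
  obtain ⟨N, hN, hNF⟩ : ∃ N : ℕ, N ≠ 0 ∧ ∀ x ∈ Λ, (N : ℂ) • F x ∈ Λ := by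
    obtain ⟨s, hs⟩ := (Module.Finite.fg_top : (⊤ : Submodule ℤ Λ).FG)
    have h1 : ∀ x : Λ, ∃ n : ℕ, n ≠ 0 ∧ (n : ℂ) • F x ∈ Λ := by
      intro x
      obtain ⟨n, hn, m, hm⟩ := exists_nat_smul_eq_one_tmul (d (1 ⊗ₜ x))
      refine ⟨n, hn, ?_⟩
      have h2 : (n : ℂ) • F x = m := by
        rw [← latticeMap_one_tmul Λ x, hF, ← latticeMap_one_tmul Λ m, ← hm, latticeMap_smul,
          Rat.cast_natCast, Nat.cast_smul_eq_nsmul, Nat.cast_smul_eq_nsmul]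
      rw [h2]
      exact m.2
    choose n hn hnF using h1
    refine ⟨∏ x ∈ s, n x, Finset.prod_ne_zero_iff.2 fun x _ => hn x, fun x hx => ?_⟩
    have key : ∀ y ∈ Submodule.span ℤ (s : Set Λ), ((∏ x ∈ s, n x : ℕ) : ℂ) • F (y : V) ∈ Λ := by
      intro y hy
      induction hy using Submodule.span_induction with
      | mem y hy =>
        obtain ⟨k, hk⟩ := Finset.dvd_prod_of_mem n hy
        rw [hk, mul_comm, Nat.cast_mul, mul_smul, Nat.cast_smul_eq_nsmul]
        exact Λ.smul_of_tower_mem k (hnF y)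
      | zero => simp
      | add y y' _ _ hy hy' =>
        rw [Submodule.coe_add, map_add, smul_add]
        exact add_mem hy hy'
      | smul c y _ hy =>
        rw [Submodule.coe_smul, map_zsmul, smul_comm]
        exact Λ.smul_mem c hy
    exact key ⟨x, hx⟩ (hs ▸ Submodule.mem_top)
  refine ⟨(N : ℚ)⁻¹ ⊗ₜ ⟨(N : ℂ) • F, hNF⟩, ?_⟩
  rw [endAlgebraHom_tmul]
  refine LinearMap.ext fun w => latticeMap_injective Λ ?_
  rw [LinearMap.smul_apply, latticeMap_smul, latticeMap_endAction, LinearMap.smul_apply, hF,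
    Rat.cast_inv, Rat.cast_natCast, Nat.cast_smul_eq_nsmul, ← Nat.cast_smul_eq_nsmul ℝ, smul_smul,
    inv_mul_cancel₀ (Nat.cast_ne_zero.2 hN), one_smul]

variable (Λ) in
/-- The evaluation of the endomorphism algebra at a vector. -/
noncomputable def endEval (w : rationalLattice Λ) : endAlgebra Λ →ₗ[ℚ] rationalLattice Λ :=
  LinearMap.applyₗ w ∘ₗ (endAlgebraHom Λ).toLinearMap

theorem endEval_apply (w : rationalLattice Λ) (t : endAlgebra Λ) :
    endEval Λ w t = endAlgebraHom Λ t w := rfl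

theorem endEval_injective (hs : IsCircleSimple (circleHom Λ)) {w : rationalLattice Λ}
    (hw : w ≠ 0) : Function.Injective (endEval Λ w) := fun t t' htt =>
  endAlgebraHom_injective (hs.eq_of_apply_eq (endAlgebraHom_mem t) (endAlgebraHom_mem t') hw htt)

/-- If the centre of the endomorphism algebra acts transitively, the endomorphism algebra is a field
of the largest possible degree. -/
theorem isField_endAlgebra (hs : IsCircleSimple (circleHom Λ)) {w : rationalLattice Λ}
    (hw : w ≠ 0) (hcyc : ∀ y, ∃ e ∈ circleCenter (circleHom Λ), e w = y) :
    IsField (endAlgebra Λ) ∧ Module.finrank ℚ (endAlgebra Λ) = 2 * Module.finrank ℂ V := by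
  have hcent : ∀ t, endAlgebraHom Λ t ∈ circleCenter (circleHom Λ) := by
    intro t
    obtain ⟨e, he, het⟩ := hcyc (endAlgebraHom Λ t w)
    -- An element of the commutant is determined by its value at w, so each one is the central
    -- element with the same value: the whole algebra is central.
    rwa [← hs.eq_of_apply_eq (mem_circleCenter.1 he).1 (endAlgebraHom_mem t) hw het]
  refine ⟨⟨⟨0, 1, fun h0 => hw ?_⟩, fun a b => endAlgebraHom_injective ?_, fun {a} ha => ?_⟩, ?_⟩
  · have h1 : endEval Λ w 0 = endEval Λ w 1 := by rw [h0]
    rw [map_zero, endEval_apply, map_one] at h1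
    exact h1.symm
  · rw [map_mul, map_mul]
    exact (mem_circleCenter.1 (hcent b)).2 _ (endAlgebraHom_mem a)
  · obtain ⟨d', hd', h1, -⟩ := hs.exists_inverse (endAlgebraHom_mem a)
      fun h0 => ha (endAlgebraHom_injective (h0.trans (map_zero _).symm))
    obtain ⟨b, rfl⟩ := exists_endAlgebraHom_eq hd'
    exact ⟨b, endAlgebraHom_injective (by rw [map_mul, h1, map_one])⟩
  · rw [← finrank_rationalLattice Λ]
    refine (LinearEquiv.ofBijective (endEval Λ w) ⟨endEval_injective hs hw, fun y => ?_⟩).finrank_eq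
    obtain ⟨e, he, hey⟩ := hcyc y
    obtain ⟨t, rfl⟩ := exists_endAlgebraHom_eq (mem_circleCenter.1 he).1
    exact ⟨t, hey⟩

/-- If the endomorphism algebra is a field of the largest possible degree, the Hodge group is
commutative. -/
theorem isCommutative_hodgeGroup (hs : IsCircleSimple (circleHom Λ)) {w : rationalLattice Λ}
    (hw : w ≠ 0) (hF : IsField (endAlgebra Λ))
    (hdim : Module.finrank ℚ (endAlgebra Λ) = 2 * Module.finrank ℂ V) :
    (hodgeGroup Λ).IsCommutative := by
  have : FiniteDimensional ℚ (endAlgebra Λ) :=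
    FiniteDimensional.of_injective (endEval Λ w) (endEval_injective hs hw)
  rw [← finrank_rationalLattice Λ] at hdim
  have hsurj := (LinearMap.injective_iff_surjective_of_finrank_eq_finrank hdim).1
    (endEval_injective hs hw)
  refine isCommutative_of_cyclic (isAnalyticUnimodular_circleHom Λ) (isLeast_hodgeGroup Λ)
    (fun d hd d' hd' => ?_) (w₀ := w) fun y => ?_
  · obtain ⟨t, rfl⟩ := exists_endAlgebraHom_eq hd
    obtain ⟨t', rfl⟩ := exists_endAlgebraHom_eq hd'
    rw [← map_mul, ← map_mul, hF.mul_comm]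
  · obtain ⟨t, ht⟩ := hsurj y
    exact ⟨_, endAlgebraHom_mem t, ht⟩

/-- The Hodge group of a 2-simple torus is semisimple or the endomorphism algebra is a field of the
largest possible degree. -/
theorem isSemisimple_or_isField (hT : IsTwoSimple Λ) (hg : 2 < Module.finrank ℂ V)
    (hs : IsCircleSimple (circleHom Λ)) :
    (hodgeGroup Λ).IsSemisimple ∨
      IsField (endAlgebra Λ) ∧ Module.finrank ℚ (endAlgebra Λ) = 2 * Module.finrank ℂ V := by
  have hh := isAnalyticUnimodular_circleHom Λ
  have hG := isLeast_hodgeGroup Λ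
  have hpos : 0 < Module.finrank ℚ (rationalLattice Λ) := by
    rw [finrank_rationalLattice]
    omega
  have : Nontrivial (rationalLattice Λ) := Module.nontrivial_of_finrank_pos hpos
  by_cases hP : balancedForms Λ ⊓ H20 V = ⊥
  · have h11 := balancedForms_le_H11 hP
    -- Without rational balanced forms, W is a line over the centre; with a nonzero one, the centre
    -- of the group has exponent two.
    by_cases hno : ∀ ω ∈ balancedForms Λ, ω ∈ H2Q Λ → ω = 0
    · obtain ⟨w, hw⟩ := exists_ne (0 : rationalLattice Λ)
      exact Or.inr (isField_endAlgebra hs hw (exists_center_apply_eq hs hno hw))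
    · push Not at hno
      obtain ⟨ω, hω, hωQ, hω0⟩ := hno
      obtain ⟨B, hB0, hB, hBe⟩ := exists_bilin_of_balanced hω hωQ (h11 hω) hω0
      exact Or.inl (isSemisimple_of_forall_central hh hG hs two_pos fun L _ _ _ _ a ha hcent =>
        sq_eq_one_of_form hh hG (fun d hd hd0 => hs.surjective (mem_circleCenter.1 hd).1 hd0)
          hB0 hB hBe ha hcent)
  -- Here 2-simplicity makes all (2,0)-forms balanced, so the centre of the endomorphism algebra is
  -- ℚ.
  · have hle := hT.le_of_ne_bot (fun ω hω l η hη => component_mem_balancedForms hω l hη)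
      (fun z ω hω => pull_mem_balancedForms z hω) hP
    exact Or.inl (isSemisimple_of_forall_central hh hG hs hpos fun L _ _ _ _ a ha hcent =>
      pow_finrank_eq_one_of_scalar hh hG
        (fun d hd => exists_eq_smul_one_of_H20_le hs hg hle hd) ha hcent)

end ComplexTorus

theorem mainTheorem8 {V : Type*} [NormedAddCommGroup V] [NormedSpace ℂ V]
    [FiniteDimensional ℂ V] (Λ : Submodule ℤ V) [DiscreteTopology Λ] [IsZLattice ℝ Λ]
    (hg : 2 < Module.finrank ℂ V) (hT : ComplexTorus.IsTwoSimple Λ) :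
    ComplexTorus.IsSimple Λ ∧
      Xor (ComplexTorus.hodgeGroup Λ).IsSemisimple (ComplexTorus.hodgeGroup Λ).IsCommutative ∧
      ((ComplexTorus.hodgeGroup Λ).IsCommutative ↔
        IsField (ComplexTorus.endAlgebra Λ) ∧
          Module.finrank ℚ (ComplexTorus.endAlgebra Λ) = 2 * Module.finrank ℂ V) := by
  have hsimple := hT.isSimple hg
  have hs := hsimple.isCircleSimple
  have hdim : 1 < Module.finrank ℚ (ComplexTorus.rationalLattice Λ) := by
    rw [ComplexTorus.finrank_rationalLattice]
    omega
  have : Nontrivial (ComplexTorus.rationalLattice Λ) :=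
    Module.nontrivial_of_finrank_pos (R := ℚ) (by omega)
  obtain ⟨w, hw⟩ := exists_ne (0 : ComplexTorus.rationalLattice Λ)
  have hnot : (ComplexTorus.hodgeGroup Λ).IsSemisimple →
      ¬ (ComplexTorus.hodgeGroup Λ).IsCommutative :=
    not_isCommutative_of_isSemisimple (ComplexTorus.isAnalyticUnimodular_circleHom Λ)
      (ComplexTorus.isLeast_hodgeGroup Λ) hs hdim
  have hcomm : IsField (ComplexTorus.endAlgebra Λ) ∧
      Module.finrank ℚ (ComplexTorus.endAlgebra Λ) = 2 * Module.finrank ℂ V →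
        (ComplexTorus.hodgeGroup Λ).IsCommutative := fun h1 =>
    ComplexTorus.isCommutative_hodgeGroup hs hw h1.1 h1.2
  have hor := ComplexTorus.isSemisimple_or_isField hT hg hs
  refine ⟨hsimple, ?_, fun h1 => hor.resolve_left fun h2 => hnot h2 h1, hcomm⟩
  rcases hor with h1 | h1
  · exact Or.inl ⟨h1, hnot h1⟩
  · exact Or.inr ⟨hcomm h1, fun h2 => hnot h2 (hcomm h1)⟩
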